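/- **Notation.** Let $d\in\mathbb N$ ($d\ge 1$), $I^d=(0,1)^d$, $\mathfrak e=(1,\dots,1)$, $\mathbb Z_+=\{0,1,2,\dots\}$, $t_+=\max(t,0)$. Operations, powers, binomial coefficients and inequalities for vectors are coordinatewise; $xA=\{(x_1y_1,\dots,x_dy_d):y\in A\}$, $a^x=\prod_j a_j^{x_j}$, $2^{\kappa}=(2^{\kappa_1},\dots,2^{\kappa_d})$, $(x,y)=\sum_j x_jy_j$, $\mathfrak s(x)=\{j:x_j\ne 0\}$, and $\chi_J$ is the indicator vector of $J\subset\{1,\dots,d\}$. $\mathcal D^\lambda$ denotes the generalized (weak) derivative. All functions are real-valued. *Averaged mixed modulus.* For $D\subset\mathbb R^d$ open, $l\in\mathbb Z_+^d$, $h\in\mathbb R^d$, put $D_h^l=\{x\in D: x+tlh\in D\ \ \forall t\in[0,1]^d\}$ and $(\Delta_h^lf)(x)=\sum_{0\le k\le l}\prod_j(-1)^{l_j-k_j}\binom{l_j}{k_j}\,f(x+kh)$ for $x\in D_h^l$. For $1\le p<\infty$, $f\in L_p(D)$, $t_j>0$ and $J=\mathfrak s(l)$, $$\Omega'^{\,l}(f,t^{J})_{L_p(D)}=\Bigl(\prod_{j\in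 J}(2t_j)^{-1}\int_{\{(\xi_j)_{j\in J}:\,|\xi_j|\le t_j\}}\|\Delta_\xi^lf\|_{L_p(D_\xi^l)}^p\,\prod_{j\in J}d\xi_j\Bigr)^{1/p}$$ (only the coordinates of $\xi$ and $t$ with index in $J$ matter; for $J=\emptyset$, i.e. $l=0$, this is $\|f\|_{L_p(D)}$). *Local projectors.* Let $\pi_n$ ($n\in\mathbb Z_+$) be the polynomials of degree $n$ that are orthonormal in $L_2(0,1)$. For $l\in\mathbb Z_+^d$, $\delta\in(0,\infty)^d$, $x^0\in\mathbb R^d$, $Q=x^0+\delta I^d$ and $f\in L_1(Q)$, put $$(P^{d,l}_{\delta,x^0}f)(x)=\delta^{-\mathfrak e}\sum_{0\le\mu\le l}\Bigl(\int_Q f(y)\prod_j\pi_{\mu_j}\bigl(\tfrac{y_j-x^0_j}{\delta_j}\bigr)dy\Bigr)\prod_j\pi_{\mu_j}\bigl(\tfrac{x_j-x^0_j}{\delta_j}\bigr),\qquad x\in\mathbb R^d,$$ the ($L_2(Q)$-orthogonal) projection onto the polynomials of degree at most $l_j$ in each $x_j$. *B-splines.* $\psi^{1,0}=\chi_{(0,1)}$,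 $\psi^{1,m}(x)=\int_0^1\psi^{1,m-1}(x-y)\,dy$ for $m\ge1$, and, for $m,\kappa\in\mathbb Z_+^d$, $\nu\in\mathbb Z^d$, $g^{d,m}_{\kappa,\nu}(x)=\prod_j\psi^{1,m_j}(2^{\kappa_j}x_j-\nu_j)$. For $m\in\mathbb Z_+$ put $a^m_\mu=2^{-m}\binom{m+1}{\mu}$, $0\le\mu\le m+1$. *The operators $\mathcal E_\kappa^{d,l,m,\mathbb R}$.* Let $l,\kappa\in\mathbb Z_+^d$, $m\in\mathbb N^d$, and let $\mathcal N_{-m,2^\kappa-\mathfrak e}=\{\nu\in\mathbb Z^d:-m\le\nu\le 2^\kappa-\mathfrak e\}$. Put $Q^{d,m}=-(m+\mathfrak e)+(2m+3\mathfrak e)I^d$. For $f$ locally integrable on $\mathbb R^d$ and $\nu\in\mathbb Z^d$ with $0\le\nu\le2^\kappa-\mathfrak e$, let $$\mathcal S_{\kappa,\nu}f=\chi_{Q^{d,m}}\cdot P^{d,l}_{2^{-\kappa},\,2^{-\kappa}\nu}\bigl(f|_{2^{-\kappa}\nu+2^{-\kappa}I^d}\bigr).$$ For $\nu\in\mathcal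 N_{-m,2^\kappa-\mathfrak e}$ let $\nu_\kappa(\nu)=(2^\kappa-m-\mathfrak e)_+-(2^\kappa-m-\mathfrak e-\nu_+)_+$, and for $\epsilon\in\{0,1\}^d$ with $\mathfrak s(\epsilon)\subset\mathfrak s(\kappa)$ let $\mathrm P_{\kappa,\nu,\epsilon}$ be the set of all $\rho\in\mathcal N_{-m,2^{\kappa-\epsilon}-\mathfrak e}$ such that $\rho_j=\nu_j$ for $j\notin\mathfrak s(\epsilon)$ and $0\le\nu_j-2\rho_j\le m_j+1$ for $j\in\mathfrak s(\epsilon)$. Put $$U_{\kappa,\nu}f=\sum_{\epsilon\in\{0,1\}^d:\ \mathfrak s(\epsilon)\subset\mathfrak s(\kappa)}\ \prod_j(-1)^{\epsilon_j}\sum_{\rho\in\mathrm P_{\kappa,\nu,\epsilon}}\Bigl(\prod_{j\in\mathfrak s(\epsilon)}a^{m_j}_{\nu_j-2\rho_j}\Bigr)\,\mathcal S_{\kappa-\epsilon,\,\nu_{\kappa-\epsilon}(\rho)}f, \qquad \mathcal E_\kappa^{d,l,m,\mathbb R}f=\sum_{\nu\in\mathcal N_{-m,2^\kappa-\mathfrak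 e}}g^{d,m}_{\kappa,\nu}\,U_{\kappa,\nu}f .$$ For a function $f$ on $I^d$ let $\mathcal If$ be its extension by zero to $\mathbb R^d$. **Proposition.** Let $d\in\mathbb N$ and $m\in\mathbb N^d$ (all $m_j\ge1$). There is a constant $c_2=c_2(d,m)>0$ such that for all $l\in\mathbb N^d$ (all $l_j\ge1$), all $\lambda\in\mathbb Z_+^d$ with $\lambda\le m$, and all $1\le p<\infty$, $1\le q\le\infty$ there is a constant $c_1=c_1(d,l,m,\lambda,p,q)>0$ such that for every $\kappa\in\mathbb Z_+^d$ and every $f\in L_p(I^d)$ the weak derivative $\mathcal D^\lambda\mathcal E_\kappa^{d,l-\mathfrak e,m,\mathbb R}(\mathcal If)$ exists, belongs to $L_q(\mathbb R^d)$, and $$\bigl\|\mathcal D^\lambda\mathcal E_\kappa^{d,l-\mathfrak e,m,\mathbb R}(\mathcal If)\bigr\|_{L_q(\mathbb R^d)}\le c_1\,2^{(\kappa,\ \lambda+(p^{-1}-q^{-1})_+\mathfrak e)}\ \Omega'^{\,l\chi_{\mathfrak s(\kappa)}}\bigl(f,(c_2 2^{-\kappa})^{\mathfrak s(\kappa)}\bigr)_{L_p(I^d)}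 .$$ -/

import Mathlib

open MeasureTheory
open scoped ENNReal ContDiff

noncomputable section

namespace MixedModulus

/-! ### Cells and the unit cube -/

/-- The open cell `x⁰ + δ·(0,1)ᵈ`. -/
def cell {d : ℕ} (x₀ δ : Fin d → ℝ) : Set (Fin d → ℝ) :=
  Set.pi Set.univ fun j => Set.Ioo (x₀ j) (x₀ j + δ j)

/-- The open unit cube `Iᵈ = (0,1)ᵈ`. -/
def unitCube (d : ℕ) : Set (Fin d → ℝ) := Set.pi Set.univ fun _ => Set.Ioo 0 1

/-- The support `𝔰(κ)` of a vector of natural numbers: the set of coordinates where it is non-zero. -/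
def supp {d : ℕ} (κ : Fin d → ℕ) : Finset (Fin d) := Finset.univ.filter fun j => κ j ≠ 0

/-- `l · χ_J`: the vector `l` with the coordinates outside `J` replaced by `0`. -/
def restrictTo {d : ℕ} (l : Fin d → ℕ) (J : Finset (Fin d)) : Fin d → ℕ :=
  fun j => if j ∈ J then l j else 0

/-! ### Orthonormal polynomials on `(0,1)` -/

/-- The integral of a polynomial over the interval `(0,1)`. -/
def polyInt (P : Polynomial ℝ) : ℝ := ∫ x in Set.Ioo (0 : ℝ) 1, P.eval x

/-- Gram–Schmidt applied to the monomials in `L₂(0,1)`, without normalization. -/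
def orthPoly : ℕ → Polynomial ℝ
  | n => Polynomial.X ^ n - ∑ k : Fin n,
      Polynomial.C (polyInt (Polynomial.X ^ n * orthPoly k) / polyInt (orthPoly k * orthPoly k)) *
        orthPoly k

/-- The polynomials `πₙ`: `πₙ` has degree `n`, is orthogonal in `L₂(0,1)` to all polynomials of
smaller degree, and has norm one in `L₂(0,1)` (see `natDegree_orthonormalPoly` and
`polyInt_orthonormalPoly`). -/
def orthonormalPoly (n : ℕ) : Polynomial ℝ :=
  Polynomial.C (Real.sqrt (polyInt (orthPoly n * orthPoly n)))⁻¹ * orthPoly n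

lemma integrableOn_poly (P : Polynomial ℝ) :
    IntegrableOn (fun x => P.eval x) (Set.Ioo (0 : ℝ) 1) :=
  (P.continuous.integrableOn_Icc (a := 0) (b := 1)).mono_set Set.Ioo_subset_Icc_self

lemma polyInt_sub (P Q : Polynomial ℝ) : polyInt (P - Q) = polyInt P - polyInt Q := by
  simp only [polyInt, Polynomial.eval_sub]
  exact integral_sub (integrableOn_poly P) (integrableOn_poly Q)

lemma polyInt_sum {ι : Type*} (s : Finset ι) (P : ι → Polynomial ℝ) :
    polyInt (∑ i ∈ s, P i) = ∑ i ∈ s, polyInt (P i) := by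
  simp only [polyInt, Polynomial.eval_finsetSum]
  exact integral_finsetSum _ fun i _ => integrableOn_poly (P i)

lemma polyInt_C_mul (c : ℝ) (P : Polynomial ℝ) :
    polyInt (Polynomial.C c * P) = c * polyInt P := by
  simp only [polyInt, Polynomial.eval_mul, Polynomial.eval_C]
  exact integral_const_mul _ _

lemma polyInt_mul_self_pos {P : Polynomial ℝ} (hP : P ≠ 0) : 0 < polyInt (P * P) := by
  have h0 : 0 ≤ polyInt (P * P) := by
    simp only [polyInt, Polynomial.eval_mul]
    exact integral_nonneg fun x => mul_self_nonneg _
  refine lt_of_le_of_ne h0 fun h => hP ?_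
  have h1 : polyInt (P * P) = 0 := h.symm
  rw [polyInt, integral_eq_zero_iff_of_nonneg
    (fun x => (mul_self_nonneg (P.eval x)).trans_eq Polynomial.eval_mul.symm)
    (integrableOn_poly _)] at h1
  have h2 : Set.EqOn (fun x => (P * P).eval x) 0 (Set.Ioo 0 1) :=
    Measure.eqOn_open_of_ae_eq h1 isOpen_Ioo (P * P).continuous.continuousOn
      continuousOn_const
  have h3 : (P * P) = 0 := by
    refine Polynomial.eq_zero_of_infinite_isRoot _ ((Set.Ioo_infinite (zero_lt_one' ℝ)).mono ?_)
    intro x hx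
    exact h2 hx
  exact mul_self_eq_zero.mp h3

lemma degree_orthPoly (n : ℕ) : (orthPoly n).degree = n := by
  induction n using Nat.strong_induction_on with
  | _ n ih =>
    rw [orthPoly, Polynomial.degree_sub_eq_left_of_degree_lt, Polynomial.degree_X_pow]
    rw [Polynomial.degree_X_pow]
    refine lt_of_le_of_lt (Polynomial.degree_sum_le _ _) ?_
    refine (Finset.sup_lt_iff (WithBot.bot_lt_coe n)).2 ?_
    intro k _
    rw [← Polynomial.smul_eq_C_mul]
    refine lt_of_le_of_lt (Polynomial.degree_smul_le _ _) ?_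
    rw [ih k k.2]
    exact Nat.cast_lt.2 k.2

lemma orthPoly_ne_zero (n : ℕ) : orthPoly n ≠ 0 := by
  intro h
  have := degree_orthPoly n
  simp [h] at this

lemma polyInt_orthPoly_of_lt (n : ℕ) : ∀ k < n, polyInt (orthPoly n * orthPoly k) = 0 := by
  induction n using Nat.strong_induction_on with
  | _ n ih =>
    intro k hk
    have hpos := polyInt_mul_self_pos (orthPoly_ne_zero k)
    rw [orthPoly, sub_mul, polyInt_sub, Finset.sum_mul, polyInt_sum,
      Finset.sum_eq_single (⟨k, hk⟩ : Fin n)]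
    · rw [mul_assoc, polyInt_C_mul, div_mul_cancel₀ _ hpos.ne', sub_self]
    · intro i _ hi
      have hne : (i : ℕ) ≠ k := fun h => hi (Fin.ext h)
      rw [mul_assoc, polyInt_C_mul]
      rcases lt_or_gt_of_ne hne with h | h
      · rw [mul_comm (orthPoly i) (orthPoly k), ih k hk i h, mul_zero]
      · rw [ih i i.2 k h, mul_zero]
    · intro h
      exact absurd (Finset.mem_univ _) h

theorem natDegree_orthonormalPoly (n : ℕ) : (orthonormalPoly n).natDegree = n := by
  have hpos := polyInt_mul_self_pos (orthPoly_ne_zero n)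
  rw [orthonormalPoly, Polynomial.natDegree_C_mul (inv_ne_zero (Real.sqrt_pos.2 hpos).ne')]
  exact Polynomial.natDegree_eq_of_degree_eq_some (degree_orthPoly n)

theorem polyInt_orthonormalPoly (n k : ℕ) :
    polyInt (orthonormalPoly n * orthonormalPoly k) = if n = k then 1 else 0 := by
  have e : orthonormalPoly n * orthonormalPoly k =
      Polynomial.C (Real.sqrt (polyInt (orthPoly n * orthPoly n)))⁻¹ *
      (Polynomial.C (Real.sqrt (polyInt (orthPoly k * orthPoly k)))⁻¹ *
        (orthPoly n * orthPoly k)) := by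
    simp only [orthonormalPoly]; ring
  rw [e, polyInt_C_mul, polyInt_C_mul]
  split_ifs with h
  · subst h
    have hpos := polyInt_mul_self_pos (orthPoly_ne_zero n)
    have hs := (Real.sqrt_pos.2 hpos).ne'
    rw [← mul_assoc, ← mul_inv, Real.mul_self_sqrt hpos.le, inv_mul_cancel₀ hpos.ne']
  · rcases lt_or_gt_of_ne h with h | h
    · rw [mul_comm (orthPoly n) (orthPoly k), polyInt_orthPoly_of_lt k n h]; simp
    · rw [polyInt_orthPoly_of_lt n k h]; simp

/-! ### The local polynomial projector -/

/-- The product polynomial `∏ⱼ π_{μⱼ}((xⱼ - x⁰ⱼ)/δⱼ)`. -/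
def cellBasis {d : ℕ} (δ x₀ : Fin d → ℝ) (μ : Fin d → ℕ) (x : Fin d → ℝ) : ℝ :=
  ∏ j, (orthonormalPoly (μ j)).eval ((x j - x₀ j) / δ j)

/-- The projector `P_{δ,x⁰}^{d,l}`: the orthogonal projection in `L₂` of the cell `x⁰ + δ Iᵈ`,
extended to `L₁` of the cell, onto the polynomials of degree at most `lⱼ` in each variable `xⱼ`,
written in the orthonormal basis; its values are polynomials on the whole space. -/
def localProj {d : ℕ} (l : Fin d → ℕ) (δ x₀ : Fin d → ℝ) (f : (Fin d → ℝ) → ℝ)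
    (x : Fin d → ℝ) : ℝ :=
  (∏ j, δ j)⁻¹ * ∑ μ ∈ Finset.Iic l,
    (∫ y in cell x₀ δ, f y * cellBasis δ x₀ μ y) * cellBasis δ x₀ μ x

/-! ### B-splines -/

/-- `ψ^{1,m}`. -/
def psi : ℕ → ℝ → ℝ
  | 0 => Set.indicator (Set.Ioo 0 1) fun _ => 1
  | m + 1 => fun x => ∫ y in Set.Ioo (0 : ℝ) 1, psi m (x - y)

/-- `g_{κ,ν}^{d,m}(x) = ∏ⱼ ψ^{1,mⱼ}(2^{κⱼ} xⱼ - νⱼ)`. -/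
def spline {d : ℕ} (m κ : Fin d → ℕ) (ν : Fin d → ℤ) (x : Fin d → ℝ) : ℝ :=
  ∏ j, psi (m j) (2 ^ κ j * x j - ν j)

/-- The refinement coefficients `a_μ^m = 2^{-m} C(m+1, μ)`, used for `0 ≤ μ ≤ m + 1`. -/
def refineCoeff (m : ℕ) (μ : ℤ) : ℝ := ((m + 1).choose μ.toNat : ℝ) / 2 ^ m

/-! ### The operators `𝓔_κ^{d,l,m,ℝ}` -/

/-- The large cell `Q^{d,m} = -(m + 𝔢) + (2m + 3𝔢) Iᵈ`. -/
def bigCell {d : ℕ} (m : Fin d → ℕ) : Set (Fin d → ℝ) :=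
  cell (fun j => -((m j : ℝ) + 1)) (fun j => 2 * (m j : ℝ) + 3)

/-- `𝓢_{κ,ν}^{d,l,m,ℝ}`: the local projector for the cell `2^{-κ}ν + 2^{-κ} Iᵈ`, cut off to
`Q^{d,m}`. -/
def opS {d : ℕ} (l m κ : Fin d → ℕ) (ν : Fin d → ℤ) (f : (Fin d → ℝ) → ℝ) :
    (Fin d → ℝ) → ℝ :=
  (bigCell m).indicator
    (localProj l (fun j => ((2 : ℝ) ^ κ j)⁻¹) (fun j => ((2 : ℝ) ^ κ j)⁻¹ * (ν j : ℝ)) f)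

/-- `𝒩_{-m, 2^κ - 𝔢}^d`. -/
def indexBox {d : ℕ} (m κ : Fin d → ℕ) : Finset (Fin d → ℤ) :=
  Finset.Icc (fun j => -(m j : ℤ)) (fun j => 2 ^ κ j - 1)

/-- `ν_κ^{d,m}(ν) = (2^κ - m - 𝔢)₊ - (2^κ - m - 𝔢 - ν₊)₊`. -/
def shiftIndex {d : ℕ} (m κ : Fin d → ℕ) (ν : Fin d → ℤ) : Fin d → ℤ :=
  fun j => max (2 ^ κ j - (m j : ℤ) - 1) 0 - max (2 ^ κ j - (m j : ℤ) - 1 - max (ν j) 0) 0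

/-- The `ε ∈ {0,1}^d` with `𝔰(ε) ⊆ 𝔰(κ)`. For such `ε` one has `ε ≤ κ`, so that `κ - ε` below
is not truncated. -/
def signs {d : ℕ} (κ : Fin d → ℕ) : Finset (Fin d → ℕ) :=
  (Finset.Icc 0 1).filter fun ε => supp ε ⊆ supp κ

/-- The index set `P_{κ,ν,ε}^{d,m}`. -/
def refineSet {d : ℕ} (m κ : Fin d → ℕ) (ν : Fin d → ℤ) (ε : Fin d → ℕ) :
    Finset (Fin d → ℤ) :=
  (indexBox m (κ - ε)).filter fun ρ =>
    (∀ j ∉ supp ε, ρ j = ν j) ∧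
    (∀ j ∈ supp ε, 0 ≤ ν j - 2 * ρ j ∧ ν j - 2 * ρ j ≤ (m j : ℤ) + 1)

/-- `U_{κ,ν}^{d,l,m,ℝ}`. -/
def opU {d : ℕ} (l m κ : Fin d → ℕ) (ν : Fin d → ℤ) (f : (Fin d → ℝ) → ℝ)
    (x : Fin d → ℝ) : ℝ :=
  ∑ ε ∈ signs κ, (∏ j, (-1 : ℝ) ^ ε j) *
    ∑ ρ ∈ refineSet m κ ν ε,
      (∏ j ∈ supp ε, refineCoeff (m j) (ν j - 2 * ρ j)) *
        opS l m (κ - ε) (shiftIndex m (κ - ε) ρ) f x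

/-- `𝓔_κ^{d,l,m,ℝ}`. -/
def opE {d : ℕ} (l m κ : Fin d → ℕ) (f : (Fin d → ℝ) → ℝ) (x : Fin d → ℝ) : ℝ :=
  ∑ ν ∈ indexBox m κ, spline m κ ν x * opU l m κ ν f x

/-- `𝓘 f`: the extension by zero of a function on the unit cube. -/
def zeroExt {d : ℕ} (f : (Fin d → ℝ) → ℝ) : (Fin d → ℝ) → ℝ := (unitCube d).indicator f

/-! ### Mixed differences and the averaged mixed modulus of continuity -/

/-- `D_h^l = {x ∈ D : x + t l h ∈ D for all t ∈ [0,1]^d}`. -/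
def diffDomain {d : ℕ} (D : Set (Fin d → ℝ)) (l : Fin d → ℕ) (h : Fin d → ℝ) :
    Set (Fin d → ℝ) :=
  {x | x ∈ D ∧ ∀ t : Fin d → ℝ, (∀ j, t j ∈ Set.Icc (0 : ℝ) 1) →
    (fun j => x j + t j * (l j : ℝ) * h j) ∈ D}

/-- The mixed difference `Δ_h^l f` of order `l` with step vector `h`. -/
def mixedDiff {d : ℕ} (l : Fin d → ℕ) (h : Fin d → ℝ) (f : (Fin d → ℝ) → ℝ)
    (x : Fin d → ℝ) : ℝ :=
  ∑ k ∈ Finset.Iic l,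
    (∏ j, (-1 : ℝ) ^ (l j - k j) * ((l j).choose (k j) : ℝ)) *
      f (fun j => x j + (k j : ℝ) * h j)

/-- Extension by zero of a vector indexed by a set `J` of coordinates. -/
def extendVec {d : ℕ} (J : Finset (Fin d)) (ξ : J → ℝ) : Fin d → ℝ :=
  fun j => if hj : j ∈ J then ξ ⟨j, hj⟩ else 0

/-- The averaged mixed modulus of continuity `Ω'^l(f, t^{𝔰(l)})_{L_p(D)}`, for `1 ≤ p < ∞`: the
average over `ξ ∈ ∏_{j ∈ 𝔰(l)} [-tⱼ, tⱼ]` of `‖Δ_ξ^l f‖_{L_p(D_ξ^l)}^p`, to the power `1/p`.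
Only the coordinates of `t` and `ξ` in `𝔰(l)` matter. -/
def avgModulus {d : ℕ} (p : ℝ≥0∞) (D : Set (Fin d → ℝ)) (l : Fin d → ℕ)
    (f : (Fin d → ℝ) → ℝ) (t : Fin d → ℝ) : ℝ≥0∞ :=
  (ENNReal.ofReal (∏ j ∈ supp l, (2 * t j)⁻¹) *
    ∫⁻ ξ in {ξ : supp l → ℝ | ∀ j, |ξ j| ≤ t j},
      eLpNorm (mixedDiff l (extendVec (supp l) ξ) f) p
        (volume.restrict (diffDomain D l (extendVec (supp l) ξ))) ^ p.toReal) ^ (1 / p.toReal)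

/-! ### Weak derivatives on `ℝᵈ` -/

/-- The classical partial derivative in the `j`-th variable. -/
def partialDeriv {d : ℕ} (j : Fin d) (φ : (Fin d → ℝ) → ℝ) : (Fin d → ℝ) → ℝ :=
  fun x => fderiv ℝ φ x (Pi.single j 1)

/-- The classical mixed derivative `D^α φ` of order `α` of a smooth function. -/
def multiDeriv {d : ℕ} (α : Fin d → ℕ) (φ : (Fin d → ℝ) → ℝ) : (Fin d → ℝ) → ℝ :=
  (List.finRange d).foldr (fun j ψ => (partialDeriv j)^[α j] ψ) φ

/-- `G` is the generalized (weak) derivative `D^α F` on `ℝᵈ`. -/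
def HasWeakDeriv {d : ℕ} (α : Fin d → ℕ) (F G : (Fin d → ℝ) → ℝ) : Prop :=
  LocallyIntegrable F ∧ LocallyIntegrable G ∧
    ∀ φ : (Fin d → ℝ) → ℝ, ContDiff ℝ ∞ φ → HasCompactSupport φ →
      ∫ x, F x * multiDeriv α φ x = (-1) ^ (∑ j, α j) * ∫ x, G x * φ x

end MixedModulus

end

open MixedModulus

open MeasureTheory MixedModulus
open scoped ENNReal ContDiff

noncomputable section

namespace MixedModulus

/-! ### Bounded measurable functions on the line -/

/-! The operator is a tensor product. A B-spline that does not vanish at `x` forces `x` into the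
large cell, so the cut-off in `opS` is invisible and `opE` is integration against `∏ⱼ opKernel (x j)
(y j)` (`opE_eq`). Each univariate kernel lives on `y ∈ (0,1)`, `|x - y| ≲ 2^{-κ}`, and its `a`-th
derivative in `x` is `O(2^{κ(a+1)})` (`opKernel_ne_zero`, `exists_opKernel_bound`). For `κ ≥ 1` it
also annihilates polynomials in `y` of degree below the given order: the local projectors reproduce
them on every cell and the refinement coefficients sum to one, so the contributions of the levels
`κ` and `κ - 1` cancel (`integral_opKernel_mul_pow`).

The analytic core is `exists_diffRep`. A density `w`, bounded by `M`, supported in an interval of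
length `L` and orthogonal to polynomials of degree `< l`, satisfies `∫ f w = ∫∫ K(z,ξ) (Δ_ξ^l f)(z)
dz dξ` with `|K| ≤ C M / L`, all points used staying in the interval. No smoothness is needed: `w`
is compared with its B-spline averages, and these are differences of the `l`-fold primitive of `w`,
which is compactly supported because the moments vanish. Dually, this is a Whitney-type estimate
with an averaged modulus.

Applying the representation in each coordinate with `κ j ≠ 0`, and a trivial representation of order
`0` in the others, bounds `|D^α E f(x)|` by `∏ 2^{κ_j(α_j+2)}` times the integral of `|Δ_ξ^l f(y)|`
over `|ξ_j|, |y_j - x_j| ≤ T 2^{-κ_j}` (`exists_enorm_opDeriv_le`). With `τ = ∏ 2T 2^{-κ_j}`, Hölder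
and Tonelli give the `L_p` bound. Dropping the localisation in `y` gives a sup bound that is worse
by `τ^{-1/p}`. Interpolation covers `q ≥ p`, and the bounded support of the operator covers `q < p`.

The weak derivative is found by differentiating the kernel. B-splines of order `m` are continuously
differentiable up to order `m - 1`, and the next derivative is bounded with finitely many jumps, so
integration by parts remains valid up to `α = m`. -/

lemma intervalIntegrable_of_bounded {f : ℝ → ℝ} (hf : Measurable f) {M : ℝ}
    (hM : ∀ x, |f x| ≤ M) (a b : ℝ) : IntervalIntegrable f volume a b := by
  rw [intervalIntegrable_iff]
  refine Measure.integrableOn_of_bounded (M := M) ?_ hf.aestronglyMeasurable ?_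
  · simp [Set.uIoc]
  · exact Filter.Eventually.of_forall fun x => hM x

lemma integrable_of_bounded_of_support {f : ℝ → ℝ} (hf : Measurable f) {M a b : ℝ}
    (hM : ∀ x, |f x| ≤ M) (hs : ∀ x, f x ≠ 0 → x ∈ Set.Icc a b) : Integrable f := by
  have h : IntegrableOn f (Set.Icc a b) := by
    refine Measure.integrableOn_of_bounded (M := M) ?_ hf.aestronglyMeasurable ?_
    · simp
    · exact Filter.Eventually.of_forall fun x => hM x
  refine (integrableOn_iff_integrable_of_support_subset ?_).1 h
  intro x hx
  exact hs x hx

/-! ### B-splines -/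

lemma psi_succ (m : ℕ) (x : ℝ) : psi (m + 1) x = ∫ u in (x - 1)..x, psi m u := by
  have h : psi (m + 1) x = ∫ y in (0 : ℝ)..1, psi m (x - y) := by
    rw [intervalIntegral.integral_of_le zero_le_one, integral_Ioc_eq_integral_Ioo]
    rfl
  rw [h, intervalIntegral.integral_comp_sub_left]
  simp

lemma psi_basic (m : ℕ) : Measurable (psi m) ∧ ∀ x, 0 ≤ psi m x ∧ psi m x ≤ 1 := by
  induction m with
  | zero =>
    refine ⟨(measurable_const.indicator measurableSet_Ioo), fun x => ?_⟩
    simp only [psi, Set.indicator]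
    split_ifs <;> simp
  | succ m ih =>
    have hb : ∀ x, |psi m x| ≤ 1 := fun x => by rw [abs_of_nonneg (ih.2 x).1]; exact (ih.2 x).2
    have hi := intervalIntegrable_of_bounded ih.1 hb
    constructor
    · have hc : Continuous fun x => ∫ u in (0 : ℝ)..x, psi m u :=
        intervalIntegral.continuous_primitive (fun a b => hi a b) 0
      have e : psi (m + 1) = fun x => (∫ u in (0 : ℝ)..x, psi m u) -
          ∫ u in (0 : ℝ)..(x - 1), psi m u := by
        funext x
        rw [psi_succ, intervalIntegral.integral_interval_sub_left (hi _ _) (hi _ _)]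
      rw [e]
      exact (hc.sub (hc.comp (continuous_id.sub continuous_const))).measurable
    · intro x
      rw [psi_succ]
      constructor
      · exact intervalIntegral.integral_nonneg (by linarith) fun u _ => (ih.2 u).1
      · refine (intervalIntegral.integral_mono_on (by linarith) (hi _ _)
          (intervalIntegrable_const (c := (1 : ℝ))) fun u _ => (ih.2 u).2).trans ?_
        simp

lemma measurable_psi (m : ℕ) : Measurable (psi m) := (psi_basic m).1

lemma psi_nonneg (m : ℕ) (x : ℝ) : 0 ≤ psi m x := ((psi_basic m).2 x).1

lemma abs_psi_le_one (m : ℕ) (x : ℝ) : |psi m x| ≤ 1 := by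
  rw [abs_of_nonneg (psi_nonneg m x)]; exact ((psi_basic m).2 x).2

lemma intervalIntegrable_psi (m : ℕ) (a b : ℝ) : IntervalIntegrable (psi m) volume a b :=
  intervalIntegrable_of_bounded (measurable_psi m) (abs_psi_le_one m) a b

lemma psi_succ_eq_sub (m : ℕ) (x : ℝ) : psi (m + 1) x = (∫ u in (0 : ℝ)..x, psi m u) -
    ∫ u in (0 : ℝ)..(x - 1), psi m u := by
  rw [psi_succ, intervalIntegral.integral_interval_sub_left
    (intervalIntegrable_psi _ _ _) (intervalIntegrable_psi _ _ _)]

lemma continuous_psi_succ (m : ℕ) : Continuous (psi (m + 1)) := by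
  have hc : Continuous fun x => ∫ u in (0 : ℝ)..x, psi m u :=
    intervalIntegral.continuous_primitive (fun a b => intervalIntegrable_psi m a b) 0
  rw [funext (psi_succ_eq_sub m)]
  exact hc.sub (hc.comp (continuous_id.sub continuous_const))

lemma psi_eq_zero (m : ℕ) {x : ℝ} (hx : x ≤ 0 ∨ (m : ℝ) + 1 ≤ x) : psi m x = 0 := by
  induction m generalizing x with
  | zero =>
    simp only [psi, Set.indicator_apply_eq_zero, Set.mem_Ioo]
    intro h
    rcases hx with hx | hx
    · linarith
    · norm_num at hx; linarith
  | succ m ih =>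
    rw [psi_succ]
    have : ∀ u ∈ Set.uIcc (x - 1) x, psi m u = 0 := by
      intro u hu
      rw [Set.uIcc_of_le (by linarith)] at hu
      refine ih ?_
      push_cast at hx
      rcases hx with hx | hx
      · exact Or.inl (hu.2.trans hx)
      · exact Or.inr (by linarith [hu.1])
    rw [intervalIntegral.integral_congr this]
    simp

lemma integrable_psi (m : ℕ) : Integrable (psi m) := by
  refine integrable_of_bounded_of_support (measurable_psi m) (abs_psi_le_one m)
    (a := 0) (b := m + 1) fun x hx => ?_
  by_contra h
  rw [Set.mem_Icc, not_and_or, not_le, not_le] at h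
  exact hx (psi_eq_zero m (h.imp le_of_lt le_of_lt))

lemma integral_psi (m : ℕ) : ∫ x, psi m x = 1 := by
  induction m with
  | zero => simp [psi, integral_indicator]
  | succ m ih =>
    have h : ∀ x, psi (m + 1) x = ∫ y in Set.Ioo (0 : ℝ) 1, psi m (x - y) := fun x => rfl
    simp_rw [h]
    rw [integral_integral_swap]
    · simp_rw [integral_sub_right_eq_self (fun x => psi m x), ih]
      simp
    · have := (integrable_const (1 : ℝ) (μ := volume.restrict (Set.Ioo (0 : ℝ) 1))).convolution_integrand
        (ContinuousLinearMap.mul ℝ ℝ) (integrable_psi m)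
      simpa [Function.uncurry_def] using this

/-! ### Continuous functions with a derivative off a countable set -/

/-- `e` is continuous and has derivative `e'` off a countable set. -/
def HasDerivOff (e e' : ℝ → ℝ) : Prop :=
  Continuous e ∧ ∃ S : Set ℝ, S.Countable ∧ ∀ x, x ∉ S → HasDerivAt e (e' x) x

lemma HasDerivOff.mul {e e' g g' : ℝ → ℝ} (h : HasDerivOff e e') (k : HasDerivOff g g') :
    HasDerivOff (fun x => e x * g x) (fun x => e' x * g x + e x * g' x) := by
  obtain ⟨h1, S, hS, h2⟩ := h
  obtain ⟨k1, T, hT, k2⟩ := k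
  refine ⟨h1.mul k1, S ∪ T, hS.union hT, fun x hx => ?_⟩
  rw [Set.mem_union, not_or] at hx
  exact (h2 x hx.1).mul (k2 x hx.2)

lemma HasDerivOff.add {e e' g g' : ℝ → ℝ} (h : HasDerivOff e e') (k : HasDerivOff g g') :
    HasDerivOff (fun x => e x + g x) (fun x => e' x + g' x) := by
  obtain ⟨h1, S, hS, h2⟩ := h
  obtain ⟨k1, T, hT, k2⟩ := k
  refine ⟨h1.add k1, S ∪ T, hS.union hT, fun x hx => ?_⟩
  rw [Set.mem_union, not_or] at hx
  exact (h2 x hx.1).add (k2 x hx.2)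

lemma HasDerivOff.const_mul {e e' : ℝ → ℝ} (h : HasDerivOff e e') (c : ℝ) :
    HasDerivOff (fun x => c * e x) (fun x => c * e' x) := by
  obtain ⟨h1, S, hS, h2⟩ := h
  exact ⟨continuous_const.mul h1, S, hS, fun x hx => (h2 x hx).const_mul c⟩

lemma hasDerivOff_zero : HasDerivOff (fun _ => 0) (fun _ => 0) :=
  ⟨continuous_const, ∅, Set.countable_empty, fun x _ => hasDerivAt_const x 0⟩

lemma HasDerivOff.sum {ι : Type*} (s : Finset ι) {e e' : ι → ℝ → ℝ}
    (h : ∀ i ∈ s, HasDerivOff (e i) (e' i)) :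
    HasDerivOff (fun x => ∑ i ∈ s, e i x) (fun x => ∑ i ∈ s, e' i x) := by
  classical
  induction s using Finset.induction_on with
  | empty => simpa using hasDerivOff_zero
  | insert a s ha ih =>
    simp_rw [Finset.sum_insert ha]
    exact (h a (Finset.mem_insert_self a s)).add
      (ih fun i hi => h i (Finset.mem_insert_of_mem hi))

lemma HasDerivOff.comp_affine {e e' : ℝ → ℝ} (h : HasDerivOff e e') {a : ℝ} (ha : a ≠ 0)
    (b : ℝ) : HasDerivOff (fun x => e (a * x - b)) (fun x => a * e' (a * x - b)) := by
  obtain ⟨h1, S, hS, h2⟩ := h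
  have hd : ∀ x, HasDerivAt (fun x : ℝ => a * x - b) a x := fun x => by
    simpa using ((hasDerivAt_id x).const_mul a).sub_const b
  refine ⟨h1.comp (by fun_prop), (fun x => a * x - b) ⁻¹' S, ?_, fun x hx => ?_⟩
  · refine hS.preimage_of_injOn ?_
    intro x _ y _ hxy
    simpa [ha] using hxy
  · have := (h2 (a * x - b) hx).comp x (hd x)
    exact this.congr_deriv (mul_comm _ _)

lemma hasDerivOff_poly (p : Polynomial ℝ) :
    HasDerivOff (fun x => p.eval x) (fun x => (Polynomial.derivative p).eval x) :=
  ⟨p.continuous, ∅, Set.countable_empty, fun x _ => p.hasDerivAt x⟩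

lemma hasDerivOff_psi (m : ℕ) :
    HasDerivOff (psi (m + 1)) (fun x => psi m x - psi m (x - 1)) := by
  -- Only `psi 0` has jumps, at `0` and `1`. The shift by one moves them to `1` and `2`.
  refine ⟨continuous_psi_succ m, {0, 1, 2}, by simp, fun x hx => ?_⟩
  have hca : ∀ y : ℝ, y ≠ 0 → y ≠ 1 → ContinuousAt (psi m) y := by
    intro y h0 h1
    cases m with
    | succ m => exact (continuous_psi_succ m).continuousAt
    | zero =>
      by_cases hy : y ∈ Set.Ioo (0 : ℝ) 1
      · refine (continuousAt_const (y := (1 : ℝ))).congr ?_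
        filter_upwards [isOpen_Ioo.mem_nhds hy] with z hz
        simp [psi, hz.1, hz.2]
      · have hy' : y ∈ (Set.Icc (0 : ℝ) 1)ᶜ := by
          intro h
          exact hy ⟨lt_of_le_of_ne h.1 (Ne.symm h0), lt_of_le_of_ne h.2 h1⟩
        refine (continuousAt_const (y := (0 : ℝ))).congr ?_
        filter_upwards [isClosed_Icc.isOpen_compl.mem_nhds hy'] with z hz
        have : z ∉ Set.Ioo (0 : ℝ) 1 := fun h => hz ⟨h.1.le, h.2.le⟩
        rw [psi, Set.indicator_of_notMem this]
  simp only [Set.mem_insert_iff, Set.mem_singleton_iff, not_or] at hx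
  have hd : ∀ y : ℝ, y ≠ 0 → y ≠ 1 → HasDerivAt (fun x => ∫ u in (0 : ℝ)..x, psi m u) (psi m y) y :=
    fun y h0 h1 => intervalIntegral.integral_hasDerivAt_right (intervalIntegrable_psi _ _ _)
      ((measurable_psi m).stronglyMeasurable.stronglyMeasurableAtFilter) (hca y h0 h1)
  rw [funext (psi_succ_eq_sub m)]
  have h2 := (hd (x - 1) (fun h => hx.2.1 (by linarith)) (fun h => hx.2.2 (by linarith))).comp_sub_const
    x 1
  exact (hd x hx.1 hx.2.1).sub h2

/-- The `a`-th derivative of `psi m`, for `a ≤ m`. -/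
def psiDeriv : ℕ → ℕ → ℝ → ℝ
  | m, 0 => psi m
  -- A default value for orders beyond `m`. It keeps the size and support bounds valid for every
  -- order, while differentiability is claimed only for `a < m`.
  | 0, _ + 1 => 0
  | m + 1, a + 1 => fun x => psiDeriv m a x - psiDeriv m a (x - 1)

lemma psiDeriv_zero (m : ℕ) : psiDeriv m 0 = psi m := by cases m <;> rfl

lemma hasDerivOff_psiDeriv {m a : ℕ} (h : a < m) :
    HasDerivOff (psiDeriv m a) (psiDeriv m (a + 1)) := by
  induction m generalizing a with
  | zero => omega
  | succ m ih =>
    cases a with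
    | zero =>
      have := hasDerivOff_psi m
      simpa [psiDeriv, psiDeriv_zero] using this
    | succ a =>
      have h1 := ih (a := a) (by omega)
      have h2 := (h1.comp_affine one_ne_zero 1).const_mul (-1)
      have h3 := h1.add h2
      simpa [psiDeriv, sub_eq_add_neg] using h3

lemma measurable_psiDeriv (m a : ℕ) : Measurable (psiDeriv m a) := by
  induction m generalizing a with
  | zero => cases a with
    | zero => exact measurable_psi 0
    | succ a => exact measurable_const
  | succ m ih => cases a with
    | zero => exact measurable_psi _
    | succ a => exact (ih a).sub ((ih a).comp (measurable_id.sub_const 1))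

lemma abs_psiDeriv_le (m a : ℕ) (x : ℝ) : |psiDeriv m a x| ≤ 2 ^ a := by
  induction m generalizing a x with
  | zero => cases a with
    | zero => simpa [psiDeriv] using abs_psi_le_one 0 x
    | succ a => simp [psiDeriv]
  | succ m ih => cases a with
    | zero => simpa [psiDeriv] using abs_psi_le_one _ x
    | succ a =>
      simp only [psiDeriv]
      refine (abs_sub _ _).trans ?_
      rw [pow_succ]
      linarith [ih a x, ih a (x - 1)]

lemma psiDeriv_eq_zero (m a : ℕ) {x : ℝ} (hx : x ≤ 0 ∨ (m : ℝ) + 1 ≤ x) :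
    psiDeriv m a x = 0 := by
  induction m generalizing a x with
  | zero => cases a with
    | zero => exact psi_eq_zero 0 hx
    | succ a => rfl
  | succ m ih => cases a with
    | zero => exact psi_eq_zero _ hx
    | succ a =>
      push_cast at hx
      simp only [psiDeriv]
      rw [ih a (by rcases hx with h | h; exacts [Or.inl h, Or.inr (by linarith)]),
        ih a (by rcases hx with h | h; exacts [Or.inl (by linarith), Or.inr (by linarith)]), sub_zero]

/-! ### Iterated primitives and iterated differences -/

/-- The primitive vanishing at the origin. -/
def prim (w : ℝ → ℝ) (y : ℝ) : ℝ := ∫ u in (0 : ℝ)..y, w u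

/-- The iterated backward difference of order `n` with step `c`. -/
def bdiff (c : ℝ) : ℕ → (ℝ → ℝ) → ℝ → ℝ
  | 0, g => g
  | n + 1, g => fun y => bdiff c n g y - bdiff c n g (y - c)

lemma bdiff_succ (c : ℝ) (n : ℕ) (g : ℝ → ℝ) (y : ℝ) :
    bdiff c (n + 1) g y = bdiff c n g y - bdiff c n g (y - c) := rfl

lemma bdiff_eq_sum (c : ℝ) (n : ℕ) (g : ℝ → ℝ) (y : ℝ) :
    bdiff c n g y = ∑ i ∈ Finset.range (n + 1), (-1) ^ i * (n.choose i : ℝ) * g (y - i * c) := by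
  have h : ∀ y, bdiff c n g y = (-1) ^ n * (fwdDiff (-c))^[n] g y := by
    induction n with
    | zero => intro y; simp [bdiff]
    | succ n ih =>
      intro y
      rw [bdiff_succ, Function.iterate_succ_apply', fwdDiff, ih, ih, ← sub_eq_add_neg]
      ring
  rw [h, fwdDiff_iter_eq_sum_shift, Finset.mul_sum]
  refine Finset.sum_congr rfl fun i hi => ?_
  have hi' : i ≤ n := Nat.lt_succ_iff.1 (Finset.mem_range.1 hi)
  obtain ⟨k, rfl⟩ := Nat.exists_eq_add_of_le hi'
  rw [Nat.add_sub_cancel_left]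
  have e : y + i • -c = y - i * c := by simp [sub_eq_add_neg]
  rw [e, zsmul_eq_mul]
  push_cast
  have e2 : ((-1 : ℝ)) ^ (i + k) * (-1) ^ k = (-1) ^ i := by
    rw [pow_add, mul_assoc, ← mul_pow]; simp
  rw [← mul_assoc, ← mul_assoc, e2]

lemma continuous_bdiff {g : ℝ → ℝ} (hg : Continuous g) (c : ℝ) (n : ℕ) :
    Continuous (bdiff c n g) := by
  induction n with
  | zero => exact hg
  | succ n ih => exact ih.sub (ih.comp (by fun_prop))

lemma integral_bdiff {g : ℝ → ℝ} (hg : Continuous g) (c : ℝ) (n : ℕ) (a b : ℝ) :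
    ∫ u in a..b, bdiff c n g u = bdiff c n (prim g) b - bdiff c n (prim g) a := by
  induction n generalizing a b with
  | zero =>
    simp only [bdiff, prim]
    rw [intervalIntegral.integral_interval_sub_left] <;> exact hg.intervalIntegrable _ _
  | succ n ih =>
    simp only [bdiff_succ]
    have hc := continuous_bdiff hg c n
    have hc2 : Continuous fun u => bdiff c n g (u - c) := hc.comp (by fun_prop)
    rw [intervalIntegral.integral_sub (hc.intervalIntegrable _ _) (hc2.intervalIntegrable _ _),
      intervalIntegral.integral_comp_sub_right (fun u => bdiff c n g u), ih, ih]
    ring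

lemma continuous_prim {w : ℝ → ℝ} (hw : ∀ a b, IntervalIntegrable w volume a b) :
    Continuous (prim w) :=
  intervalIntegral.continuous_primitive hw 0

lemma continuous_prim_iterate {w : ℝ → ℝ} (hw : ∀ a b, IntervalIntegrable w volume a b) (n : ℕ) :
    Continuous (prim^[n + 1] w) := by
  induction n with
  | zero => exact continuous_prim hw
  | succ n ih =>
    rw [Function.iterate_succ_apply']
    exact continuous_prim fun a b => ih.intervalIntegrable a b

/-- Averaging against a B-spline turns a function into an iterated difference of an iterated
primitive. -/
lemma integral_mul_psi {w : ℝ → ℝ} (hw : Measurable w) {M : ℝ} (hM : ∀ x, |w x| ≤ M) {c : ℝ}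
    (hc : c ≠ 0) (r : ℕ) (y : ℝ) :
    ∫ σ, w (y - c * σ) * psi r σ = (c ^ (r + 1))⁻¹ * bdiff c (r + 1) (prim^[r + 1] w) y := by
  have hwi := intervalIntegrable_of_bounded hw hM
  induction r generalizing y with
  | zero =>
    have h : ∀ σ, w (y - c * σ) * psi 0 σ =
        (Set.Ioo (0 : ℝ) 1).indicator (fun σ => w (y - c * σ)) σ := fun σ => by
      simp only [psi, Set.indicator]; split_ifs <;> simp
    simp_rw [h]
    rw [integral_indicator measurableSet_Ioo, ← integral_Ioc_eq_integral_Ioo,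
      ← intervalIntegral.integral_of_le zero_le_one, intervalIntegral.integral_comp_sub_mul _ hc]
    simp only [bdiff, zero_add, pow_one, Function.iterate_one, smul_eq_mul, mul_one, mul_zero,
      sub_zero, prim]
    rw [intervalIntegral.integral_interval_sub_left (hwi _ _) (hwi _ _)]
  | succ r ih =>
    have h : ∀ σ, w (y - c * σ) * psi (r + 1) σ =
        ∫ t in Set.Ioo (0 : ℝ) 1, w (y - c * σ) * psi r (σ - t) := fun σ => by
      rw [integral_const_mul]; rfl
    simp_rw [h]
    rw [integral_integral_swap]
    · have h2 : ∀ t, ∫ σ, w (y - c * σ) * psi r (σ - t) =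
          (c ^ (r + 1))⁻¹ * bdiff c (r + 1) (prim^[r + 1] w) (y - c * t) := fun t => by
        rw [← ih, ← integral_add_right_eq_self _ t]
        congr 1; funext σ
        rw [add_sub_cancel_right]
        congr 2; ring
      simp_rw [h2]
      rw [integral_const_mul, ← integral_Ioc_eq_integral_Ioo,
        ← intervalIntegral.integral_of_le zero_le_one,
        intervalIntegral.integral_comp_sub_mul (fun u => bdiff c (r + 1) (prim^[r + 1] w) u) hc,
        integral_bdiff (continuous_prim_iterate hwi r)]
      rw [Function.iterate_succ_apply' prim (r + 1)]
      simp only [mul_one, mul_zero, sub_zero, smul_eq_mul]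
      rw [bdiff_succ c (r + 1), pow_succ c (r + 1), mul_inv]
      ring
    · have h1 := (integrable_const (1 : ℝ) (μ := volume.restrict (Set.Ioo (0 : ℝ) 1))).convolution_integrand
        (ContinuousLinearMap.mul ℝ ℝ) (integrable_psi r)
      have h2 : Integrable (fun q : ℝ × ℝ => psi r (q.1 - q.2))
          (volume.prod (volume.restrict (Set.Ioo (0 : ℝ) 1))) := by
        simpa using h1
      refine h2.bdd_mul (c := M) ?_ (Filter.Eventually.of_forall fun q => hM _)
      exact (hw.comp (by fun_prop)).aestronglyMeasurable

/-- `w` vanishes outside `(0,b)`, is bounded by `M`, and is orthogonal to the polynomials of degree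
less than `s`. -/
structure Vanishing (b : ℝ) (s : ℕ) (M : ℝ) (w : ℝ → ℝ) : Prop where
  meas : Measurable w
  bdd : ∀ x, |w x| ≤ M
  supp : ∀ x, w x ≠ 0 → x ∈ Set.Ioo 0 b
  moments : ∀ n < s, ∫ y, w y * y ^ n = 0

lemma setIntegral_Ioo_eq {b : ℝ} {w : ℝ → ℝ} (hw : ∀ x, w x ≠ 0 → x ∈ Set.Ioo 0 b) (hb : 0 ≤ b) :
    ∫ u in (0 : ℝ)..b, w u = ∫ u, w u := by
  rw [intervalIntegral.integral_of_le hb, integral_Ioc_eq_integral_Ioo]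
  exact setIntegral_eq_integral_of_forall_compl_eq_zero fun x hx => by
    by_contra h; exact hx (hw x h)

/-- The zeroth moment makes the primitive vanish again to the right of `b`. Integration by parts
turns its `n`-th moment into a multiple of the `(n+1)`-st moment of `w`, so each primitive costs one
moment and a factor `b`. -/
lemma Vanishing.prim {b : ℝ} (hb : 0 < b) {s : ℕ} {M : ℝ} {w : ℝ → ℝ}
    (h : Vanishing b (s + 1) M w) : Vanishing b s (b * M) (prim w) := by
  have hwi := intervalIntegrable_of_bounded h.meas h.bdd
  have hM : 0 ≤ M := (abs_nonneg _).trans (h.bdd 0)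
  have hsupp : ∀ x, MixedModulus.prim w x ≠ 0 → x ∈ Set.Ioo 0 b := by
    intro x hx
    by_contra hx'
    apply hx
    rw [Set.mem_Ioo, not_and_or, not_lt, not_lt] at hx'
    have hz : ∀ u, u ≤ 0 ∨ b ≤ u → w u = 0 := fun u hu => by
      by_contra hne
      have := h.supp u hne
      rcases hu with hu | hu
      · linarith [this.1]
      · linarith [this.2]
    rcases hx' with hx' | hx'
    · rw [MixedModulus.prim, intervalIntegral.integral_congr (g := fun _ => 0)]
      · simp
      · intro u hu
        rw [Set.uIcc_of_ge hx'] at hu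
        exact hz u (Or.inl hu.2)
    · rw [MixedModulus.prim, ← intervalIntegral.integral_add_adjacent_intervals (hwi 0 b) (hwi b x),
        setIntegral_Ioo_eq h.supp hb.le, intervalIntegral.integral_congr (g := fun _ => 0) (a := b)]
      · simpa using h.moments 0 (by omega)
      · intro u hu
        rw [Set.uIcc_of_le hx'] at hu
        exact hz u (Or.inr hu.1)
  refine ⟨(continuous_prim hwi).measurable, fun x => ?_, hsupp, fun n hn => ?_⟩
  · by_cases hx : MixedModulus.prim w x = 0
    · rw [hx, abs_zero]; positivity
    · have hx' := hsupp x hx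
      refine (intervalIntegral.norm_integral_le_of_norm_le_const (C := M)
        fun u _ => (Real.norm_eq_abs _).trans_le (h.bdd u)).trans ?_
      rw [sub_zero, abs_of_pos hx'.1, mul_comm]
      exact mul_le_mul_of_nonneg_right hx'.2.le hM
  · have hs2 : ∀ x, MixedModulus.prim w x * x ^ n ≠ 0 → x ∈ Set.Ioo 0 b := fun x hx =>
      hsupp x (left_ne_zero_of_mul hx)
    have hs3 : ∀ x, w x * x ^ (n + 1) ≠ 0 → x ∈ Set.Ioo 0 b := fun x hx =>
      h.supp x (left_ne_zero_of_mul hx)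
    rw [← setIntegral_Ioo_eq hs2 hb.le]
    -- Since `w` is merely bounded and measurable, its primitive is differentiable only almost
    -- everywhere. Integration by parts is therefore used in its absolutely continuous form.
    have hac : AbsolutelyContinuousOnInterval (MixedModulus.prim w) 0 b :=
      (hwi 0 b).absolutelyContinuousOnInterval_intervalIntegral Set.left_mem_uIcc
    have hac2 : AbsolutelyContinuousOnInterval (fun x : ℝ => x ^ (n + 1)) 0 b :=
      ContDiffOn.absolutelyContinuousOnInterval (by fun_prop)
    have hparts := hac.integral_mul_deriv_eq_deriv_mul hac2
    have hd : ∀ x : ℝ, deriv (fun x : ℝ => x ^ (n + 1)) x = (n + 1) * x ^ n := fun x => by simp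
    have hb0 : MixedModulus.prim w b = 0 := by
      by_contra hne; exact lt_irrefl _ (hsupp b hne).2
    have h00 : MixedModulus.prim w 0 = 0 := by simp [MixedModulus.prim]
    have hae : ∫ x in (0 : ℝ)..b, deriv (MixedModulus.prim w) x * x ^ (n + 1) = 0 := by
      refine Eq.trans (intervalIntegral.integral_congr_ae ?_)
        ((setIntegral_Ioo_eq hs3 hb.le).trans (h.moments (n + 1) (by omega)))
      filter_upwards [(hwi 0 b).ae_hasDerivAt_integral] with x hx hx2
      have := hx (Set.uIoc_subset_uIcc hx2) 0 Set.left_mem_uIcc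
      rw [show deriv (MixedModulus.prim w) x = w x from this.deriv]
    rw [hae, hb0, h00] at hparts
    simp_rw [hd] at hparts
    have e : ∀ x : ℝ, MixedModulus.prim w x * ((n + 1) * x ^ n) =
        (n + 1) * (MixedModulus.prim w x * x ^ n) := fun x => by ring
    simp_rw [e] at hparts
    rw [intervalIntegral.integral_const_mul] at hparts
    have : (n : ℝ) + 1 ≠ 0 := by positivity
    simpa [this] using hparts

lemma Vanishing.prim_iterate {b : ℝ} (hb : 0 < b) {s n : ℕ} {M : ℝ} {w : ℝ → ℝ}
    (h : Vanishing b (s + n) M w) : Vanishing b s (b ^ n * M) (MixedModulus.prim^[n] w) := by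
  induction n generalizing s with
  | zero => simpa using h
  | succ n ih =>
    rw [Function.iterate_succ_apply']
    have := (ih (s := s + 1) (by rwa [add_assoc, add_comm 1 n])).prim hb
    rwa [← mul_assoc, ← pow_succ'] at this

/-! ### Representation of functionals by finite differences -/

lemma integrable_of_bounded_of_support_subset {X : Type*} [MeasurableSpace X] {μ : Measure X}
    {f : X → ℝ} (hf : Measurable f) {M : ℝ} (hM : ∀ x, |f x| ≤ M) {s : Set X} (hμ : μ s < ⊤)
    (hs : ∀ x, f x ≠ 0 → x ∈ s) : Integrable f μ := by
  have h : IntegrableOn f s μ := by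
    refine Measure.integrableOn_of_bounded (M := M) hμ.ne hf.aestronglyMeasurable ?_
    exact Filter.Eventually.of_forall fun x => hM x
  exact (integrableOn_iff_integrable_of_support_subset fun x hx => hs x hx).1 h

/-- `w` is the density of the functional `f ↦ ∫∫ K(x,ξ) (Δ_ξ^l f)(x) dx dξ`. -/
def IsDiffRep (l : ℕ) (w : ℝ → ℝ) (K : ℝ → ℝ → ℝ) : Prop :=
  ∀ y, w y = ∑ k ∈ Finset.range (l + 1),
    (-1) ^ (l - k) * (l.choose k : ℝ) * ∫ ξ, K (y - k * ξ) ξ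

/-- The mean of the dilated B-splines of order `r` over the dilations in `(1,2)`. -/
def meanSpline (r : ℕ) (ξ : ℝ) : ℝ := ∫ h in (1 : ℝ)..2, h⁻¹ * psi r (ξ / h)

lemma measurable_meanSpline (r : ℕ) : Measurable (meanSpline r) := by
  have h : Measurable (Function.uncurry fun ξ h : ℝ => h⁻¹ * psi r (ξ / h)) := by
    have := (measurable_psi r).comp (measurable_fst.div measurable_snd : Measurable fun q : ℝ × ℝ => q.1 / q.2)
    exact measurable_snd.inv.mul this
  have h2 := (h.stronglyMeasurable.integral_prod_right
    (ν := volume.restrict (Set.Ioc (1 : ℝ) 2))).measurable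
  convert h2 using 1
  funext ξ
  rw [meanSpline, intervalIntegral.integral_of_le (by norm_num)]

lemma abs_meanSpline_le (r : ℕ) (ξ : ℝ) : |meanSpline r ξ| ≤ 1 := by
  have h := intervalIntegral.norm_integral_le_of_norm_le_const (a := (1 : ℝ)) (b := 2) (C := 1)
    (f := fun h => h⁻¹ * psi r (ξ / h)) fun h hh => by
      rw [Set.uIoc_of_le (by norm_num)] at hh
      rw [norm_mul, Real.norm_eq_abs, Real.norm_eq_abs, abs_of_pos (by have := hh.1; positivity)]
      have h1 : h⁻¹ ≤ 1 := inv_le_one_of_one_le₀ hh.1.le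
      have h2 := abs_psi_le_one r (ξ / h)
      exact mul_le_one₀ h1 (abs_nonneg _) h2
  rw [← Real.norm_eq_abs, meanSpline]
  refine h.trans ?_
  norm_num

lemma psi_div_eq_zero {r : ℕ} {ξ h : ℝ} (hh : h ∈ Set.Ioc (1 : ℝ) 2)
    (hξ : ξ ∉ Set.Icc (0 : ℝ) (2 * (r + 1))) : psi r (ξ / h) = 0 := by
  have hpos : 0 < h := by linarith [hh.1]
  refine psi_eq_zero r ?_
  rw [Set.mem_Icc, not_and_or, not_le, not_le] at hξ
  refine hξ.imp (fun h0 => (div_neg_of_neg_of_pos h0 hpos).le) fun h1 => ?_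
  rw [le_div_iff₀ hpos]
  have : ((r : ℝ) + 1) * h ≤ (r + 1) * 2 := mul_le_mul_of_nonneg_left hh.2 (by positivity)
  linarith

lemma meanSpline_eq_zero {r : ℕ} {ξ : ℝ} (hξ : ξ ∉ Set.Icc (0 : ℝ) (2 * (r + 1))) :
    meanSpline r ξ = 0 := by
  rw [meanSpline, intervalIntegral.integral_of_le (by norm_num),
    setIntegral_congr_fun (g := fun _ => (0 : ℝ)) measurableSet_Ioc]
  · simp
  · intro h hh
    simp [psi_div_eq_zero hh hξ]

/-- Fubini and the substitution `ξ = hσ`. The factor `h⁻¹` in `meanSpline` is the Jacobian. -/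
lemma integral_mul_meanSpline {w : ℝ → ℝ} (hw : Measurable w) {M : ℝ} (hM : ∀ x, |w x| ≤ M)
    (r : ℕ) (k y : ℝ) :
    ∫ ξ, w (y - k * ξ) * meanSpline r ξ =
      ∫ h in (1 : ℝ)..2, ∫ σ, w (y - (k * h) * σ) * psi r σ := by
  rw [intervalIntegral.integral_of_le (by norm_num)]
  have h1 : ∀ ξ, w (y - k * ξ) * meanSpline r ξ =
      ∫ h in Set.Ioc (1 : ℝ) 2, w (y - k * ξ) * (h⁻¹ * psi r (ξ / h)) := fun ξ => by
    rw [integral_const_mul, meanSpline, intervalIntegral.integral_of_le (by norm_num)]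
  simp_rw [h1]
  have hmeas : Measurable (Function.uncurry fun ξ h : ℝ => w (y - k * ξ) * (h⁻¹ * psi r (ξ / h))) := by
    have h2 := (measurable_psi r).comp
      (measurable_fst.div measurable_snd : Measurable fun q : ℝ × ℝ => q.1 / q.2)
    have h3 : Measurable fun q : ℝ × ℝ => w (y - k * q.1) := hw.comp (by fun_prop)
    exact h3.mul (measurable_snd.inv.mul h2)
  have hM0 : 0 ≤ M := (abs_nonneg _).trans (hM 0)
  rw [integral_integral_swap]
  · refine setIntegral_congr_fun measurableSet_Ioc fun h hh => ?_
    have hpos : 0 < h := by linarith [hh.1]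
    have := Measure.integral_comp_div (fun σ => w (y - (k * h) * σ) * (h⁻¹ * psi r σ)) h
    have e : ∀ ξ, y - k * h * (ξ / h) = y - k * ξ := fun ξ => by field_simp
    simp_rw [e] at this
    rw [this, abs_of_pos hpos, smul_eq_mul, ← integral_const_mul]
    congr 1; funext σ
    field_simp
  -- Boundedness of the integrand uses `h > 1`, and compact support uses `h ≤ 2`. The integrand is
  -- therefore first cut off to this box, which changes it only on a null set of the restricted
  -- product measure.
  · let s : Set (ℝ × ℝ) := Set.Icc (0 : ℝ) (2 * (r + 1)) ×ˢ Set.Ioc (1 : ℝ) 2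
    have hs : MeasurableSet s := measurableSet_Icc.prod measurableSet_Ioc
    have hind : Integrable (s.indicator
        (Function.uncurry fun ξ h : ℝ => w (y - k * ξ) * (h⁻¹ * psi r (ξ / h))))
        (volume.prod (volume.restrict (Set.Ioc (1 : ℝ) 2))) := by
      refine integrable_of_bounded_of_support_subset (M := M) (s := s) (hmeas.indicator hs) ?_ ?_ ?_
      · rintro ⟨ξ, h⟩
        by_cases hq : (ξ, h) ∈ s
        · rw [Set.indicator_of_mem hq]
          have hh := hq.2
          simp only at hh
          have hpos : 0 < h := by linarith [hh.1]
          simp only [Function.uncurry]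
          rw [abs_mul, abs_mul, abs_of_pos (inv_pos.2 hpos)]
          have h1 : h⁻¹ ≤ 1 := inv_le_one_of_one_le₀ hh.1.le
          have h2 := mul_le_one₀ h1 (abs_nonneg _) (abs_psi_le_one r (ξ / h))
          calc _ ≤ M * 1 := mul_le_mul (hM _) h2 (by positivity) hM0
            _ = M := mul_one M
        · rw [Set.indicator_of_notMem hq, abs_zero]; exact hM0
      · rw [Measure.prod_prod]
        simp [ENNReal.mul_lt_top]
      · intro q hq
        by_contra h
        exact hq (Set.indicator_of_notMem h _)
    refine hind.congr ?_
    have : ∀ᵐ q : ℝ × ℝ ∂(volume.prod (volume.restrict (Set.Ioc (1 : ℝ) 2))),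
        q.2 ∈ Set.Ioc (1 : ℝ) 2 :=
      Measure.quasiMeasurePreserving_snd.ae (ae_restrict_mem measurableSet_Ioc)
    filter_upwards [this] with q hq
    by_cases hqs : q ∈ s
    · rw [Set.indicator_of_mem hqs]
    · rw [Set.indicator_of_notMem hqs]
      have : q.1 ∉ Set.Icc (0 : ℝ) (2 * (r + 1)) := fun h => hqs ⟨h, hq⟩
      simp [Function.uncurry, psi_div_eq_zero hq this]

/-- The density which turns an average over dilations into an average over steps. -/
def stepDensity (r k : ℕ) : ℝ → ℝ :=
  (Set.Ioc (k : ℝ) (2 * k)).indicator fun ξ => (ξ ^ (r + 1))⁻¹ * (k : ℝ)⁻¹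

lemma measurable_stepDensity (r k : ℕ) : Measurable (stepDensity r k) := by
  refine Measurable.indicator ?_ measurableSet_Ioc
  fun_prop

lemma abs_stepDensity_le (r : ℕ) {k : ℕ} (hk : 1 ≤ k) (ξ : ℝ) : |stepDensity r k ξ| ≤ 1 := by
  have hk' : (1 : ℝ) ≤ k := by exact_mod_cast hk
  rw [stepDensity]
  by_cases h : ξ ∈ Set.Ioc (k : ℝ) (2 * k)
  · rw [Set.indicator_of_mem h]
    have h1 : 1 ≤ ξ := hk'.trans h.1.le
    have h2 : (1 : ℝ) ≤ ξ ^ (r + 1) := one_le_pow₀ h1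
    rw [abs_of_nonneg (by positivity)]
    exact mul_le_one₀ (inv_le_one_of_one_le₀ h2) (by positivity) (inv_le_one_of_one_le₀ hk')
  · rw [Set.indicator_of_notMem h]; simp

/-- The substitution `ξ = kh`, with `k⁻¹` in the density as Jacobian. This is why dilations were
averaged: a fixed step `kh` becomes a step `ξ` with bounded density, as the operator representation
requires. -/
lemma integral_mul_stepDensity (v : ℝ → ℝ) (r : ℕ) {k : ℕ} (hk : 1 ≤ k) (i y : ℝ) :
    ∫ ξ, v (y - i * ξ) * stepDensity r k ξ =
      ∫ h in (1 : ℝ)..2, ((k * h) ^ (r + 1))⁻¹ * v (y - i * (k * h)) := by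
  have hk' : (0 : ℝ) < k := by exact_mod_cast hk
  have h1 : ∀ ξ, v (y - i * ξ) * stepDensity r k ξ = (Set.Ioc (k : ℝ) (2 * k)).indicator
      (fun ξ => v (y - i * ξ) * ((ξ ^ (r + 1))⁻¹ * (k : ℝ)⁻¹)) ξ := fun ξ => by
    rw [stepDensity, Set.indicator, Set.indicator]; split_ifs <;> simp
  simp_rw [h1]
  rw [integral_indicator measurableSet_Ioc, ← intervalIntegral.integral_of_le (by linarith)]
  have := intervalIntegral.mul_integral_comp_mul_left (a := (1 : ℝ)) (b := 2)
    (f := fun ξ => v (y - i * ξ) * ((ξ ^ (r + 1))⁻¹ * (k : ℝ)⁻¹)) (k : ℝ)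
  rw [mul_one, mul_comm (k : ℝ) 2] at this
  rw [← this, ← intervalIntegral.integral_const_mul]
  refine intervalIntegral.integral_congr fun h _ => ?_
  field_simp

/-- Put `n = r + 1`, let `v` be the `n`-fold primitive of `w`, and let `A_k(y) = ∫ w(y - kξ)
meanSpline(ξ) dξ`. Then `A_0 = w`, while for `k ≥ 1` the average `A_k` is a mean over steps of
`n`-th differences of `v`. Hence the signed binomial combination of the `A_k` equals `w` plus terms
already in difference form. Moving those terms to the other side gives the kernel `w ⊗ meanSpline -
v ⊗ η`, up to sign. All its steps are nonnegative. -/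
lemma exists_forward_rep (r : ℕ) {b : ℝ} (hb : 0 < b) : ∃ C : ℝ, 0 < C ∧ ∀ (M : ℝ) (w : ℝ → ℝ),
    Vanishing b (r + 1) M w → ∃ K : ℝ → ℝ → ℝ, Measurable (Function.uncurry K) ∧
      (∀ z ξ, |K z ξ| ≤ C * M) ∧
      (∀ z ξ, K z ξ ≠ 0 → z ∈ Set.Ioo 0 b ∧ ξ ∈ Set.Icc (0 : ℝ) (2 * (r + 1))) ∧
      IsDiffRep (r + 1) w K := by
  -- The summand `1` accounts for `w ⊗ meanSpline`. In the other term `b ^ (r + 1) * M` bounds the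
  -- primitive and the binomial sum bounds `η`.
  refine ⟨1 + b ^ (r + 1) * ∑ k ∈ Finset.Icc 1 (r + 1), ((r + 1).choose k : ℝ), by positivity,
    fun M w hw => ?_⟩
  have hM : 0 ≤ M := (abs_nonneg _).trans (hw.bdd 0)
  have hwi := intervalIntegrable_of_bounded hw.meas hw.bdd
  have hv : Vanishing b 0 (b ^ (r + 1) * M) (prim^[r + 1] w) :=
    Vanishing.prim_iterate hb (by simpa using hw)
  set v := prim^[r + 1] w with hvdef
  set η : ℝ → ℝ := fun ξ => ∑ k ∈ Finset.Icc 1 (r + 1),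
    (-1) ^ k * ((r + 1).choose k : ℝ) * stepDensity r k ξ with hη
  have hηm : Measurable η := Finset.measurable_fun_sum _ fun k _ =>
    (measurable_stepDensity r k).const_mul _
  have hηb : ∀ ξ, |η ξ| ≤ ∑ k ∈ Finset.Icc 1 (r + 1), ((r + 1).choose k : ℝ) := fun ξ => by
    refine (Finset.abs_sum_le_sum_abs _ _).trans (Finset.sum_le_sum fun k hk => ?_)
    rw [abs_mul, abs_mul, abs_pow, abs_neg, abs_one, one_pow, one_mul, Nat.abs_cast]
    exact mul_le_of_le_one_right (by positivity) (abs_stepDensity_le r (Finset.mem_Icc.1 hk).1 ξ)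
  have hηs : ∀ ξ, η ξ ≠ 0 → ξ ∈ Set.Icc (0 : ℝ) (2 * (r + 1)) := fun ξ h => by
    obtain ⟨k, hk, hk2⟩ := Finset.exists_ne_zero_of_sum_ne_zero h
    have h3 : ξ ∈ Set.Ioc (k : ℝ) (2 * k) := by
      by_contra hn
      exact right_ne_zero_of_mul hk2 (Set.indicator_of_notMem hn _)
    have h4 : (k : ℝ) ≤ r + 1 := by exact_mod_cast (Finset.mem_Icc.1 hk).2
    have h5 : (0 : ℝ) ≤ k := k.cast_nonneg
    exact ⟨by linarith [h3.1], by linarith [h3.2]⟩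
  refine ⟨fun z ξ => (-1) ^ (r + 1) * (w z * meanSpline r ξ - v z * η ξ), ?_, ?_, ?_, ?_⟩
  · have h1 := (hw.meas.comp measurable_fst : Measurable fun q : ℝ × ℝ => w q.1)
    have h2 := (hv.meas.comp measurable_fst : Measurable fun q : ℝ × ℝ => v q.1)
    have h3 := ((measurable_meanSpline r).comp measurable_snd : Measurable fun q : ℝ × ℝ => _)
    have h4 := (hηm.comp measurable_snd : Measurable fun q : ℝ × ℝ => η q.2)
    exact ((h1.mul h3).sub (h2.mul h4)).const_mul _
  · intro z ξ
    rw [abs_mul, abs_pow, abs_neg, abs_one, one_pow, one_mul]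
    refine (abs_sub _ _).trans ?_
    rw [abs_mul, abs_mul, add_mul, one_mul]
    refine add_le_add ?_ ?_
    · calc _ ≤ M * 1 := mul_le_mul (hw.bdd z) (abs_meanSpline_le r ξ) (abs_nonneg _) hM
        _ = M := mul_one M
    · calc _ ≤ (b ^ (r + 1) * M) * ∑ k ∈ Finset.Icc 1 (r + 1), ((r + 1).choose k : ℝ) :=
            mul_le_mul (hv.bdd z) (hηb ξ) (abs_nonneg _) (by positivity)
        _ = _ := by ring
  · intro z ξ h
    have h1 := right_ne_zero_of_mul h
    have : w z * meanSpline r ξ ≠ 0 ∨ v z * η ξ ≠ 0 := by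
      by_contra hn
      rw [not_or, not_not, not_not] at hn
      rw [hn.1, hn.2, sub_zero] at h1
      exact h1 rfl
    rcases this with h2 | h2
    · refine ⟨hw.supp z (left_ne_zero_of_mul h2), ?_⟩
      by_contra hn
      exact right_ne_zero_of_mul h2 (meanSpline_eq_zero hn)
    · exact ⟨hv.supp z (left_ne_zero_of_mul h2), hηs ξ (right_ne_zero_of_mul h2)⟩
  · intro y
    have hsm : ∀ g : ℝ → ℝ, Measurable g → (∃ B, ∀ x, |g x| ≤ B) → ∀ k : ℝ,
        Integrable fun ξ => g (y - k * ξ) * meanSpline r ξ := by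
      rintro g hg ⟨B, hB⟩ k
      have hB0 : 0 ≤ B := (abs_nonneg _).trans (hB 0)
      refine integrable_of_bounded_of_support (M := B) (a := 0) (b := 2 * (r + 1))
        ((hg.comp (by fun_prop)).mul (measurable_meanSpline r)) (fun ξ => ?_) fun ξ h => ?_
      · rw [abs_mul]
        calc _ ≤ B * 1 := mul_le_mul (hB _) (abs_meanSpline_le r ξ) (abs_nonneg _) hB0
          _ = B := mul_one B
      · by_contra hn
        exact right_ne_zero_of_mul h (meanSpline_eq_zero hn)
    have hst : ∀ (k : ℝ) (j : ℕ), 1 ≤ j →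
        Integrable fun ξ => v (y - k * ξ) * stepDensity r j ξ := by
      intro k j hj
      have hB0 : 0 ≤ b ^ (r + 1) * M := (abs_nonneg _).trans (hv.bdd 0)
      refine integrable_of_bounded_of_support (M := b ^ (r + 1) * M) (a := j) (b := 2 * j)
        ((hv.meas.comp (by fun_prop)).mul (measurable_stepDensity r j)) (fun ξ => ?_) fun ξ h => ?_
      · rw [abs_mul]
        calc _ ≤ (b ^ (r + 1) * M) * 1 :=
              mul_le_mul (hv.bdd _) (abs_stepDensity_le r hj ξ) (abs_nonneg _) hB0
          _ = _ := mul_one _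
      · by_contra hn
        exact right_ne_zero_of_mul h (Set.indicator_of_notMem (fun h => hn ⟨h.1.le, h.2⟩) _)
    have hsplit : ∀ k : ℝ, ∫ ξ, (-1) ^ (r + 1) * (w (y - k * ξ) * meanSpline r ξ -
        v (y - k * ξ) * η ξ) = (-1) ^ (r + 1) * ((∫ ξ, w (y - k * ξ) * meanSpline r ξ) -
        ∑ j ∈ Finset.Icc 1 (r + 1), (-1) ^ j * ((r + 1).choose j : ℝ) *
          ∫ ξ, v (y - k * ξ) * stepDensity r j ξ) := by
      intro k
      have e : ∀ ξ, v (y - k * ξ) * η ξ = ∑ j ∈ Finset.Icc 1 (r + 1),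
          (-1) ^ j * ((r + 1).choose j : ℝ) * (v (y - k * ξ) * stepDensity r j ξ) := fun ξ => by
        rw [hη, Finset.mul_sum]
        exact Finset.sum_congr rfl fun j _ => by ring
      simp_rw [e]
      rw [integral_const_mul, integral_sub (hsm w hw.meas ⟨M, hw.bdd⟩ k), integral_finsetSum]
      · simp_rw [integral_const_mul]
      · exact fun j hj => (hst k j (Finset.mem_Icc.1 hj).1).const_mul _
      · exact integrable_finsetSum _ fun j hj => (hst k j (Finset.mem_Icc.1 hj).1).const_mul _
    -- The spline average with step `jh` is the difference of order `r + 1` of `v` divided by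
    -- `(jh)^(r+1)`. Integrating over `h` turns that weight into `stepDensity r j`.
    have hA : ∀ j ∈ Finset.Icc 1 (r + 1), ∫ ξ, w (y - (j : ℝ) * ξ) * meanSpline r ξ =
        ∑ i ∈ Finset.range (r + 1 + 1), (-1) ^ i * ((r + 1).choose i : ℝ) *
          ∫ ξ, v (y - i * ξ) * stepDensity r j ξ := by
      intro j hj
      have hj1 := (Finset.mem_Icc.1 hj).1
      have hj0 : (0 : ℝ) < j := by exact_mod_cast hj1
      simp_rw [integral_mul_meanSpline hw.meas hw.bdd, integral_mul_stepDensity v r hj1]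
      simp_rw [← intervalIntegral.integral_const_mul]
      rw [← intervalIntegral.integral_finsetSum]
      · refine intervalIntegral.integral_congr fun h hh => ?_
        rw [Set.uIcc_of_le (by norm_num)] at hh
        have : (j : ℝ) * h ≠ 0 := (mul_pos hj0 (by linarith [hh.1])).ne'
        rw [integral_mul_psi hw.meas hw.bdd this, bdiff_eq_sum, Finset.mul_sum]
        exact Finset.sum_congr rfl fun i _ => by ring
      · intro i _
        refine ContinuousOn.intervalIntegrable ?_
        have hvc : Continuous v := continuous_prim_iterate hwi r
        refine continuousOn_const.mul (ContinuousOn.mul ?_ ?_)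
        · refine ContinuousOn.inv₀ (by fun_prop) fun h hh => ?_
          rw [Set.uIcc_of_le (by norm_num)] at hh
          exact pow_ne_zero _ (mul_pos hj0 (by linarith [hh.1])).ne'
        · exact (hvc.comp (by fun_prop)).continuousOn
    have h0 : ∫ ξ, w (y - ((0 : ℕ) : ℝ) * ξ) * meanSpline r ξ = w y := by
      rw [integral_mul_meanSpline hw.meas hw.bdd]
      simp only [Nat.cast_zero, zero_mul, sub_zero]
      simp_rw [integral_const_mul, integral_psi]
      simp only [mul_one, intervalIntegral.integral_const, smul_eq_mul]
      norm_num
    simp_rw [hsplit]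
    have hsign : ∀ k ∈ Finset.range (r + 1 + 1), ∀ X : ℝ,
        (-1) ^ (r + 1 - k) * ((r + 1).choose k : ℝ) * ((-1) ^ (r + 1) * X) =
        (-1) ^ k * ((r + 1).choose k : ℝ) * X := by
      intro k hk X
      have hk' : k ≤ r + 1 := Nat.lt_succ_iff.1 (Finset.mem_range.1 hk)
      have e2 : ((-1 : ℝ)) ^ (r + 1 - k) * (-1) ^ (r + 1) = (-1) ^ k := by
        nth_rewrite 2 [← Nat.sub_add_cancel hk']
        rw [pow_add, ← mul_assoc, ← mul_pow]; simp
      rw [← e2]; ring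
    rw [Finset.sum_congr rfl fun k hk => hsign k hk _]
    simp_rw [mul_sub]
    rw [Finset.sum_sub_distrib]
    -- Exchanging the two finite sums shows that the `η` part cancels exactly the averages with `j ≥
    -- 1`, leaving the term `k = 0`, which is `w`.
    have hswap : ∑ k ∈ Finset.range (r + 1 + 1), (-1) ^ k * ((r + 1).choose k : ℝ) *
        ∑ j ∈ Finset.Icc 1 (r + 1), (-1) ^ j * ((r + 1).choose j : ℝ) *
          ∫ ξ, v (y - k * ξ) * stepDensity r j ξ =
        ∑ j ∈ Finset.Icc 1 (r + 1), (-1) ^ j * ((r + 1).choose j : ℝ) *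
          ∫ ξ, w (y - (j : ℝ) * ξ) * meanSpline r ξ := by
      simp_rw [Finset.mul_sum]
      rw [Finset.sum_comm]
      refine Finset.sum_congr rfl fun j hj => ?_
      rw [hA j hj, Finset.mul_sum]
      exact Finset.sum_congr rfl fun k _ => by ring
    rw [hswap, Finset.range_eq_Ico, Finset.sum_eq_sum_Ico_succ_bot (by omega), h0]
    have : Finset.Ico (0 + 1) (r + 1 + 1) = Finset.Icc 1 (r + 1) := by
      ext; simp only [Finset.mem_Ico, Finset.mem_Icc]; omega
    rw [this]
    simp

/-! ### Reproduction of polynomials -/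

lemma polyInt_add (P Q : Polynomial ℝ) : polyInt (P + Q) = polyInt P + polyInt Q := by
  simp only [polyInt, Polynomial.eval_add]
  exact integral_add (integrableOn_poly P) (integrableOn_poly Q)

/-- By induction on the degree: subtracting a multiple of `orthonormalPoly j` removes the leading
coefficient, and orthonormality identifies that multiple with the corresponding term of the sum. -/
lemma sum_polyInt_smul_orthonormalPoly (L : ℕ) {P : Polynomial ℝ} (hP : P.degree < L) :
    ∑ n ∈ Finset.range L, polyInt (orthonormalPoly n * P) • orthonormalPoly n = P := by
  have key : ∀ j ≤ L, ∀ P : Polynomial ℝ, P.degree < j →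
      ∑ n ∈ Finset.range L, polyInt (orthonormalPoly n * P) • orthonormalPoly n = P := by
    intro j
    induction j with
    | zero =>
      intro _ P hP
      have : P = 0 := by
        rw [← Polynomial.degree_eq_bot]
        simpa using hP
      subst this
      simp [polyInt]
    | succ j ih =>
      intro hj P hP
      have hne : orthonormalPoly j ≠ 0 := by
        intro h
        have := polyInt_orthonormalPoly j j
        simp [h, polyInt] at this
      have hlc : (orthonormalPoly j).coeff j ≠ 0 := by
        have := Polynomial.leadingCoeff_ne_zero.2 hne
        rwa [Polynomial.leadingCoeff, natDegree_orthonormalPoly] at this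
      set c := P.coeff j / (orthonormalPoly j).coeff j with hc
      set Q := P - Polynomial.C c * orthonormalPoly j with hQ
      have hQd : Q.degree < j := by
        rw [Polynomial.degree_lt_iff_coeff_zero]
        intro n hn
        rw [hQ, Polynomial.coeff_sub, Polynomial.coeff_C_mul]
        rcases hn.eq_or_lt with rfl | hn
        · rw [hc, div_mul_cancel₀ _ hlc, sub_self]
        · rw [(Polynomial.degree_lt_iff_coeff_zero _ _).1 hP n hn,
            Polynomial.coeff_eq_zero_of_natDegree_lt (by rwa [natDegree_orthonormalPoly])]
          simp
      have h1 := ih (by omega) Q hQd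
      have e : P = Q + Polynomial.C c * orthonormalPoly j := by rw [hQ]; ring
      have e2 : ∀ n, polyInt (orthonormalPoly n * P) =
          polyInt (orthonormalPoly n * Q) + c * if n = j then 1 else 0 := fun n => by
        rw [e, mul_add, polyInt_add, ← polyInt_orthonormalPoly, ← polyInt_C_mul]
        congr 2; ring
      simp_rw [e2, add_smul, Finset.sum_add_distrib]
      rw [h1]
      conv_rhs => rw [e]
      congr 1
      rw [Finset.sum_eq_single j]
      · simp [Polynomial.smul_eq_C_mul]
      · intro n _ hn; simp [hn]
      · intro h; exact absurd (Finset.mem_range.2 (by omega)) h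
  exact key L le_rfl P hP

/-! ### Transport of difference representations -/

/-- Reflection reverses the direction of the steps. The binomial weights are untouched, so no sign
appears. It serves to turn forward steps into backward ones near the right end of an interval. -/
lemma IsDiffRep.reflect {l : ℕ} {w : ℝ → ℝ} {K : ℝ → ℝ → ℝ} (B : ℝ)
    (h : IsDiffRep l (fun y => w (B - y)) K) : IsDiffRep l w fun z ξ => K (B - z) (-ξ) := by
  intro y
  have := h (B - y)
  simp only [sub_sub_cancel] at this
  rw [this]
  refine Finset.sum_congr rfl fun k _ => ?_
  congr 1
  rw [← integral_neg_eq_self]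
  congr 1; funext ξ
  congr 1; ring

/-- The factor `a` compensates the Jacobian of `ξ ↦ ξ * a`. -/
lemma IsDiffRep.dilate {l : ℕ} {w : ℝ → ℝ} {K : ℝ → ℝ → ℝ} {a A : ℝ} (ha : 0 < a)
    (h : IsDiffRep l (fun u => w (A + u * a⁻¹)) K) :
    IsDiffRep l w fun z ξ => a * K ((z - A) * a) (ξ * a) := by
  intro y
  have := h ((y - A) * a)
  simp only at this ⊢
  rw [mul_assoc, mul_inv_cancel₀ ha.ne', mul_one, add_sub_cancel] at this
  rw [this]
  refine Finset.sum_congr rfl fun k _ => ?_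
  congr 1
  have h2 := Measure.integral_comp_mul_right (fun ξ => K ((y - A) * a - k * ξ) ξ) a
  rw [abs_of_pos (inv_pos.2 ha), smul_eq_mul] at h2
  rw [integral_const_mul]
  have e : ∀ ξ, (y - k * ξ - A) * a = (y - A) * a - k * (ξ * a) := fun ξ => by ring
  simp_rw [e]
  rw [h2, mul_inv_cancel_left₀ ha.ne']

lemma IsDiffRep.add {l : ℕ} {w₁ w₂ : ℝ → ℝ} {K₁ K₂ : ℝ → ℝ → ℝ}
    (h₁ : IsDiffRep l w₁ K₁) (h₂ : IsDiffRep l w₂ K₂)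
    (i₁ : ∀ y k : ℝ, Integrable fun ξ => K₁ (y - k * ξ) ξ)
    (i₂ : ∀ y k : ℝ, Integrable fun ξ => K₂ (y - k * ξ) ξ) :
    IsDiffRep l (fun y => w₁ y + w₂ y) fun z ξ => K₁ z ξ + K₂ z ξ := by
  intro y
  simp only
  rw [h₁ y, h₂ y, ← Finset.sum_add_distrib]
  refine Finset.sum_congr rfl fun k _ => ?_
  rw [integral_add (i₁ _ _) (i₂ _ _)]
  ring

/-! ### Densities with prescribed moments -/

lemma exists_poly_bound (P : Polynomial ℝ) (a b : ℝ) :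
    ∃ S : ℝ, 0 ≤ S ∧ ∀ x ∈ Set.Icc a b, |P.eval x| ≤ S := by
  obtain ⟨S, hS⟩ := isCompact_Icc.exists_bound_of_continuousOn (s := Set.Icc a b)
    P.continuous.continuousOn
  exact ⟨max S 0, le_max_right _ _, fun x hx => (hS x hx).trans (le_max_left _ _)⟩

lemma integral_mul_eval_eq_zero {w : ℝ → ℝ} {l : ℕ} (hm : ∀ n < l, ∫ y, w y * y ^ n = 0)
    (hi : ∀ n, Integrable fun y => w y * y ^ n) {P : Polynomial ℝ} (hP : P.degree < l) :
    ∫ y, w y * P.eval y = 0 := by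
  simp_rw [Polynomial.eval_eq_sum, Polynomial.sum, Finset.mul_sum]
  rw [integral_finsetSum]
  · refine Finset.sum_eq_zero fun n hn => ?_
    have e : ∀ y, w y * (P.coeff n * y ^ n) = P.coeff n * (w y * y ^ n) := fun y => by ring
    simp_rw [e]
    rw [integral_const_mul, hm n, mul_zero]
    have := (Polynomial.le_degree_of_mem_supp n hn).trans_lt hP
    exact_mod_cast this
  · intro n _
    have e : ∀ y, w y * (P.coeff n * y ^ n) = P.coeff n * (w y * y ^ n) := fun y => by ring
    simp_rw [e]
    exact (hi n).const_mul _

lemma integrable_mul_poly {w : ℝ → ℝ} (hw : Measurable w) {M a b : ℝ} (hM : ∀ x, |w x| ≤ M)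
    (hs : ∀ x, w x ≠ 0 → x ∈ Set.Icc a b) (P : Polynomial ℝ) :
    Integrable fun y => w y * P.eval y := by
  obtain ⟨S, hS0, hS⟩ := exists_poly_bound P a b
  refine integrable_of_bounded_of_support (M := M * S) (a := a) (b := b)
    (hw.mul P.continuous.measurable) (fun x => ?_) fun x hx => hs x (left_ne_zero_of_mul hx)
  have hM0 : 0 ≤ M := (abs_nonneg _).trans (hM 0)
  by_cases hx : w x = 0
  · rw [hx, zero_mul, abs_zero]; positivity
  · rw [abs_mul]
    exact mul_le_mul (hM x) (hS x (hs x hx)) (abs_nonneg _) hM0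

/-- A bounded density on the middle third of `(0,3s)` with prescribed moments. -/
lemma exists_density_on_middle (l : ℕ) {s : ℝ} (hs : 0 < s) : ∃ C : ℝ, 0 < C ∧
    ∀ (M : ℝ) (w : ℝ → ℝ), Measurable w → (∀ x, |w x| ≤ M) →
      (∀ x, w x ≠ 0 → x ∈ Set.Icc 0 (3 * s)) →
      ∃ ρ : ℝ → ℝ, Measurable ρ ∧ (∀ x, |ρ x| ≤ C * M) ∧
        (∀ x, ρ x ≠ 0 → x ∈ Set.Ioo s (2 * s)) ∧
        ∀ n < l, ∫ y, ρ y * y ^ n = ∫ y, w y * y ^ n := by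
  -- The map `y ↦ y / s - 1` sends the middle third to `(0,1)` and the whole interval `[0, 3s]` to
  -- `[-1, 2]`.
  choose S hS0 hS using fun n => exists_poly_bound (orthonormalPoly n) (-1) 2
  refine ⟨1 + ∑ n ∈ Finset.range l, 3 * S n * S n, ?_, fun M w hw hM hsupp => ?_⟩
  · have : 0 ≤ ∑ n ∈ Finset.range l, 3 * S n * S n :=
      Finset.sum_nonneg fun n _ => mul_nonneg (mul_nonneg (by norm_num) (hS0 n)) (hS0 n)
    linarith
  have hM0 : 0 ≤ M := (abs_nonneg _).trans (hM 0)
  set p : ℕ → Polynomial ℝ := fun n =>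
    (orthonormalPoly n).comp (Polynomial.C s⁻¹ * Polynomial.X - 1) with hp
  have hpe : ∀ n y, (p n).eval y = (orthonormalPoly n).eval (s⁻¹ * y - 1) := fun n y => by
    simp [hp]
  have hrange : ∀ y ∈ Set.Icc 0 (3 * s), s⁻¹ * y - 1 ∈ Set.Icc (-1 : ℝ) 2 := fun y hy => by
    have h1 : 0 ≤ s⁻¹ * y := mul_nonneg (by positivity) hy.1
    have h2 : s⁻¹ * y ≤ 3 := by
      rw [inv_mul_le_iff₀ hs]; linarith [hy.2]
    exact ⟨by linarith, by linarith⟩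
  set c : ℕ → ℝ := fun n => ∫ y, w y * (p n).eval y with hc
  have hcb : ∀ n, |c n| ≤ 3 * s * (M * S n) := fun n => by
    have e : c n = ∫ y in Set.Icc 0 (3 * s), w y * (p n).eval y :=
      (setIntegral_eq_integral_of_forall_compl_eq_zero fun x hx => by
        by_contra h; exact hx (hsupp x (left_ne_zero_of_mul h))).symm
    rw [e, ← Real.norm_eq_abs]
    refine (norm_setIntegral_le_of_norm_le_const (C := M * S n)
      measure_Icc_lt_top fun y hy => ?_).trans ?_
    · rw [norm_mul]
      exact mul_le_mul (hM y) (by rw [hpe]; exact hS n _ (hrange y hy)) (norm_nonneg _) hM0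
    · rw [measureReal_def, Real.volume_Icc, sub_zero, ENNReal.toReal_ofReal (by positivity)]
      exact le_of_eq (by ring)
  -- This is the polynomial density on the middle third representing the functional `P ↦ ∫ w P` in
  -- the transported orthonormal basis.
  refine ⟨(Set.Ioo s (2 * s)).indicator fun y => ∑ n ∈ Finset.range l, c n * (s⁻¹ * (p n).eval y),
    ?_, ?_, ?_, ?_⟩
  · refine Measurable.indicator ?_ measurableSet_Ioo
    exact Finset.measurable_fun_sum _ fun n _ =>
      (((p n).continuous.measurable).const_mul _).const_mul _
  · intro x
    by_cases hx : x ∈ Set.Ioo s (2 * s)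
    · rw [Set.indicator_of_mem hx]
      refine (Finset.abs_sum_le_sum_abs _ _).trans ?_
      rw [add_mul, one_mul, Finset.sum_mul]
      refine le_add_of_nonneg_of_le hM0 (Finset.sum_le_sum fun n _ => ?_)
      rw [abs_mul, abs_mul, abs_of_pos (inv_pos.2 hs)]
      have h2 : |(p n).eval x| ≤ S n := by
        rw [hpe]; exact hS n _ (hrange x ⟨by linarith [hx.1], by linarith [hx.2]⟩)
      calc _ ≤ 3 * s * (M * S n) * (s⁻¹ * S n) := by
            have := hS0 n
            have := hcb n
            gcongr
        _ = _ := by field_simp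
    · rw [Set.indicator_of_notMem hx, abs_zero]
      have : 0 ≤ ∑ n ∈ Finset.range l, 3 * S n * S n :=
        Finset.sum_nonneg fun n _ => mul_nonneg (mul_nonneg (by norm_num) (hS0 n)) (hS0 n)
      positivity
  · intro x hx
    by_contra h
    exact hx (Set.indicator_of_notMem h _)
  · intro n hn
    set Q : Polynomial ℝ := (Polynomial.C s * (Polynomial.X + 1)) ^ n with hQ
    have hQd : Q.degree < l := by
      refine lt_of_le_of_lt ?_ (Nat.cast_lt.2 hn)
      rw [hQ]
      have h1 : (Polynomial.C s * (Polynomial.X + 1) : Polynomial ℝ).degree ≤ 1 := by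
        compute_degree
      refine (Polynomial.degree_pow_le _ _).trans ?_
      calc n • (Polynomial.C s * (Polynomial.X + 1) : Polynomial ℝ).degree ≤ n • 1 :=
            nsmul_le_nsmul_right h1 n
        _ = n := by simp
    have hrep := sum_polyInt_smul_orthonormalPoly l hQd
    have hrep2 : ∀ y, ∑ k ∈ Finset.range l, polyInt (orthonormalPoly k * Q) * (p k).eval y =
        y ^ n := fun y => by
      have := congrArg (Polynomial.eval (s⁻¹ * y - 1)) hrep
      rw [Polynomial.eval_finsetSum] at this
      simp only [Polynomial.eval_smul, smul_eq_mul] at this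
      simp_rw [hpe]
      rw [this, hQ]
      simp only [Polynomial.eval_pow, Polynomial.eval_mul, Polynomial.eval_C,
        Polynomial.eval_add, Polynomial.eval_X, Polynomial.eval_one]
      congr 1
      field_simp
      ring
    have hR : ∫ y, w y * y ^ n = ∑ k ∈ Finset.range l, polyInt (orthonormalPoly k * Q) * c k := by
      simp_rw [← hrep2, Finset.mul_sum]
      rw [integral_finsetSum]
      · refine Finset.sum_congr rfl fun k _ => ?_
        rw [hc, ← integral_const_mul]
        congr 1; funext y; ring
      · intro k _
        have := (integrable_mul_poly hw hM hsupp (p k)).const_mul (polyInt (orthonormalPoly k * Q))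
        refine this.congr (Filter.Eventually.of_forall fun y => ?_)
        simp only; ring
    have hL : ∀ k, ∫ y in Set.Ioo s (2 * s), s⁻¹ * (p k).eval y * y ^ n =
        polyInt (orthonormalPoly k * Q) := fun k => by
      rw [polyInt, ← integral_Ioc_eq_integral_Ioo, ← integral_Ioc_eq_integral_Ioo,
        ← intervalIntegral.integral_of_le (by linarith), ← intervalIntegral.integral_of_le (by simp)]
      have h1 := intervalIntegral.mul_integral_comp_mul_add (a := (0 : ℝ)) (b := 1)
        (f := fun y => s⁻¹ * (p k).eval y * y ^ n) s s
      rw [mul_zero, zero_add, mul_one, ← two_mul] at h1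
      rw [← h1, ← intervalIntegral.integral_const_mul]
      refine intervalIntegral.integral_congr fun u _ => ?_
      rw [hpe, hQ]
      simp only [Polynomial.eval_mul, Polynomial.eval_pow, Polynomial.eval_C,
        Polynomial.eval_add, Polynomial.eval_X, Polynomial.eval_one]
      have e1 : s⁻¹ * (s * u + s) - 1 = u := by field_simp; ring
      rw [e1]
      field_simp
    rw [hR]
    have e : ∀ y, (Set.Ioo s (2 * s)).indicator
        (fun y => ∑ n ∈ Finset.range l, c n * (s⁻¹ * (p n).eval y)) y * y ^ n =
        (Set.Ioo s (2 * s)).indicator (fun y => ∑ k ∈ Finset.range l,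
          c k * (s⁻¹ * (p k).eval y * y ^ n)) y := fun y => by
      rw [Set.indicator, Set.indicator]
      split_ifs
      · rw [Finset.sum_mul]
        exact Finset.sum_congr rfl fun k _ => by ring
      · rw [zero_mul]
    simp_rw [e]
    rw [integral_indicator measurableSet_Ioo, integral_finsetSum]
    · refine Finset.sum_congr rfl fun k _ => ?_
      rw [integral_const_mul, hL, mul_comm]
    · intro k _
      have hcont : Continuous fun y => c k * (s⁻¹ * (p k).eval y * y ^ n) := by
        have := (p k).continuous
        fun_prop
      exact (hcont.integrableOn_Icc (a := s) (b := 2 * s)).mono_set Set.Ioo_subset_Icc_self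

/-! ### Difference representations that stay inside the interval -/

lemma integrable_diagonal {K : ℝ → ℝ → ℝ} (hK : Measurable (Function.uncurry K)) {M T : ℝ}
    (hM : ∀ z ξ, |K z ξ| ≤ M) (hs : ∀ z ξ, K z ξ ≠ 0 → |ξ| ≤ T) (y k : ℝ) :
    Integrable fun ξ => K (y - k * ξ) ξ := by
  refine integrable_of_bounded_of_support (M := M) (a := -T) (b := T) ?_ (fun ξ => hM _ _)
    fun ξ h => abs_le.1 (hs _ _ h)
  exact hK.comp (by fun_prop : Measurable fun ξ : ℝ => (y - k * ξ, ξ))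

/-- Forward steps would leave the interval on the right. The density is cut at the midpoint, and a
correction supported in the middle third restores the vanishing moments of both pieces. The left
piece is then represented with forward steps and the right piece, after reflection, with backward
ones. -/
lemma exists_diffRep_base (r : ℕ) : ∃ B C : ℝ, 0 < B ∧ 0 < C ∧ ∀ (M : ℝ) (w : ℝ → ℝ),
    Vanishing B (r + 1) M w → ∃ K : ℝ → ℝ → ℝ, Measurable (Function.uncurry K) ∧
      (∀ z ξ, |K z ξ| ≤ C * M) ∧
      (∀ z ξ, K z ξ ≠ 0 → z ∈ Set.Ioo 0 B ∧ z + (r + 1) * ξ ∈ Set.Ioo 0 B) ∧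
      IsDiffRep (r + 1) w K := by
  -- The forward kernel has `ξ ≤ 2(r+1)`, so the total displacement `(r+1)ξ` is at most `s - 1`. A
  -- piece supported in `(0, 2s)` thus stays inside `(0, 3s)`.
  set s : ℝ := 2 * ((r : ℝ) + 1) ^ 2 + 1 with hs
  have hs0 : 0 < s := by positivity
  obtain ⟨C₁, hC₁, hfwd⟩ := exists_forward_rep r (b := 2 * s) (by positivity)
  obtain ⟨C₂, hC₂, hmid⟩ := exists_density_on_middle (r + 1) hs0
  refine ⟨3 * s, C₁ * (1 + C₂) + C₁ * (1 + C₂), by positivity, by positivity, fun M w hw => ?_⟩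
  have hM0 : 0 ≤ M := (abs_nonneg _).trans (hw.bdd 0)
  set w₁ : ℝ → ℝ := (Set.Iic (3 * s / 2)).indicator w with hw₁
  have hw₁m : Measurable w₁ := hw.meas.indicator measurableSet_Iic
  have hw₁b : ∀ x, |w₁ x| ≤ M := fun x => by
    rw [hw₁, Set.indicator]; split_ifs
    · exact hw.bdd x
    · simpa using hM0
  have hw₁s : ∀ x, w₁ x ≠ 0 → x ∈ Set.Ioo 0 (2 * s) := fun x hx => by
    have h1 : x ∈ Set.Iic (3 * s / 2) := by
      by_contra h; exact hx (Set.indicator_of_notMem h _)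
    have h2 : w x ≠ 0 := by rwa [hw₁, Set.indicator_of_mem h1] at hx
    have h3 : x ≤ 3 * s / 2 := h1
    exact ⟨(hw.supp x h2).1, by linarith⟩
  obtain ⟨ρ, hρm, hρb, hρs, hρ⟩ := hmid M w₁ hw₁m hw₁b fun x hx => by
    have := hw₁s x hx; exact ⟨this.1.le, by linarith [this.2]⟩
  have hiw : ∀ n : ℕ, Integrable fun y => w y * y ^ n := fun n => by
    simpa using integrable_mul_poly hw.meas hw.bdd
      (fun x hx => Set.Ioo_subset_Icc_self (hw.supp x hx)) (Polynomial.X ^ n)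
  have hiw₁ : ∀ n : ℕ, Integrable fun y => w₁ y * y ^ n := fun n => by
    simpa using integrable_mul_poly hw₁m hw₁b
      (fun x hx => Set.Ioo_subset_Icc_self (hw₁s x hx)) (Polynomial.X ^ n)
  have hiρ : ∀ n : ℕ, Integrable fun y => ρ y * y ^ n := fun n => by
    simpa using integrable_mul_poly hρm hρb
      (fun x hx => Set.Ioo_subset_Icc_self (hρs x hx)) (Polynomial.X ^ n)
  have hv₁ : Vanishing (2 * s) (r + 1) ((1 + C₂) * M) fun y => w₁ y - ρ y := by
    refine ⟨hw₁m.sub hρm, fun x => ?_, fun x hx => ?_, fun n hn => ?_⟩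
    · refine (abs_sub _ _).trans ?_
      linarith [hw₁b x, hρb x]
    · by_contra h
      have h1 : w₁ x = 0 := by by_contra h1; exact h (hw₁s x h1)
      have h2 : ρ x = 0 := by
        by_contra h2
        have := hρs x h2
        exact h ⟨by linarith [this.1], this.2⟩
      exact hx (by rw [h1, h2, sub_zero])
    · simp_rw [sub_mul]
      rw [integral_sub (hiw₁ n) (hiρ n), hρ n hn, sub_self]
  set w₂ : ℝ → ℝ := fun y => w y - (w₁ y - ρ y) with hw₂
  have hw₂b : ∀ x, |w₂ x| ≤ (1 + C₂) * M := fun x => by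
    have e : w₂ x = (Set.Iic (3 * s / 2))ᶜ.indicator w x + ρ x := by
      simp only [hw₂, hw₁, Set.indicator, Set.mem_compl_iff]
      by_cases h : x ∈ Set.Iic (3 * s / 2) <;> simp [h]
    rw [e]
    refine (abs_add_le _ _).trans ?_
    have : |(Set.Iic (3 * s / 2))ᶜ.indicator w x| ≤ M := by
      rw [Set.indicator]; split_ifs
      · exact hw.bdd x
      · simpa using hM0
    linarith [hρb x]
  have hw₂s : ∀ x, w₂ x ≠ 0 → x ∈ Set.Ioo s (3 * s) := fun x hx => by
    by_contra h
    have h2 : ρ x = 0 := by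
      by_contra h2
      have := hρs x h2
      exact h ⟨this.1, by linarith [this.2]⟩
    apply hx
    simp only [hw₂, hw₁, h2, sub_zero, Set.indicator]
    split_ifs with h3
    · exact sub_self _
    · rw [sub_zero]
      by_contra h4
      have h5 : 3 * s / 2 < x := not_le.1 h3
      exact h ⟨by linarith, (hw.supp x h4).2⟩
  have hw₂m : Measurable w₂ := hw.meas.sub (hw₁m.sub hρm)
  have hiw₂ : ∀ n : ℕ, Integrable fun y => w₂ y * y ^ n := fun n => by
    simpa using integrable_mul_poly hw₂m hw₂b
      (fun x hx => Set.Ioo_subset_Icc_self (hw₂s x hx)) (Polynomial.X ^ n)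
  have hw₂0 : ∀ n < r + 1, ∫ y, w₂ y * y ^ n = 0 := fun n hn => by
    have e : ∀ y, w₂ y * y ^ n = w y * y ^ n - (w₁ y - ρ y) * y ^ n := fun y => by
      simp only [hw₂]; ring
    simp_rw [e]
    have hi : Integrable fun y => (w₁ y - ρ y) * y ^ n := by
      simp_rw [sub_mul]; exact (hiw₁ n).sub (hiρ n)
    rw [integral_sub (hiw n) hi, hw.moments n hn, hv₁.moments n hn, sub_zero]
  have hv₂ : Vanishing (2 * s) (r + 1) ((1 + C₂) * M) fun y => w₂ (3 * s - y) := by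
    refine ⟨hw₂m.comp (by fun_prop), fun x => hw₂b _, fun x hx => ?_, fun n hn => ?_⟩
    · have := hw₂s _ hx
      exact ⟨by linarith [this.2], by linarith [this.1]⟩
    · have h1 := integral_sub_left_eq_self (fun y => w₂ y * (3 * s - y) ^ n) (volume : Measure ℝ) (3 * s)
      simp only [sub_sub_cancel] at h1
      rw [h1]
      have hd : ((Polynomial.C (3 * s) - Polynomial.X : Polynomial ℝ) ^ n).degree < (r + 1 : ℕ) := by
        refine lt_of_le_of_lt ?_ (Nat.cast_lt.2 hn)
        have h1 : (Polynomial.C (3 * s) - Polynomial.X : Polynomial ℝ).degree ≤ 1 := by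
          compute_degree
        refine (Polynomial.degree_pow_le _ _).trans ?_
        calc n • (Polynomial.C (3 * s) - Polynomial.X : Polynomial ℝ).degree ≤ n • 1 :=
              nsmul_le_nsmul_right h1 n
          _ = n := by simp
      have := integral_mul_eval_eq_zero hw₂0 hiw₂ hd
      simpa using this
  obtain ⟨K₁, hK₁m, hK₁b, hK₁s, hK₁⟩ := hfwd _ _ hv₁
  obtain ⟨K₂, hK₂m, hK₂b, hK₂s, hK₂⟩ := hfwd _ _ hv₂
  have hsr : ((r : ℝ) + 1) * (2 * (r + 1)) = s - 1 := by rw [hs]; ring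
  have hr0 : (0 : ℝ) < r + 1 := by positivity
  have hm₂ : Measurable (Function.uncurry fun z ξ => K₂ (3 * s - z) (-ξ)) :=
    hK₂m.comp (by fun_prop : Measurable fun q : ℝ × ℝ => (3 * s - q.1, -q.2))
  refine ⟨fun z ξ => K₁ z ξ + K₂ (3 * s - z) (-ξ), hK₁m.add hm₂, fun z ξ => ?_,
    fun z ξ h => ?_, ?_⟩
  · refine (abs_add_le _ _).trans ?_
    have h1 := hK₁b z ξ
    have h2 := hK₂b (3 * s - z) (-ξ)
    linarith
  · have : K₁ z ξ ≠ 0 ∨ K₂ (3 * s - z) (-ξ) ≠ 0 := by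
      by_contra hn
      rw [not_or, not_not, not_not] at hn
      exact h (by simp only [hn.1, hn.2, add_zero])
    rcases this with h1 | h1
    · obtain ⟨h2, h3⟩ := hK₁s _ _ h1
      have h4 := mul_le_mul_of_nonneg_left h3.2 hr0.le
      have h5 := mul_nonneg hr0.le h3.1
      exact ⟨⟨h2.1, by linarith [h2.2]⟩, by linarith [h2.1], by linarith [h2.2]⟩
    · obtain ⟨h2, h3⟩ := hK₂s _ _ h1
      have h4 := mul_le_mul_of_nonneg_left h3.2 hr0.le
      have h5 := mul_nonneg hr0.le h3.1
      exact ⟨⟨by linarith [h2.2], by linarith [h2.1]⟩, by linarith [h2.2], by linarith [h2.1]⟩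
  · have hadd := hK₁.add (hK₂.reflect (3 * s))
      (fun y k => integrable_diagonal hK₁m hK₁b (T := 2 * (r + 1)) (fun z ξ h => by
        have := (hK₁s z ξ h).2
        rw [abs_of_nonneg this.1]; exact this.2) y k)
      (fun y k => integrable_diagonal hm₂ (fun z ξ => hK₂b _ _) (T := 2 * (r + 1)) (fun z ξ h => by
        have := (hK₂s _ _ h).2
        rw [← abs_neg, abs_of_nonneg this.1]; exact this.2) y k)
    have e : w = fun y => w₁ y - ρ y + w₂ y := by
      funext y; simp only [hw₂]; ring
    rw [e]
    exact hadd

/-- A bounded density on an interval, orthogonal to the polynomials of degree less than `l`, is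
represented by a bounded kernel through the differences of order `l` inside the interval. -/
lemma exists_diffRep {l : ℕ} (hl : 1 ≤ l) : ∃ C : ℝ, 0 < C ∧
    ∀ (A L M : ℝ) (w : ℝ → ℝ), 0 < L → Measurable w → (∀ x, |w x| ≤ M) →
      (∀ x, w x ≠ 0 → x ∈ Set.Ioo A (A + L)) → (∀ n < l, ∫ y, w y * y ^ n = 0) →
      ∃ K : ℝ → ℝ → ℝ, Measurable (Function.uncurry K) ∧
        (∀ z ξ, |K z ξ| ≤ C * M / L) ∧
        (∀ z ξ, K z ξ ≠ 0 → z ∈ Set.Ioo A (A + L) ∧ z + l * ξ ∈ Set.Ioo A (A + L) ∧ |ξ| ≤ L) ∧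
        IsDiffRep l w K := by
  obtain ⟨r, rfl⟩ := Nat.exists_eq_add_of_le' hl
  obtain ⟨B, C, hB, hC, hbase⟩ := exists_diffRep_base r
  refine ⟨B * C, by positivity, fun A L M w hL hw hM hs hm => ?_⟩
  -- Dilation to the model interval `(0, B)`. The factor `a` gained by `IsDiffRep.dilate` is the
  -- source of the bound `C * M / L`.
  set a : ℝ := B / L with ha
  have ha0 : 0 < a := by positivity
  have hiw : ∀ n : ℕ, Integrable fun y => w y * y ^ n := fun n => by
    simpa using integrable_mul_poly hw hM
      (fun x hx => Set.Ioo_subset_Icc_self (hs x hx)) (Polynomial.X ^ n)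
  have haL : a * L = B := by rw [ha]; field_simp
  have hv : Vanishing B (r + 1) M fun u => w (A + u * a⁻¹) := by
    refine ⟨hw.comp (by fun_prop), fun x => hM _, fun x hx => ?_, fun n hn => ?_⟩
    · obtain ⟨h1, h2⟩ := hs _ hx
      have h3 : 0 < x * a⁻¹ := by linarith
      have h4 : x * a⁻¹ < L := by linarith
      rw [← div_eq_mul_inv] at h3 h4
      rw [div_lt_iff₀ ha0, mul_comm, haL] at h4
      exact ⟨by have := mul_pos h3 ha0; rwa [div_mul_cancel₀ _ ha0.ne'] at this, h4⟩
    · have h1 := Measure.integral_comp_mul_right (fun v => w (A + v) * (v * a) ^ n) a⁻¹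
      have e : ∀ u, u * a⁻¹ * a = u := fun u => by field_simp
      simp_rw [e] at h1
      rw [h1]
      have h2 := integral_sub_right_eq_self (fun v => w (A + v) * (v * a) ^ n) (μ := volume) A
      simp only [add_sub_cancel] at h2
      rw [← h2]
      have hd : (((Polynomial.X - Polynomial.C A) * Polynomial.C a : Polynomial ℝ) ^ n).degree <
          (r + 1 : ℕ) := by
        refine lt_of_le_of_lt ?_ (Nat.cast_lt.2 hn)
        have h1 : ((Polynomial.X - Polynomial.C A) * Polynomial.C a : Polynomial ℝ).degree ≤ 1 := by
          compute_degree
        refine (Polynomial.degree_pow_le _ _).trans ?_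
        calc n • ((Polynomial.X - Polynomial.C A) * Polynomial.C a : Polynomial ℝ).degree ≤ n • 1 :=
              nsmul_le_nsmul_right h1 n
          _ = n := by simp
      have := integral_mul_eval_eq_zero hm hiw hd
      simp only [Polynomial.eval_pow, Polynomial.eval_mul, Polynomial.eval_sub, Polynomial.eval_X,
        Polynomial.eval_C] at this
      rw [this, smul_zero]
  obtain ⟨K, hKm, hKb, hKs, hK⟩ := hbase _ _ hv
  have hr0 : (0 : ℝ) < r + 1 := by positivity
  refine ⟨fun z ξ => a * K ((z - A) * a) (ξ * a), ?_, fun z ξ => ?_, fun z ξ h => ?_, hK.dilate ha0⟩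
  · exact (hKm.comp (by fun_prop : Measurable fun q : ℝ × ℝ => ((q.1 - A) * a, q.2 * a))).const_mul a
  · rw [abs_mul, abs_of_pos ha0]
    calc _ ≤ a * (C * M) := mul_le_mul_of_nonneg_left (hKb _ _) ha0.le
      _ = _ := by rw [ha]; ring
  · obtain ⟨h1, h2⟩ := hKs _ _ (right_ne_zero_of_mul h)
    have e : (z - A) * a + (r + 1) * (ξ * a) = (z + (r + 1) * ξ - A) * a := by ring
    rw [e] at h2
    have hconv : ∀ x, (x - A) * a ∈ Set.Ioo 0 B → x ∈ Set.Ioo A (A + L) := fun x hx => by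
      have h3 : 0 < x - A := pos_of_mul_pos_left hx.1 ha0.le
      have h4 : x - A < L := by
        have := hx.2
        rw [← haL, mul_comm a L] at this
        exact lt_of_mul_lt_mul_right this ha0.le
      exact ⟨by linarith, by linarith⟩
    have h3 := hconv _ h1
    have h4 := hconv _ h2
    refine ⟨h3, by push_cast; exact h4, ?_⟩
    have h5 : |((r : ℝ) + 1) * ξ| ≤ L := by
      rw [abs_le]
      constructor <;> linarith [h3.1, h3.2, h4.1, h4.2]
    rw [abs_mul, abs_of_pos hr0] at h5
    have h6 : (1 : ℝ) ≤ r + 1 := by have : (0 : ℝ) ≤ r := r.cast_nonneg; linarith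
    exact (le_mul_of_one_le_left (abs_nonneg ξ) h6).trans h5

/-! ### The univariate kernel of the operator -/

/-- The univariate version of `shiftIndex`. -/
def shift1 (m κ : ℕ) (ν : ℤ) : ℤ :=
  max (2 ^ κ - (m : ℤ) - 1) 0 - max (2 ^ κ - (m : ℤ) - 1 - max ν 0) 0

/-- The univariate version of `signs`. -/
def signs1 (κ : ℕ) : Finset ℕ := (Finset.Icc 0 1).filter fun ε => ε ≠ 0 → κ ≠ 0

/-- The univariate version of `refineSet`. -/
def refine1 (m κ : ℕ) (ν : ℤ) (ε : ℕ) : Finset ℤ :=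
  (Finset.Icc (-(m : ℤ)) (2 ^ (κ - ε) - 1)).filter fun ρ =>
    (ε = 0 → ρ = ν) ∧ (ε ≠ 0 → 0 ≤ ν - 2 * ρ ∧ ν - 2 * ρ ≤ (m : ℤ) + 1)

/-- The univariate coefficient, `1` for `ε = 0` and `refineCoeff` otherwise. -/
def coef1 (m ε : ℕ) (μ : ℤ) : ℝ := if ε = 0 then 1 else refineCoeff m μ

lemma coef1_nonneg (m ε : ℕ) (μ : ℤ) : 0 ≤ coef1 m ε μ := by
  unfold coef1 refineCoeff
  split_ifs <;> positivity

/-! ### Refinement coefficients and index ranges -/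

lemma mem_signs1 {κ ε : ℕ} (h : ε ∈ signs1 κ) : ε ≤ 1 ∧ ε ≤ κ := by
  simp only [signs1, Finset.mem_filter, Finset.mem_Icc] at h
  omega

lemma signs1_of_pos {κ : ℕ} (h : 1 ≤ κ) : signs1 κ = {0, 1} := by
  ext ε
  simp only [signs1, Finset.mem_filter, Finset.mem_Icc, Finset.mem_insert, Finset.mem_singleton]
  omega

/-- Half of `(1 + 1)^(m+1) ± (1 - 1)^(m+1)`. The sign selects the parity class of `ν`. -/
lemma sum_choose_parity (m : ℕ) (ν : ℤ) :
    ∑ μ ∈ (Finset.range (m + 2)).filter (fun μ : ℕ => (2 : ℤ) ∣ ν - μ), ((m + 1).choose μ : ℝ) =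
      2 ^ m := by
  have h1 : ∑ μ ∈ Finset.range (m + 2), ((m + 1).choose μ : ℝ) = 2 ^ (m + 1) := by
    exact_mod_cast Nat.sum_range_choose (m + 1)
  have h2 : ∑ μ ∈ Finset.range (m + 2), (-1 : ℝ) ^ μ * ((m + 1).choose μ : ℝ) = 0 := by
    have := Int.alternating_sum_range_choose (n := m + 1)
    simp only [Nat.succ_ne_zero, if_false] at this
    exact_mod_cast this
  have h3 : ∀ μ : ℕ, (if (2 : ℤ) ∣ ν - μ then ((m + 1).choose μ : ℝ) else 0) =
      (((m + 1).choose μ : ℝ) + (-1) ^ ν.natAbs * ((-1) ^ μ * ((m + 1).choose μ : ℝ))) / 2 := by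
    intro μ
    rw [← mul_assoc, ← pow_add]
    split_ifs with h
    · rw [Even.neg_one_pow (by rw [Nat.even_iff]; omega)]; ring
    · rw [Odd.neg_one_pow (by rw [Nat.odd_iff]; omega)]; ring
  rw [Finset.sum_filter]
  simp_rw [h3]
  rw [← Finset.sum_div, Finset.sum_add_distrib, ← Finset.mul_sum, h1, h2, pow_succ]
  ring

/-- The admissible `ν - 2ρ` fill one parity class of `{0, …, m+1}`, whose coefficients sum to one.
The restriction of `ρ` to the index box loses nothing: `-m ≤ ν ≤ 2^κ - 1` already forces `-m ≤ ρ ≤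
2^(κ-1) - 1`. -/
lemma sum_coef1 {m κ ε : ℕ} {ν : ℤ} (hν : ν ∈ Finset.Icc (-(m : ℤ)) (2 ^ κ - 1))
    (hε : ε ∈ signs1 κ) : ∑ ρ ∈ refine1 m κ ν ε, coef1 m ε (ν - 2 * ρ) = 1 := by
  rw [Finset.mem_Icc] at hν
  obtain ⟨h1, h2⟩ := mem_signs1 hε
  interval_cases ε
  · have : refine1 m κ ν 0 = {ν} := by
      ext ρ
      simp only [refine1, Finset.mem_filter, Finset.mem_Icc, Finset.mem_singleton, Nat.sub_zero]
      constructor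
      · intro h; exact h.2.1 trivial
      · rintro rfl; exact ⟨hν, fun _ => rfl, fun h => absurd rfl h⟩
    rw [this]; simp [coef1]
  · have hp : (2 : ℤ) ^ κ = 2 * 2 ^ (κ - 1) := by
      rw [← pow_succ', Nat.sub_add_cancel h2]
    simp only [coef1, one_ne_zero, if_false, refineCoeff]
    rw [← Finset.sum_div, div_eq_one_iff_eq (by positivity), ← sum_choose_parity m ν]
    refine Finset.sum_nbij' (fun ρ => (ν - 2 * ρ).toNat) (fun μ => (ν - μ) / 2) ?_ ?_ ?_ ?_ ?_
    · intro ρ hρ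
      simp only [refine1, Finset.mem_filter, Finset.mem_Icc] at hρ
      simp only [Finset.mem_filter, Finset.mem_range]
      have := hρ.2.2 one_ne_zero
      omega
    · intro μ hμ
      simp only [Finset.mem_filter, Finset.mem_range] at hμ
      simp only [refine1, Finset.mem_filter, Finset.mem_Icc]
      refine ⟨⟨by omega, by omega⟩, fun h => absurd h one_ne_zero, fun _ => by omega⟩
    · intro ρ hρ
      simp only [refine1, Finset.mem_filter, Finset.mem_Icc] at hρ
      have := hρ.2.2 one_ne_zero
      omega
    · intro μ hμ
      simp only [Finset.mem_filter, Finset.mem_range] at hμ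
      omega
    · intro ρ _; rfl

/-- The shift equals `min(ν₊, (2^κ - m - 1)₊)`, hence always indexes a cell inside `(0,1)` and moves
an index of the box by at most `m`. The refinement step contributes the rest of the offset. The
point is that the offset ranges over a finite set independent of `κ`. -/
lemma shift1_bounds {m κ ε : ℕ} {ν ρ : ℤ} (hν : ν ∈ Finset.Icc (-(m : ℤ)) (2 ^ κ - 1))
    (hε : ε ∈ signs1 κ) (hρ : ρ ∈ refine1 m κ ν ε) :
    0 ≤ shift1 m (κ - ε) ρ ∧ shift1 m (κ - ε) ρ ≤ 2 ^ (κ - ε) - 1 ∧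
      ν - 2 ^ ε * shift1 m (κ - ε) ρ ∈ Finset.Icc (-(3 * m + 1 : ℤ)) (3 * m + 1) := by
  rw [Finset.mem_Icc] at hν
  obtain ⟨h1, h2⟩ := mem_signs1 hε
  simp only [refine1, Finset.mem_filter, Finset.mem_Icc] at hρ
  have hp1 : (1 : ℤ) ≤ 2 ^ (κ - ε) := one_le_pow₀ (by norm_num)
  have hp : (2 : ℤ) ^ κ = 2 ^ ε * 2 ^ (κ - ε) := by
    rw [← pow_add, Nat.add_sub_cancel' h2]
  rw [Finset.mem_Icc]
  unfold shift1
  interval_cases ε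
  · have := hρ.2.1 rfl
    simp only [pow_zero, one_mul, Nat.sub_zero] at *
    omega
  · have := hρ.2.2 one_ne_zero
    simp only [pow_one] at *
    omega

/-- The coefficient functions of the local projector. -/
def cellCoef (κ : ℕ) (ν : ℤ) (n : ℕ) : ℝ → ℝ :=
  (Set.Ioo (((2 : ℝ) ^ κ)⁻¹ * ν) (((2 : ℝ) ^ κ)⁻¹ * ν + ((2 : ℝ) ^ κ)⁻¹)).indicator fun y =>
    2 ^ κ * (orthonormalPoly n).eval (2 ^ κ * y - ν)

lemma mem_dyadic_iff {κ : ℕ} {ν : ℤ} {y : ℝ} :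
    y ∈ Set.Ioo (((2 : ℝ) ^ κ)⁻¹ * ν) (((2 : ℝ) ^ κ)⁻¹ * ν + ((2 : ℝ) ^ κ)⁻¹) ↔
      2 ^ κ * y - ν ∈ Set.Ioo (0 : ℝ) 1 := by
  have h : (0 : ℝ) < 2 ^ κ := by positivity
  have e1 : ((2 : ℝ) ^ κ)⁻¹ * ν < y ↔ 0 < 2 ^ κ * y - ν := by
    rw [inv_mul_lt_iff₀ h, sub_pos]
  have e2 : y < ((2 : ℝ) ^ κ)⁻¹ * ν + ((2 : ℝ) ^ κ)⁻¹ ↔ 2 ^ κ * y - ν < 1 := by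
    rw [show ((2 : ℝ) ^ κ)⁻¹ * ν + ((2 : ℝ) ^ κ)⁻¹ = ((2 : ℝ) ^ κ)⁻¹ * (ν + 1) by ring,
      lt_inv_mul_iff₀ h, sub_lt_iff_lt_add']
  rw [Set.mem_Ioo, Set.mem_Ioo, e1, e2]

lemma measurable_cellCoef (κ : ℕ) (ν : ℤ) (n : ℕ) : Measurable (cellCoef κ ν n) := by
  refine Measurable.indicator ?_ measurableSet_Ioo
  have := (orthonormalPoly n).continuous
  exact Continuous.measurable (by fun_prop)

lemma cellCoef_ne_zero {κ : ℕ} {ν : ℤ} {n : ℕ} {y : ℝ} (h : cellCoef κ ν n y ≠ 0) :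
    2 ^ κ * y - ν ∈ Set.Ioo (0 : ℝ) 1 := by
  rw [← mem_dyadic_iff]
  by_contra hn
  exact h (Set.indicator_of_notMem hn _)

lemma abs_cellCoef_le {n : ℕ} {S : ℝ} (hS0 : 0 ≤ S)
    (hS : ∀ x ∈ Set.Icc (0 : ℝ) 1, |(orthonormalPoly n).eval x| ≤ S) (κ : ℕ) (ν : ℤ) (y : ℝ) :
    |cellCoef κ ν n y| ≤ 2 ^ κ * S := by
  by_cases h : 2 ^ κ * y - ν ∈ Set.Ioo (0 : ℝ) 1
  · rw [cellCoef, Set.indicator_of_mem (mem_dyadic_iff.2 h), abs_mul, abs_pow, abs_two]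
    exact mul_le_mul_of_nonneg_left (hS _ (Set.Ioo_subset_Icc_self h)) (by positivity)
  · rw [cellCoef, Set.indicator_of_notMem (fun hn => h (mem_dyadic_iff.1 hn)), abs_zero]
    positivity

lemma integrable_cellCoef_mul_pow (κ : ℕ) (ν : ℤ) (n k : ℕ) :
    Integrable fun y => cellCoef κ ν n y * y ^ k := by
  obtain ⟨S, hS0, hS⟩ := exists_poly_bound (orthonormalPoly n) 0 1
  have := integrable_mul_poly (measurable_cellCoef κ ν n) (abs_cellCoef_le hS0 hS κ ν)
    (a := ((2 : ℝ) ^ κ)⁻¹ * ν) (b := ((2 : ℝ) ^ κ)⁻¹ * ν + ((2 : ℝ) ^ κ)⁻¹)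
    (fun x hx => Set.Ioo_subset_Icc_self (mem_dyadic_iff.2 (cellCoef_ne_zero hx)))
    (Polynomial.X ^ k)
  simpa using this

lemma integral_cellCoef_mul_pow (κ : ℕ) (ν : ℤ) (n k : ℕ) :
    ∫ y, cellCoef κ ν n y * y ^ k = polyInt (orthonormalPoly n *
      (Polynomial.C ((2 : ℝ) ^ κ)⁻¹ * (Polynomial.X + Polynomial.C (ν : ℝ))) ^ k) := by
  have hp : (0 : ℝ) < 2 ^ κ := by positivity
  have h1 : ∀ y, cellCoef κ ν n y * y ^ k = 2 ^ κ * ((Set.Ioo (0 : ℝ) 1).indicator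
      (fun u => (orthonormalPoly n).eval u * (((2 : ℝ) ^ κ)⁻¹ * (u + ν)) ^ k)
        (2 ^ κ * y - ν)) := fun y => by
    by_cases h : 2 ^ κ * y - ν ∈ Set.Ioo (0 : ℝ) 1
    · rw [cellCoef, Set.indicator_of_mem (mem_dyadic_iff.2 h), Set.indicator_of_mem h,
        sub_add_cancel, inv_mul_cancel_left₀ hp.ne', mul_assoc]
    · rw [cellCoef, Set.indicator_of_notMem (fun hn => h (mem_dyadic_iff.1 hn)),
        Set.indicator_of_notMem h, zero_mul, mul_zero]
  simp_rw [h1]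
  rw [integral_const_mul]
  have h2 := Measure.integral_comp_mul_left (fun v => (Set.Ioo (0 : ℝ) 1).indicator
      (fun u => (orthonormalPoly n).eval u * (((2 : ℝ) ^ κ)⁻¹ * (u + ν)) ^ k) (v - ν)) ((2 : ℝ) ^ κ)
  rw [h2, abs_of_pos (inv_pos.2 hp), smul_eq_mul, mul_inv_cancel_left₀ hp.ne',
    integral_sub_right_eq_self (fun v => (Set.Ioo (0 : ℝ) 1).indicator
      (fun u => (orthonormalPoly n).eval u * (((2 : ℝ) ^ κ)⁻¹ * (u + ν)) ^ k) v),
    integral_indicator measurableSet_Ioo, polyInt]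
  simp

/-- The basis polynomials of the local projector in the local coordinate of a B-spline. -/
def locPoly (ε : ℕ) (i : ℤ) (n : ℕ) : Polynomial ℝ :=
  (orthonormalPoly n).comp (Polynomial.C ((2 : ℝ) ^ ε)⁻¹ * (Polynomial.X + Polynomial.C (i : ℝ)))

/-- The projector of any cell reproduces `y^k` as a polynomial on the whole line, so in the local
coordinate of the spline `ν` the outcome depends neither on the cell `ν'` nor on `ε`. This is what
makes the two levels cancel. -/
lemma sum_integral_smul_locPoly {κ ε k L : ℕ} (hε : ε ≤ κ) (ν ν' : ℤ) (hk : k ≤ L) :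
    ∑ n ∈ Finset.range (L + 1), (∫ y, cellCoef (κ - ε) ν' n y * y ^ k) •
        locPoly ε (ν - 2 ^ ε * ν') n =
      (Polynomial.C ((2 : ℝ) ^ κ)⁻¹ * (Polynomial.X + Polynomial.C (ν : ℝ))) ^ k := by
  set P : Polynomial ℝ :=
    (Polynomial.C ((2 : ℝ) ^ (κ - ε))⁻¹ * (Polynomial.X + Polynomial.C (ν' : ℝ))) ^ k with hP
  have hd : P.degree < (L + 1 : ℕ) := by
    refine lt_of_le_of_lt ?_ (Nat.cast_lt.2 (Nat.lt_succ_of_le hk))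
    have h1 : (Polynomial.C ((2 : ℝ) ^ (κ - ε))⁻¹ * (Polynomial.X + Polynomial.C (ν' : ℝ)) :
        Polynomial ℝ).degree ≤ 1 := by
      compute_degree
    refine (Polynomial.degree_pow_le _ _).trans ?_
    calc _ ≤ k • (1 : WithBot ℕ) := nsmul_le_nsmul_right h1 k
      _ = k := by simp
  have h1 := congrArg (fun Q : Polynomial ℝ => Q.comp (Polynomial.C ((2 : ℝ) ^ ε)⁻¹ *
    (Polynomial.X + Polynomial.C ((ν - 2 ^ ε * ν' : ℤ) : ℝ))))
    (sum_polyInt_smul_orthonormalPoly (L + 1) hd)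
  rw [Polynomial.sum_comp] at h1
  simp_rw [Polynomial.smul_comp] at h1
  simp_rw [integral_cellCoef_mul_pow]
  refine h1.trans ?_
  rw [hP]
  simp only [Polynomial.pow_comp, Polynomial.mul_comp, Polynomial.C_comp, Polynomial.add_comp,
    Polynomial.X_comp]
  congr 1
  have e : ((2 : ℝ) ^ κ)⁻¹ = ((2 : ℝ) ^ (κ - ε))⁻¹ * ((2 : ℝ) ^ ε)⁻¹ := by
    rw [← mul_inv, ← pow_add, Nat.sub_add_cancel hε]
  rw [e]
  have e2 : (Polynomial.C (ν' : ℝ)) = Polynomial.C ((2 : ℝ) ^ ε)⁻¹ *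
      Polynomial.C ((2 : ℝ) ^ ε * ν') := by
    rw [← Polynomial.C_mul, inv_mul_cancel_left₀ (by positivity)]
  rw [e2]
  push_cast
  simp only [Polynomial.C_mul, Polynomial.C_sub]
  ring

/-- The kernel of the univariate operator `U`, as a polynomial in the local coordinate. -/
def locKernel (L m κ : ℕ) (ν : ℤ) (y : ℝ) : Polynomial ℝ :=
  ∑ ε ∈ signs1 κ, ∑ ρ ∈ refine1 m κ ν ε, ((-1) ^ ε * coef1 m ε (ν - 2 * ρ)) •
    ∑ n ∈ Finset.range (L + 1), cellCoef (κ - ε) (shift1 m (κ - ε) ρ) n y •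
      locPoly ε (ν - 2 ^ ε * shift1 m (κ - ε) ρ) n

lemma map_locKernel (Λ : Polynomial ℝ →ₗ[ℝ] ℝ) (L m κ : ℕ) (ν : ℤ) (y : ℝ) :
    Λ (locKernel L m κ ν y) =
      ∑ ε ∈ signs1 κ, ∑ ρ ∈ refine1 m κ ν ε, ((-1) ^ ε * coef1 m ε (ν - 2 * ρ)) *
        ∑ n ∈ Finset.range (L + 1), cellCoef (κ - ε) (shift1 m (κ - ε) ρ) n y *
          Λ (locPoly ε (ν - 2 ^ ε * shift1 m (κ - ε) ρ) n) := by
  simp only [locKernel, map_sum, map_smul, smul_eq_mul]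

lemma integrable_map_locKernel (Λ : Polynomial ℝ →ₗ[ℝ] ℝ) (L m κ : ℕ) (ν : ℤ) (k : ℕ) :
    Integrable fun y => Λ (locKernel L m κ ν y) * y ^ k := by
  simp_rw [map_locKernel, Finset.sum_mul]
  refine integrable_finsetSum _ fun ε _ => integrable_finsetSum _ fun ρ _ => ?_
  simp_rw [mul_assoc, Finset.sum_mul]
  refine ((integrable_finsetSum _ fun n _ => ?_).const_mul _).const_mul _
  refine ((integrable_cellCoef_mul_pow (κ - ε) (shift1 m (κ - ε) ρ) n k).const_mul
    (Λ (locPoly ε (ν - 2 ^ ε * shift1 m (κ - ε) ρ) n))).congr ?_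
  exact Filter.Eventually.of_forall fun y => by simp only; ring

/-- For each `ε` the coefficients sum to one and every projector reproduces `y^k`, so the level
contributes `(-1)^ε` times a common value. The hypothesis `1 ≤ κ` makes both signs occur. -/
lemma integral_map_locKernel (Λ : Polynomial ℝ →ₗ[ℝ] ℝ) {L m κ : ℕ} {ν : ℤ} (hκ : 1 ≤ κ)
    (hν : ν ∈ Finset.Icc (-(m : ℤ)) (2 ^ κ - 1)) {k : ℕ} (hk : k ≤ L) :
    ∫ y, Λ (locKernel L m κ ν y) * y ^ k = 0 := by
  have hterm : ∀ ε ρ, Integrable fun y => ((-1) ^ ε * coef1 m ε (ν - 2 * ρ)) *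
        ∑ n ∈ Finset.range (L + 1), (cellCoef (κ - ε) (shift1 m (κ - ε) ρ) n y * y ^ k) *
          Λ (locPoly ε (ν - 2 ^ ε * shift1 m (κ - ε) ρ) n) := fun ε ρ =>
    (integrable_finsetSum _ fun n _ => (integrable_cellCoef_mul_pow _ _ n k).mul_const _).const_mul _
  have e : ∀ y, Λ (locKernel L m κ ν y) * y ^ k =
      ∑ ε ∈ signs1 κ, ∑ ρ ∈ refine1 m κ ν ε, ((-1) ^ ε * coef1 m ε (ν - 2 * ρ)) *
        ∑ n ∈ Finset.range (L + 1), (cellCoef (κ - ε) (shift1 m (κ - ε) ρ) n y * y ^ k) *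
          Λ (locPoly ε (ν - 2 ^ ε * shift1 m (κ - ε) ρ) n) := fun y => by
    rw [map_locKernel, Finset.sum_mul]
    refine Finset.sum_congr rfl fun ε _ => ?_
    rw [Finset.sum_mul]
    refine Finset.sum_congr rfl fun ρ _ => ?_
    rw [mul_assoc, Finset.sum_mul]
    congr 1
    exact Finset.sum_congr rfl fun n _ => by ring
  simp_rw [e]
  rw [integral_finsetSum _ fun ε _ => integrable_finsetSum _ fun ρ _ => hterm ε ρ]
  have h2 : ∀ ε ∈ signs1 κ, ∫ y, ∑ ρ ∈ refine1 m κ ν ε, ((-1) ^ ε * coef1 m ε (ν - 2 * ρ)) *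
        ∑ n ∈ Finset.range (L + 1), (cellCoef (κ - ε) (shift1 m (κ - ε) ρ) n y * y ^ k) *
          Λ (locPoly ε (ν - 2 ^ ε * shift1 m (κ - ε) ρ) n) = (-1) ^ ε *
      Λ ((Polynomial.C ((2 : ℝ) ^ κ)⁻¹ * (Polynomial.X + Polynomial.C (ν : ℝ))) ^ k) := by
    intro ε hε
    rw [integral_finsetSum _ fun ρ _ => hterm ε ρ]
    have h3 : ∀ ρ ∈ refine1 m κ ν ε, ∫ y, ((-1) ^ ε * coef1 m ε (ν - 2 * ρ)) *
        ∑ n ∈ Finset.range (L + 1), (cellCoef (κ - ε) (shift1 m (κ - ε) ρ) n y * y ^ k) *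
          Λ (locPoly ε (ν - 2 ^ ε * shift1 m (κ - ε) ρ) n) =
        coef1 m ε (ν - 2 * ρ) * ((-1) ^ ε *
          Λ ((Polynomial.C ((2 : ℝ) ^ κ)⁻¹ * (Polynomial.X + Polynomial.C (ν : ℝ))) ^ k)) := by
      intro ρ _
      rw [integral_const_mul, integral_finsetSum _ fun n _ =>
        (integrable_cellCoef_mul_pow _ _ n k).mul_const _,
        ← sum_integral_smul_locPoly (mem_signs1 hε).2 ν (shift1 m (κ - ε) ρ) hk]
      simp only [map_sum, map_smul, smul_eq_mul, integral_mul_const]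
      ring
    rw [Finset.sum_congr rfl h3, ← Finset.sum_mul, sum_coef1 hν hε, one_mul]
  rw [Finset.sum_congr rfl h2, signs1_of_pos hκ, Finset.sum_pair (by norm_num)]
  ring

/-- The `a`-th derivative at `z` of the product of the `b`-th derivative of `psi m` with a
polynomial. -/
def splDeriv (m : ℕ) : ℕ → ℕ → ℝ → Polynomial ℝ →ₗ[ℝ] ℝ
  | 0, b, z => psiDeriv m b z • Polynomial.leval z
  | a + 1, b, z => splDeriv m a (b + 1) z + (splDeriv m a b z).comp Polynomial.derivative

lemma splDeriv_zero (m b : ℕ) (z : ℝ) (p : Polynomial ℝ) :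
    splDeriv m 0 b z p = psiDeriv m b z * p.eval z := rfl

lemma splDeriv_succ (m a b : ℕ) (z : ℝ) (p : Polynomial ℝ) : splDeriv m (a + 1) b z p =
    splDeriv m a (b + 1) z p + splDeriv m a b z (Polynomial.derivative p) := rfl

lemma hasDerivOff_splDeriv {m a b : ℕ} (h : a + b < m) (p : Polynomial ℝ) :
    HasDerivOff (fun z => splDeriv m a b z p) (fun z => splDeriv m (a + 1) b z p) := by
  induction a generalizing b p with
  | zero =>
    simp only [splDeriv_succ, splDeriv_zero]
    exact (hasDerivOff_psiDeriv (by omega)).mul (hasDerivOff_poly p)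
  | succ a ih =>
    simp only [splDeriv_succ m (a + 1), splDeriv_succ m a b]
    exact (ih (by omega) p).add (ih (by omega) _)

lemma measurable_splDeriv (m a b : ℕ) (p : Polynomial ℝ) :
    Measurable fun z => splDeriv m a b z p := by
  induction a generalizing b p with
  | zero => exact (measurable_psiDeriv m b).mul p.continuous.measurable
  | succ a ih => exact (ih _ _).add (ih _ _)

lemma splDeriv_eq_zero (m a b : ℕ) {z : ℝ} (hz : z ≤ 0 ∨ (m : ℝ) + 1 ≤ z) (p : Polynomial ℝ) :
    splDeriv m a b z p = 0 := by
  induction a generalizing b p with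
  | zero => rw [splDeriv_zero, psiDeriv_eq_zero m b hz, zero_mul]
  | succ a ih => rw [splDeriv_succ, ih, ih, add_zero]

lemma mem_of_splDeriv_ne_zero {m a b : ℕ} {z : ℝ} {p : Polynomial ℝ}
    (h : splDeriv m a b z p ≠ 0) : z ∈ Set.Ioo (0 : ℝ) (m + 1) := by
  by_contra hn
  rw [Set.mem_Ioo, not_and_or, not_lt, not_lt] at hn
  exact h (splDeriv_eq_zero m a b hn p)

lemma exists_splDeriv_bound (m a b : ℕ) (p : Polynomial ℝ) :
    ∃ C : ℝ, 0 ≤ C ∧ ∀ z, |splDeriv m a b z p| ≤ C := by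
  induction a generalizing b p with
  | zero =>
    obtain ⟨S, hS0, hS⟩ := exists_poly_bound p 0 (m + 1)
    refine ⟨2 ^ b * S, by positivity, fun z => ?_⟩
    by_cases hz : splDeriv m 0 b z p = 0
    · rw [hz, abs_zero]; positivity
    · rw [splDeriv_zero, abs_mul]
      exact mul_le_mul (abs_psiDeriv_le m b z)
        (hS z (Set.Ioo_subset_Icc_self (mem_of_splDeriv_ne_zero hz))) (abs_nonneg _) (by positivity)
  | succ a ih =>
    obtain ⟨C₁, h₁, hC₁⟩ := ih (b + 1) p
    obtain ⟨C₂, h₂, hC₂⟩ := ih b (Polynomial.derivative p)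
    exact ⟨C₁ + C₂, by positivity, fun z =>
      (abs_add_le _ _).trans (add_le_add (hC₁ z) (hC₂ z))⟩

/-- The `a`-th derivative in `x` of the kernel of the univariate operator, with polynomials of
degree at most `L`. -/
def opKernel (L m κ a : ℕ) (x y : ℝ) : ℝ :=
  ∑ ν ∈ Finset.Icc (-(m : ℤ)) (2 ^ κ - 1),
    (2 ^ κ) ^ a * splDeriv m a 0 (2 ^ κ * x - ν) (locKernel L m κ ν y)

lemma hasDerivOff_opKernel (L : ℕ) {m a : ℕ} (κ : ℕ) (h : a < m) (y : ℝ) :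
    HasDerivOff (fun x => opKernel L m κ a x y) (fun x => opKernel L m κ (a + 1) x y) := by
  refine HasDerivOff.sum _ fun ν _ => ?_
  have := ((hasDerivOff_splDeriv (b := 0) h (locKernel L m κ ν y)).comp_affine
    (a := 2 ^ κ) (by positivity) ν).const_mul ((2 ^ κ) ^ a)
  simp_rw [← mul_assoc, ← pow_succ] at this
  exact this

lemma measurable_opKernel (L m κ a : ℕ) : Measurable (Function.uncurry (opKernel L m κ a)) := by
  have e : Function.uncurry (opKernel L m κ a) = fun q : ℝ × ℝ =>
      ∑ ν ∈ Finset.Icc (-(m : ℤ)) (2 ^ κ - 1),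
        (2 ^ κ) ^ a * splDeriv m a 0 (2 ^ κ * q.1 - ν) (locKernel L m κ ν q.2) := rfl
  rw [e]
  refine Finset.measurable_fun_sum _ fun ν _ => ?_
  refine Measurable.const_mul (f := fun q : ℝ × ℝ =>
    splDeriv m a 0 (2 ^ κ * q.1 - ν) (locKernel L m κ ν q.2)) ?_ _
  simp_rw [map_locKernel]
  refine Finset.measurable_fun_sum _ fun ε _ => Finset.measurable_fun_sum _ fun ρ _ => ?_
  refine Measurable.const_mul (f := fun q : ℝ × ℝ => ∑ n ∈ Finset.range (L + 1),
    cellCoef (κ - ε) (shift1 m (κ - ε) ρ) n q.2 * splDeriv m a 0 (2 ^ κ * q.1 - ν)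
      (locPoly ε (ν - 2 ^ ε * shift1 m (κ - ε) ρ) n)) (Finset.measurable_fun_sum _ fun n _ => ?_) _
  exact ((measurable_cellCoef _ _ n).comp measurable_snd).mul
    ((measurable_splDeriv m a 0 _).comp (by fun_prop))

/-! ### Support, size and moments of the kernel -/

lemma map_locKernel_ne_zero {Λ : Polynomial ℝ →ₗ[ℝ] ℝ} {L m κ : ℕ} {ν : ℤ} {y : ℝ}
    (hν : ν ∈ Finset.Icc (-(m : ℤ)) (2 ^ κ - 1)) (h : Λ (locKernel L m κ ν y) ≠ 0) :
    y ∈ Set.Ioo (0 : ℝ) 1 ∧ -(3 * (m : ℝ) + 3) ≤ ν - 2 ^ κ * y ∧ ν - 2 ^ κ * y ≤ 3 * m + 1 := by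
  rw [map_locKernel] at h
  obtain ⟨ε, hε, h⟩ := Finset.exists_ne_zero_of_sum_ne_zero h
  obtain ⟨ρ, hρ, h⟩ := Finset.exists_ne_zero_of_sum_ne_zero h
  obtain ⟨n, _, h⟩ := Finset.exists_ne_zero_of_sum_ne_zero (right_ne_zero_of_mul h)
  have h1 := cellCoef_ne_zero (left_ne_zero_of_mul h)
  obtain ⟨h2, h3, h4⟩ := shift1_bounds hν hε hρ
  obtain ⟨hε1, hεκ⟩ := mem_signs1 hε
  rw [Finset.mem_Icc] at h4
  set σ := shift1 m (κ - ε) ρ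
  have h2' : (0 : ℝ) ≤ σ := by exact_mod_cast h2
  have h3' : (σ : ℝ) ≤ 2 ^ (κ - ε) - 1 := by exact_mod_cast h3
  have h4' : (-(3 * m + 1) : ℝ) ≤ ν - 2 ^ ε * σ := by exact_mod_cast h4.1
  have h5' : (ν - 2 ^ ε * σ : ℝ) ≤ 3 * m + 1 := by exact_mod_cast h4.2
  have hp : (0 : ℝ) < 2 ^ (κ - ε) := by positivity
  have hpe : (2 : ℝ) ^ κ = 2 ^ ε * 2 ^ (κ - ε) := by rw [← pow_add, Nat.add_sub_cancel' hεκ]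
  have hε0 : (0 : ℝ) < 2 ^ ε := by positivity
  have hε2 : (2 : ℝ) ^ ε ≤ 2 := by
    calc (2 : ℝ) ^ ε ≤ 2 ^ 1 := pow_le_pow_right₀ (by norm_num) hε1
      _ = 2 := pow_one 2
  have h6 : 0 < 2 ^ (κ - ε) * y := by linarith [h1.1]
  have h7 : 2 ^ (κ - ε) * y < 2 ^ (κ - ε) * 1 := by linarith [h1.2]
  refine ⟨⟨pos_of_mul_pos_right h6 hp.le, lt_of_mul_lt_mul_left h7 hp.le⟩, ?_, ?_⟩
  · have := mul_lt_mul_of_pos_left h1.2 hε0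
    rw [hpe]; linarith
  · have := mul_pos hε0 h1.1
    rw [hpe]; linarith

lemma opKernel_ne_zero {L m κ a : ℕ} {x y : ℝ} (h : opKernel L m κ a x y ≠ 0) :
    y ∈ Set.Ioo (0 : ℝ) 1 ∧ |x - y| ≤ (4 * m + 3) * (2 ^ κ : ℝ)⁻¹ := by
  obtain ⟨ν, hν, h⟩ := Finset.exists_ne_zero_of_sum_ne_zero h
  have h0 := right_ne_zero_of_mul h
  have h1 := mem_of_splDeriv_ne_zero h0
  obtain ⟨h2, h3, h4⟩ := map_locKernel_ne_zero hν h0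
  refine ⟨h2, ?_⟩
  have hp : (0 : ℝ) < 2 ^ κ := by positivity
  rw [← div_eq_mul_inv, le_div_iff₀ hp, ← abs_of_pos hp, ← abs_mul, abs_le]
  have hm : (0 : ℝ) ≤ m := m.cast_nonneg
  constructor <;> linarith [h1.1, h1.2]

/-- At a given `x` at most `m + 2` splines are active. In the local coordinate only finitely many
polynomials `locPoly ε i n` occur, whatever `κ` is, so their derivative bounds are uniform. The
powers of `2^κ` come from the normalisation of the projector and from the chain rule. -/
lemma exists_opKernel_bound (L m a : ℕ) : ∃ C : ℝ, 0 < C ∧ ∀ (κ : ℕ) (x y : ℝ),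
    |opKernel L m κ a x y| ≤ C * (2 ^ κ) ^ (a + 1) := by
  choose S hS0 hS using fun n => exists_poly_bound (orthonormalPoly n) 0 1
  choose T hT0 hT using fun p => exists_splDeriv_bound m a 0 p
  set D : ℝ := ∑ n ∈ Finset.range (L + 1), S n * ∑ ε ∈ Finset.range 2,
    ∑ i ∈ Finset.Icc (-(3 * m + 1 : ℤ)) (3 * m + 1), T (locPoly ε i n) with hD
  have hD0 : 0 ≤ D := Finset.sum_nonneg fun n _ => mul_nonneg (hS0 n) <|
    Finset.sum_nonneg fun ε _ => Finset.sum_nonneg fun i _ => hT0 _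
  have hTle : ∀ n ε i, ε ∈ Finset.range 2 → i ∈ Finset.Icc (-(3 * m + 1 : ℤ)) (3 * m + 1) →
      T (locPoly ε i n) ≤ ∑ ε ∈ Finset.range 2,
        ∑ i ∈ Finset.Icc (-(3 * m + 1 : ℤ)) (3 * m + 1), T (locPoly ε i n) := by
    intro n ε i hε hi
    refine (Finset.single_le_sum (f := fun i => T (locPoly ε i n)) (fun i _ => hT0 _) hi).trans ?_
    exact Finset.single_le_sum (f := fun ε => ∑ i ∈ Finset.Icc (-(3 * m + 1 : ℤ)) (3 * m + 1),
      T (locPoly ε i n)) (fun ε _ => Finset.sum_nonneg fun i _ => hT0 _) hε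
  have hloc : ∀ (κ : ℕ) (ν : ℤ) (z y : ℝ), ν ∈ Finset.Icc (-(m : ℤ)) (2 ^ κ - 1) →
      |splDeriv m a 0 z (locKernel L m κ ν y)| ≤ 2 * (2 ^ κ * D) := by
    intro κ ν z y hν
    rw [map_locKernel]
    have h1 : ∀ ε ∈ signs1 κ, |∑ ρ ∈ refine1 m κ ν ε, ((-1) ^ ε * coef1 m ε (ν - 2 * ρ)) *
        ∑ n ∈ Finset.range (L + 1), cellCoef (κ - ε) (shift1 m (κ - ε) ρ) n y *
          splDeriv m a 0 z (locPoly ε (ν - 2 ^ ε * shift1 m (κ - ε) ρ) n)| ≤ 2 ^ κ * D := by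
      intro ε hε
      have h2 : ∀ ρ ∈ refine1 m κ ν ε, |((-1) ^ ε * coef1 m ε (ν - 2 * ρ)) *
        ∑ n ∈ Finset.range (L + 1), cellCoef (κ - ε) (shift1 m (κ - ε) ρ) n y *
          splDeriv m a 0 z (locPoly ε (ν - 2 ^ ε * shift1 m (κ - ε) ρ) n)| ≤
          coef1 m ε (ν - 2 * ρ) * (2 ^ κ * D) := by
        intro ρ hρ
        rw [abs_mul, abs_mul, abs_pow, abs_neg, abs_one, one_pow, one_mul,
          abs_of_nonneg (coef1_nonneg _ _ _)]
        refine mul_le_mul_of_nonneg_left ?_ (coef1_nonneg _ _ _)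
        refine (Finset.abs_sum_le_sum_abs _ _).trans ?_
        rw [hD, Finset.mul_sum]
        refine Finset.sum_le_sum fun n _ => ?_
        rw [abs_mul, ← mul_assoc]
        refine mul_le_mul ?_ ((hT _ z).trans (hTle n ε _ ?_ (shift1_bounds hν hε hρ).2.2))
          (abs_nonneg _) (mul_nonneg (by positivity) (hS0 n))
        · refine (abs_cellCoef_le (hS0 n) (hS n) _ _ _).trans ?_
          exact mul_le_mul_of_nonneg_right
            (pow_le_pow_right₀ (by norm_num) (Nat.sub_le _ _)) (hS0 n)
        · exact Finset.mem_range.2 (Nat.lt_succ_of_le (mem_signs1 hε).1)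
      refine (Finset.abs_sum_le_sum_abs _ _).trans ((Finset.sum_le_sum h2).trans ?_)
      rw [← Finset.sum_mul, sum_coef1 hν hε, one_mul]
    refine (Finset.abs_sum_le_sum_abs _ _).trans ((Finset.sum_le_sum h1).trans ?_)
    rw [Finset.sum_const, nsmul_eq_mul]
    refine mul_le_mul_of_nonneg_right ?_ (by positivity)
    have : (signs1 κ).card ≤ 2 := (Finset.card_filter_le _ _).trans (by simp)
    exact_mod_cast this
  refine ⟨(m + 2) * (2 * (D + 1)), by positivity, fun κ x y => ?_⟩
  have hp : (0 : ℝ) < 2 ^ κ := by positivity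
  -- Indices with `0 < 2^κ x - ν < m + 1`, up to rounding.
  set s := Finset.Icc (⌊(2 : ℝ) ^ κ * x⌋ - (m : ℤ) - 1) ⌊(2 : ℝ) ^ κ * x⌋ with hs
  have hbound : ∀ ν ∈ Finset.Icc (-(m : ℤ)) (2 ^ κ - 1),
      |(2 ^ κ) ^ a * splDeriv m a 0 (2 ^ κ * x - ν) (locKernel L m κ ν y)| ≤
        if ν ∈ s then (2 ^ κ) ^ a * (2 * (2 ^ κ * D)) else 0 := by
    intro ν hν
    split_ifs with hmem
    · rw [abs_mul, abs_of_pos (pow_pos hp a)]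
      exact mul_le_mul_of_nonneg_left (hloc κ ν _ y hν) (by positivity)
    · have : splDeriv m a 0 (2 ^ κ * x - ν) (locKernel L m κ ν y) = 0 := by
        by_contra hne
        have h1 := mem_of_splDeriv_ne_zero hne
        apply hmem
        rw [hs, Finset.mem_Icc]
        constructor
        · have h2 : (2 : ℝ) ^ κ * x < ((ν + m + 1 : ℤ) : ℝ) := by push_cast; linarith [h1.2]
          have := Int.floor_lt.2 h2
          omega
        · exact Int.le_floor.2 (by linarith [h1.1])
      rw [this, mul_zero, abs_zero]
  rw [opKernel]
  refine (Finset.abs_sum_le_sum_abs _ _).trans ((Finset.sum_le_sum hbound).trans ?_)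
  rw [← Finset.sum_filter, Finset.sum_const, nsmul_eq_mul]
  have hcard : ((Finset.filter (fun ν => ν ∈ s) (Finset.Icc (-(m : ℤ)) (2 ^ κ - 1))).card : ℝ) ≤
      m + 2 := by
    have h1 : Finset.filter (fun ν => ν ∈ s) (Finset.Icc (-(m : ℤ)) (2 ^ κ - 1)) ⊆ s :=
      fun ν hν => (Finset.mem_filter.1 hν).2
    have h2 := Finset.card_le_card h1
    have h3 : s.card = m + 2 := by rw [hs, Int.card_Icc]; omega
    rw [h3] at h2
    exact_mod_cast h2
  calc _ ≤ ((m : ℝ) + 2) * ((2 ^ κ) ^ a * (2 * (2 ^ κ * D))) :=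
        mul_le_mul_of_nonneg_right hcard (by positivity)
    _ ≤ ((m : ℝ) + 2) * ((2 ^ κ) ^ a * (2 * (2 ^ κ * (D + 1)))) := by gcongr; linarith
    _ = _ := by rw [pow_succ]; ring

lemma integral_opKernel_mul_pow {L m κ a : ℕ} (hκ : 1 ≤ κ) (x : ℝ) {k : ℕ} (hk : k ≤ L) :
    ∫ y, opKernel L m κ a x y * y ^ k = 0 := by
  simp_rw [opKernel, Finset.sum_mul, mul_assoc]
  rw [integral_finsetSum _ fun ν _ => (integrable_map_locKernel _ L m κ ν k).const_mul _]
  refine Finset.sum_eq_zero fun ν hν => ?_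
  rw [integral_const_mul, integral_map_locKernel _ hκ hν hk, mul_zero]

/-- For `κ ≠ 0` this applies `exists_diffRep` on the part of `(0,1)` within `(4m + 4) 2^{-κ}` of
`x`. That interval has length between `2^{-κ}` and `(8m + 8) 2^{-κ}`: the lower bound yields the
extra factor `2^κ` in the size of the kernel, the upper one the requirement on `T`. -/
lemma exists_opKernel_rep (L m a : ℕ) {T : ℝ} (hT : 8 * (m : ℝ) + 8 ≤ T) :
    ∃ C : ℝ, 0 < C ∧ ∀ (κ : ℕ) (x : ℝ), ∃ K : ℝ → ℝ → ℝ, Measurable (Function.uncurry K) ∧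
      (∀ z ξ, |K z ξ| ≤ C * (2 ^ κ) ^ (a + 2)) ∧
      (∀ z ξ, K z ξ ≠ 0 → z ∈ Set.Ioo (0 : ℝ) 1 ∧
        z + ((if κ ≠ 0 then L + 1 else 0 : ℕ) : ℝ) * ξ ∈ Set.Ioo (0 : ℝ) 1 ∧
        |ξ| ≤ T * (2 ^ κ : ℝ)⁻¹ ∧ |z - x| ≤ T * (2 ^ κ : ℝ)⁻¹) ∧
      IsDiffRep (if κ ≠ 0 then L + 1 else 0) (opKernel L m κ a x) K := by
  obtain ⟨C₁, hC₁, hbd⟩ := exists_opKernel_bound L m a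
  obtain ⟨C₂, hC₂, hrep⟩ := exists_diffRep (l := L + 1) (by omega)
  have hm0 : (0 : ℝ) ≤ m := m.cast_nonneg
  have hT8 : 8 ≤ T := by linarith
  refine ⟨C₁ + C₂ * C₁, by positivity, fun κ x => ?_⟩
  have hp : (1 : ℝ) ≤ 2 ^ κ := one_le_pow₀ (by norm_num)
  have hwm : Measurable (opKernel L m κ a x) :=
    (measurable_opKernel L m κ a).comp measurable_prodMk_left
  set δ : ℝ := (2 ^ κ : ℝ)⁻¹ with hδ
  have hδ0 : 0 < δ := by positivity
  have hδ1 : δ ≤ 1 := inv_le_one_of_one_le₀ hp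
  by_cases hκ : κ = 0
  · subst hκ
    have hδe : δ = 1 := by rw [hδ]; simp
    -- The difference of order `0` ignores `ξ`, so the kernel is tensored with the uniform
    -- probability density on `[-T, T]`. All coordinates then have the same form.
    refine ⟨fun z ξ => opKernel L m 0 a x z * (Set.Icc (-T) T).indicator (fun _ => (2 * T)⁻¹) ξ,
      ?_, fun z ξ => ?_, fun z ξ h => ?_, fun y => ?_⟩
    · exact (hwm.comp measurable_fst).mul
        ((measurable_const.indicator measurableSet_Icc).comp measurable_snd)
    · have h1 := hbd 0 x z
      have h2 : |(Set.Icc (-T) T).indicator (fun _ => (2 * T)⁻¹) ξ| ≤ 1 := by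
        rw [Set.indicator]; split_ifs
        · rw [abs_of_pos (by positivity)]
          exact inv_le_one_of_one_le₀ (by linarith)
        · simp
      rw [abs_mul]
      refine (mul_le_of_le_one_right (abs_nonneg _) h2).trans (h1.trans ?_)
      simp only [pow_zero, one_pow, mul_one]
      linarith [mul_pos hC₂ hC₁]
    · have h1 := opKernel_ne_zero (left_ne_zero_of_mul h)
      have h2 : ξ ∈ Set.Icc (-T) T := by
        by_contra hn; exact right_ne_zero_of_mul h (Set.indicator_of_notMem hn _)
      refine ⟨h1.1, by simpa using h1.1, ?_, ?_⟩
      · rw [hδe, mul_one]; exact abs_le.2 h2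
      · rw [abs_sub_comm]
        refine h1.2.trans ?_
        rw [← hδ]
        gcongr
        linarith
    · simp only [ne_eq, not_true_eq_false, if_false, zero_add, Finset.sum_range_one,
        Nat.sub_zero, pow_zero, Nat.choose_self, Nat.cast_one, one_mul, Nat.cast_zero, zero_mul,
        sub_zero]
      rw [integral_const_mul, integral_indicator measurableSet_Icc]
      simp only [integral_const, MeasurableSet.univ, measureReal_restrict_apply, Set.univ_inter,
        Real.volume_real_Icc, smul_eq_mul]
      rw [max_eq_left (by linarith)]
      have : T ≠ 0 := by linarith
      field_simp
      ring
  · have hκ1 : 1 ≤ κ := Nat.one_le_iff_ne_zero.2 hκ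
    simp only [ne_eq, hκ, not_false_eq_true, if_true]
    -- If the kernel vanishes identically the interval around `x` may miss `(0,1)`. Otherwise a
    -- point of its support guarantees length at least `2^{-κ}`.
    by_cases hw0 : ∀ y, opKernel L m κ a x y = 0
    · refine ⟨fun _ _ => 0, measurable_const, fun z ξ => ?_, fun z ξ h => absurd rfl h, fun y => ?_⟩
      · rw [abs_zero]; positivity
      · simp [hw0 y]
    · rw [not_forall] at hw0
      obtain ⟨y₀, hy₀⟩ := hw0
      obtain ⟨hy1, hy2⟩ := opKernel_ne_zero hy₀
      rw [← hδ, abs_le] at hy2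
      set A : ℝ := max 0 (x - (4 * m + 4) * δ) with hA
      set R : ℝ := min 1 (x + (4 * m + 4) * δ) with hR
      have hA1 : A ≤ max 0 (y₀ - δ) := max_le_max le_rfl (by linarith [hy2.2])
      have hR1 : min 1 (y₀ + δ) ≤ R := min_le_min le_rfl (by linarith [hy2.1])
      have hL : δ ≤ R - A := by
        have : δ ≤ min 1 (y₀ + δ) - max 0 (y₀ - δ) := by
          rcases max_cases 0 (y₀ - δ) with h | h <;> rcases min_cases 1 (y₀ + δ) with h' | h' <;>
            rw [h.1, h'.1] <;> linarith [hy1.1, hy1.2]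
        linarith
      have hA0 : 0 ≤ A := le_max_left _ _
      have hR0 : R ≤ 1 := min_le_left _ _
      have hA2 : x - (4 * m + 4) * δ ≤ A := le_max_right _ _
      have hR2 : R ≤ x + (4 * m + 4) * δ := min_le_right _ _
      obtain ⟨K, hKm, hKb, hKs, hK⟩ := hrep A (R - A) (C₁ * (2 ^ κ) ^ (a + 1))
        (opKernel L m κ a x) (by linarith) hwm (hbd κ x) (fun y hy => by
          obtain ⟨h1, h2⟩ := opKernel_ne_zero hy
          rw [← hδ, abs_le] at h2
          rw [add_sub_cancel]
          exact ⟨max_lt h1.1 (by linarith [h2.2]), lt_min h1.2 (by linarith [h2.1])⟩)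
        (fun n hn => integral_opKernel_mul_pow hκ1 x (Nat.lt_succ_iff.1 hn))
      rw [add_sub_cancel] at hKs
      have hTδ : (8 * (m : ℝ) + 8) * δ ≤ T * δ := mul_le_mul_of_nonneg_right hT hδ0.le
      refine ⟨K, hKm, fun z ξ => (hKb z ξ).trans ?_, fun z ξ h => ?_, hK⟩
      · calc _ ≤ C₂ * (C₁ * (2 ^ κ) ^ (a + 1)) / δ := by gcongr
          _ = C₂ * C₁ * (2 ^ κ) ^ (a + 2) := by rw [hδ, div_inv_eq_mul]; ring
          _ ≤ _ := by gcongr; linarith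
      · obtain ⟨h1, h2, h3⟩ := hKs z ξ h
        refine ⟨⟨by linarith [h1.1], by linarith [h1.2]⟩, ⟨by linarith [h2.1], by linarith [h2.2]⟩,
          by linarith, ?_⟩
        have : 0 ≤ m * δ := by positivity
        rw [abs_le]
        constructor <;> linarith [h1.1, h1.2]

/-! ### The operator as a tensor product -/

/-- `φ` is measurable and bounded. -/
def BddMeas (φ : ℝ → ℝ) : Prop := Measurable φ ∧ ∃ C : ℝ, ∀ x, |φ x| ≤ C

lemma BddMeas.const_mul {φ : ℝ → ℝ} (h : BddMeas φ) (c : ℝ) : BddMeas fun x => c * φ x := by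
  obtain ⟨h1, C, hC⟩ := h
  refine ⟨h1.const_mul c, |c| * C, fun x => ?_⟩
  rw [abs_mul]
  exact mul_le_mul_of_nonneg_left (hC x) (abs_nonneg c)

lemma BddMeas.sum {ι : Type*} (s : Finset ι) {φ : ι → ℝ → ℝ} (h : ∀ i ∈ s, BddMeas (φ i)) :
    BddMeas fun x => ∑ i ∈ s, φ i x := by
  classical
  induction s using Finset.induction_on with
  | empty => exact ⟨by simp, 0, by simp⟩
  | insert a s ha ih =>
    obtain ⟨h1, C, hC⟩ := h a (Finset.mem_insert_self a s)
    obtain ⟨h2, D, hD⟩ := ih fun i hi => h i (Finset.mem_insert_of_mem hi)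
    simp_rw [Finset.sum_insert ha]
    exact ⟨h1.add h2, C + D, fun x => (abs_add_le _ _).trans (add_le_add (hC x) (hD x))⟩

variable {d : ℕ}

lemma measurable_prod_apply {φ : Fin d → ℝ → ℝ} (h : ∀ j, Measurable (φ j)) :
    Measurable fun y : Fin d → ℝ => ∏ j, φ j (y j) :=
  Finset.measurable_fun_prod _ fun j _ => (h j).comp (measurable_pi_apply j)

lemma integrable_mul_prod {F : (Fin d → ℝ) → ℝ} (hF : Integrable F) {φ : Fin d → ℝ → ℝ}
    (h : ∀ j, BddMeas (φ j)) : Integrable fun y => F y * ∏ j, φ j (y j) := by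
  choose h1 C hC using h
  refine hF.mul_bdd (c := ∏ j, C j) (measurable_prod_apply h1).aestronglyMeasurable
    (Filter.Eventually.of_forall fun y => ?_)
  rw [Real.norm_eq_abs, Finset.abs_prod]
  exact Finset.prod_le_prod (fun j _ => abs_nonneg _) fun j _ => hC j _

lemma integral_mul_prod_sum {ι : Type*} [DecidableEq ι] {F : (Fin d → ℝ) → ℝ} (hF : Integrable F)
    (s : Fin d → Finset ι) {φ : Fin d → ι → ℝ → ℝ} (h : ∀ j, ∀ i ∈ s j, BddMeas (φ j i)) :
    ∫ y, F y * ∏ j, ∑ i ∈ s j, φ j i (y j) =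
      ∑ p ∈ Fintype.piFinset s, ∫ y, F y * ∏ j, φ j (p j) (y j) := by
  simp_rw [Finset.prod_univ_sum, Finset.mul_sum]
  exact integral_finsetSum _ fun p hp =>
    integrable_mul_prod hF fun j => h j (p j) (Fintype.mem_piFinset.1 hp j)

lemma integral_mul_prod_const_mul (F : (Fin d → ℝ) → ℝ) (c : Fin d → ℝ) (φ : Fin d → ℝ → ℝ) :
    ∫ y, F y * ∏ j, c j * φ j (y j) = (∏ j, c j) * ∫ y, F y * ∏ j, φ j (y j) := by
  simp_rw [Finset.prod_mul_distrib]
  rw [← integral_const_mul]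
  congr 1; funext y; ring

lemma bddMeas_cellCoef (κ : ℕ) (ν : ℤ) (n : ℕ) : BddMeas (cellCoef κ ν n) := by
  obtain ⟨S, hS0, hS⟩ := exists_poly_bound (orthonormalPoly n) 0 1
  exact ⟨measurable_cellCoef κ ν n, _, abs_cellCoef_le hS0 hS κ ν⟩

/-- The sum over `μ ≤ L` factors into univariate sums. In this product form the signs and the
refinement coefficients can be distributed over the coordinates as well. -/
lemma localProj_eq {F : (Fin d → ℝ) → ℝ} (hF : Integrable F) (L κ : Fin d → ℕ) (ν : Fin d → ℤ)
    (x : Fin d → ℝ) :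
    localProj L (fun j => ((2 : ℝ) ^ κ j)⁻¹) (fun j => ((2 : ℝ) ^ κ j)⁻¹ * (ν j : ℝ)) F x =
      ∫ y, F y * ∏ j, ∑ n ∈ Finset.range (L j + 1),
        (orthonormalPoly n).eval (2 ^ κ j * x j - ν j) * cellCoef (κ j) (ν j) n (y j) := by
  rw [integral_mul_prod_sum hF _ fun j n _ => (bddMeas_cellCoef _ _ n).const_mul _]
  have hset : Fintype.piFinset (fun j => Finset.range (L j + 1)) = Finset.Iic L := by
    ext μ
    simp only [Fintype.mem_piFinset, Finset.mem_range, Finset.mem_Iic, Nat.lt_succ_iff, Pi.le_def]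
  rw [hset, localProj, Finset.mul_sum]
  refine Finset.sum_congr rfl fun μ _ => ?_
  have hb : ∀ y, cellBasis (fun j => ((2 : ℝ) ^ κ j)⁻¹)
      (fun j => ((2 : ℝ) ^ κ j)⁻¹ * (ν j : ℝ)) μ y =
      ∏ j, (orthonormalPoly (μ j)).eval (2 ^ κ j * y j - ν j) := fun y => by
    rw [cellBasis]
    refine Finset.prod_congr rfl fun j _ => ?_
    congr 1
    field_simp
  have hmeas : MeasurableSet (cell (fun j => ((2 : ℝ) ^ κ j)⁻¹ * (ν j : ℝ))
      (fun j => ((2 : ℝ) ^ κ j)⁻¹)) :=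
    MeasurableSet.univ_pi fun j => measurableSet_Ioo
  rw [integral_mul_prod_const_mul F (fun j => (orthonormalPoly (μ j)).eval (2 ^ κ j * x j - ν j))
    (fun j => cellCoef (κ j) (ν j) (μ j)), hb x, mul_comm, mul_assoc, mul_comm,
    mul_assoc]
  congr 1
  rw [← integral_indicator hmeas, ← integral_const_mul]
  congr 1; funext y
  by_cases hy : y ∈ cell (fun j => ((2 : ℝ) ^ κ j)⁻¹ * (ν j : ℝ)) (fun j => ((2 : ℝ) ^ κ j)⁻¹)
  · rw [Set.indicator_of_mem hy, hb, ← Finset.prod_inv_distrib, mul_left_comm, ← Finset.prod_mul_distrib]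
    congr 1
    refine Finset.prod_congr rfl fun j _ => ?_
    rw [cellCoef, Set.indicator_of_mem (hy j (Set.mem_univ j)), inv_inv]
  · rw [Set.indicator_of_notMem hy, mul_zero]
    have : ∃ j, y j ∉ Set.Ioo (((2 : ℝ) ^ κ j)⁻¹ * (ν j : ℝ))
        (((2 : ℝ) ^ κ j)⁻¹ * (ν j : ℝ) + ((2 : ℝ) ^ κ j)⁻¹) := by
      by_contra hn
      push Not at hn
      exact hy fun j _ => hn j
    obtain ⟨j, hj⟩ := this
    rw [Finset.prod_eq_zero (Finset.mem_univ j), mul_zero]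
    rw [cellCoef, Set.indicator_of_notMem hj]

lemma indexBox_eq (m κ : Fin d → ℕ) : indexBox m κ =
    Fintype.piFinset fun j => Finset.Icc (-(m j : ℤ)) (2 ^ κ j - 1) := by
  ext ν
  simp only [indexBox, Fintype.mem_piFinset, Finset.mem_Icc, Pi.le_def, forall_and]

lemma signs_eq (κ : Fin d → ℕ) : signs κ = Fintype.piFinset fun j => signs1 (κ j) := by
  ext ε
  simp only [signs, signs1, supp, Fintype.mem_piFinset, Finset.mem_filter, Finset.mem_Icc,
    Pi.le_def, Finset.subset_iff, Finset.mem_univ, true_and, Pi.zero_apply, Pi.one_apply, ← forall_and]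

lemma refineSet_eq (m κ : Fin d → ℕ) (ν : Fin d → ℤ) (ε : Fin d → ℕ) : refineSet m κ ν ε =
    Fintype.piFinset fun j => refine1 (m j) (κ j) (ν j) (ε j) := by
  ext ρ
  simp only [refineSet, refine1, indexBox_eq, supp, Fintype.mem_piFinset, Finset.mem_filter,
    Finset.mem_univ, true_and, Pi.sub_apply, not_not, ← forall_and]

lemma opU_eq {F : (Fin d → ℝ) → ℝ} (hF : Integrable F) {L m κ : Fin d → ℕ} {ν : Fin d → ℤ}
    {x : Fin d → ℝ} (hx : x ∈ bigCell m) : opU L m κ ν F x =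
    ∫ y, F y * ∏ j, (locKernel (L j) (m j) (κ j) (ν j) (y j)).eval (2 ^ κ j * x j - ν j) := by
  have e1 : ∀ j y, (locKernel (L j) (m j) (κ j) (ν j) y).eval (2 ^ κ j * x j - ν j) =
      ∑ ε ∈ signs1 (κ j), ∑ ρ ∈ refine1 (m j) (κ j) (ν j) ε,
        ((-1) ^ ε * coef1 (m j) ε (ν j - 2 * ρ)) *
        ∑ n ∈ Finset.range (L j + 1), (locPoly ε (ν j - 2 ^ ε * shift1 (m j) (κ j - ε) ρ) n).eval
          (2 ^ κ j * x j - ν j) * cellCoef (κ j - ε) (shift1 (m j) (κ j - ε) ρ) n y := fun j y => by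
    have := map_locKernel (Polynomial.leval (2 ^ κ j * x j - ν j)) (L j) (m j) (κ j) (ν j) y
    simp only [Polynomial.leval_apply] at this
    rw [this]
    refine Finset.sum_congr rfl fun ε _ => Finset.sum_congr rfl fun ρ _ => ?_
    congr 1
    exact Finset.sum_congr rfl fun n _ => mul_comm _ _
  have hbm : ∀ j ε ρ, BddMeas fun y => ((-1) ^ ε * coef1 (m j) ε (ν j - 2 * ρ)) *
        ∑ n ∈ Finset.range (L j + 1), (locPoly ε (ν j - 2 ^ ε * shift1 (m j) (κ j - ε) ρ) n).eval
          (2 ^ κ j * x j - ν j) * cellCoef (κ j - ε) (shift1 (m j) (κ j - ε) ρ) n y :=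
    fun j ε ρ => (BddMeas.sum _ fun n _ => (bddMeas_cellCoef _ _ n).const_mul _).const_mul _
  simp_rw [e1]
  rw [integral_mul_prod_sum hF _ fun j ε _ => BddMeas.sum _ fun ρ _ => hbm j ε ρ, opU, signs_eq]
  refine Finset.sum_congr rfl fun ε hε => ?_
  rw [integral_mul_prod_sum hF _ fun j ρ _ => hbm j (ε j) ρ, refineSet_eq, Finset.mul_sum]
  refine Finset.sum_congr rfl fun ρ hρ => ?_
  rw [integral_mul_prod_const_mul F (fun j => (-1) ^ ε j * coef1 (m j) (ε j) (ν j - 2 * ρ j))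
    (fun j y => ∑ n ∈ Finset.range (L j + 1),
      (locPoly (ε j) (ν j - 2 ^ ε j * shift1 (m j) (κ j - ε j) (ρ j)) n).eval
        (2 ^ κ j * x j - ν j) * cellCoef (κ j - ε j) (shift1 (m j) (κ j - ε j) (ρ j)) n y),
    Finset.prod_mul_distrib, mul_assoc]
  congr 1
  have e2 : ∏ j ∈ supp ε, refineCoeff (m j) (ν j - 2 * ρ j) =
      ∏ j, coef1 (m j) (ε j) (ν j - 2 * ρ j) := by
    rw [supp, Finset.prod_filter]
    refine Finset.prod_congr rfl fun j _ => ?_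
    by_cases h : ε j = 0 <;> simp [coef1, h]
  rw [e2, opS, Set.indicator_of_mem hx]
  congr 1
  have h3 := localProj_eq hF L (κ - ε) (shiftIndex m (κ - ε) ρ) x
  rw [h3]
  congr 1; funext y
  congr 1
  refine Finset.prod_congr rfl fun j _ => Finset.sum_congr rfl fun n _ => ?_
  have e3 : shiftIndex m (κ - ε) ρ j = shift1 (m j) (κ j - ε j) (ρ j) := rfl
  rw [e3, Pi.sub_apply]
  congr 1
  rw [locPoly]
  simp only [Polynomial.eval_comp, Polynomial.eval_mul, Polynomial.eval_C, Polynomial.eval_add,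
    Polynomial.eval_X]
  congr 1
  have hεκ : ε j ≤ κ j := (mem_signs1 (Fintype.mem_piFinset.1 hε j)).2
  have e4 : (2 : ℝ) ^ κ j = 2 ^ (κ j - ε j) * 2 ^ ε j := by
    rw [← pow_add, Nat.sub_add_cancel hεκ]
  push_cast
  rw [e4]
  field_simp
  ring

/-- This is what makes the cut-off in `opS` harmless: `opU` is always multiplied by a spline that
vanishes off the large cell. -/
lemma mem_bigCell_of_spline_ne_zero {m κ : Fin d → ℕ} {ν : Fin d → ℤ} {x : Fin d → ℝ}
    (hν : ν ∈ indexBox m κ) (h : spline m κ ν x ≠ 0) : x ∈ bigCell m := by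
  intro j _
  have h1 : psi (m j) (2 ^ κ j * x j - ν j) ≠ 0 := Finset.prod_ne_zero_iff.1 h j (Finset.mem_univ j)
  rw [indexBox_eq, Fintype.mem_piFinset] at hν
  have h2 := Finset.mem_Icc.1 (hν j)
  have h3 : (-(m j : ℝ)) ≤ ν j := by exact_mod_cast h2.1
  have h4 : (ν j : ℝ) ≤ 2 ^ κ j - 1 := by exact_mod_cast h2.2
  have h5 : 0 < 2 ^ κ j * x j - ν j := by
    by_contra hn; exact h1 (psi_eq_zero _ (Or.inl (not_lt.1 hn)))
  have h6 : 2 ^ κ j * x j - ν j < m j + 1 := by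
    by_contra hn; exact h1 (psi_eq_zero _ (Or.inr (not_lt.1 hn)))
  have hp : (1 : ℝ) ≤ 2 ^ κ j := one_le_pow₀ (by norm_num)
  have hm : (0 : ℝ) ≤ m j := (m j).cast_nonneg
  constructor
  · by_contra hn
    rw [not_lt] at hn
    have : (2 : ℝ) ^ κ j * x j ≤ 2 ^ κ j * (-(m j + 1)) :=
      mul_le_mul_of_nonneg_left hn (by positivity)
    nlinarith
  · by_contra hn
    rw [not_lt] at hn
    have : (2 : ℝ) ^ κ j * (m j + 2) ≤ 2 ^ κ j * x j :=
      mul_le_mul_of_nonneg_left (by linarith) (by positivity)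
    nlinarith

lemma bddMeas_map_locKernel (Λ : Polynomial ℝ →ₗ[ℝ] ℝ) (L m κ : ℕ) (ν : ℤ) :
    BddMeas fun y => Λ (locKernel L m κ ν y) := by
  simp_rw [map_locKernel]
  refine BddMeas.sum _ fun ε _ => BddMeas.sum _ fun ρ _ => BddMeas.const_mul
    (BddMeas.sum _ fun n _ => ?_) _
  have := (bddMeas_cellCoef (κ - ε) (shift1 m (κ - ε) ρ) n).const_mul
    (Λ (locPoly ε (ν - 2 ^ ε * shift1 m (κ - ε) ρ) n))
  simpa [mul_comm] using this

lemma opE_eq {F : (Fin d → ℝ) → ℝ} (hF : Integrable F) (L m κ : Fin d → ℕ) (x : Fin d → ℝ) :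
    opE L m κ F x = ∫ y, F y * ∏ j, opKernel (L j) (m j) (κ j) 0 (x j) (y j) := by
  simp_rw [opKernel, pow_zero, one_mul]
  rw [integral_mul_prod_sum hF _ fun j ν _ => bddMeas_map_locKernel _ _ _ _ ν, opE, indexBox_eq]
  refine Finset.sum_congr rfl fun ν hν => ?_
  rw [← indexBox_eq] at hν
  simp_rw [splDeriv_zero, psiDeriv_zero]
  rw [integral_mul_prod_const_mul F (fun j => psi (m j) (2 ^ κ j * x j - ν j))
    (fun j y => (locKernel (L j) (m j) (κ j) (ν j) y).eval (2 ^ κ j * x j - ν j))]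
  by_cases h : spline m κ ν x = 0
  · rw [h, zero_mul]
    rw [spline] at h
    rw [h, zero_mul]
  · rw [opU_eq hF (mem_bigCell_of_spline_ne_zero hν h)]
    rfl

/-! ### Weak derivatives of tensor products -/

/-- The derivative `e'` may jump, as happens at the top order of a B-spline. The fundamental theorem
with a countable exceptional set still applies to the continuous product `e * φ`, whose boundary
terms vanish. -/
lemma HasDerivOff.integral_mul_deriv {e e' : ℝ → ℝ} (h : HasDerivOff e e') (he' : BddMeas e')
    {R : ℝ} (hs : ∀ x, R < |x| → e x = 0) (hs' : ∀ x, R < |x| → e' x = 0) {φ φ' : ℝ → ℝ}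
    (hφ : ∀ x, HasDerivAt φ (φ' x) x) (hφ' : Continuous φ') :
    ∫ x, e x * φ' x = -∫ x, e' x * φ x := by
  obtain ⟨hc, S, hS, hd⟩ := h
  obtain ⟨hm, C, hC⟩ := he'
  have hφc : Continuous φ := continuous_iff_continuousAt.2 fun x => (hφ x).continuousAt
  set R' : ℝ := |R| + 1 with hR'
  have hR0 : 0 < R' := by positivity
  have hRR : R < R' := (le_abs_self R).trans_lt (lt_add_one _)
  have hout : ∀ x, x ∉ Set.Ioc (-R') R' → R < |x| := fun x hx => by
    rw [Set.mem_Ioc, not_and_or, not_lt, not_le] at hx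
    rcases hx with hx | hx
    · exact hRR.trans_le (by rw [abs_of_neg (by linarith)]; linarith)
    · exact hRR.trans (hx.trans_le (le_abs_self x))
  have h1 : ∫ x, e x * φ' x = ∫ x in (-R')..R', e x * φ' x := by
    rw [intervalIntegral.integral_of_le (by linarith)]
    exact (setIntegral_eq_integral_of_forall_compl_eq_zero fun x hx => by
      rw [hs x (hout x hx), zero_mul]).symm
  have h2 : ∫ x, e' x * φ x = ∫ x in (-R')..R', e' x * φ x := by
    rw [intervalIntegral.integral_of_le (by linarith)]
    exact (setIntegral_eq_integral_of_forall_compl_eq_zero fun x hx => by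
      rw [hs' x (hout x hx), zero_mul]).symm
  have i1 : IntervalIntegrable (fun x => e x * φ' x) volume (-R') R' :=
    (hc.mul hφ').intervalIntegrable _ _
  have i2 : IntervalIntegrable (fun x => e' x * φ x) volume (-R') R' :=
    (intervalIntegrable_of_bounded hm hC _ _).mul_continuousOn hφc.continuousOn
  have h3 := integral_eq_of_hasDerivAt_off_countable (fun x => e x * φ x)
    (fun x => e' x * φ x + e x * φ' x) (a := -R') (b := R') hS (hc.mul hφc).continuousOn
    (fun x hx => (hd x hx.2).mul (hφ x)) (i2.add i1)
  rw [intervalIntegral.integral_add i2 i1, hs R' (by rw [abs_of_pos hR0]; exact hRR),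
    hs (-R') (by rw [abs_neg, abs_of_pos hR0]; exact hRR), ← h1, ← h2] at h3
  linarith

/-- A family of bounded functions with bounded support on the line. -/
structure BddSupp (R : ℝ) (φ : ℝ → ℝ) : Prop where
  bddMeas : BddMeas φ
  eq_zero : ∀ x, R < |x| → φ x = 0

lemma prod_eq_zero_of_notMem {R : ℝ} {e : Fin d → ℝ → ℝ} (he : ∀ i, BddSupp R (e i))
    {x : Fin d → ℝ} (hx : x ∉ Set.Icc (fun _ => -R) (fun _ => R)) : ∏ i, e i (x i) = 0 := by
  have : ∃ i, R < |x i| := by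
    by_contra hn
    push Not at hn
    exact hx ⟨fun i => (abs_le.1 (hn i)).1, fun i => (abs_le.1 (hn i)).2⟩
  obtain ⟨i, hi⟩ := this
  exact Finset.prod_eq_zero (Finset.mem_univ i) ((he i).eq_zero _ hi)

lemma integrable_prod_mul {R : ℝ} {e : Fin d → ℝ → ℝ} (he : ∀ i, BddSupp R (e i))
    {g : (Fin d → ℝ) → ℝ} (hg : Continuous g) : Integrable fun x => (∏ i, e i (x i)) * g x := by
  have h1 : IntegrableOn (fun x => (∏ i, e i (x i)) * g x) (Set.Icc (fun _ => -R) (fun _ => R)) := by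
    have hgi : IntegrableOn g (Set.Icc (fun _ : Fin d => -R) (fun _ => R)) :=
      hg.continuousOn.integrableOn_compact isCompact_Icc
    choose h2 C hC using fun i => (he i).bddMeas
    refine hgi.bdd_mul (c := ∏ i, C i) (measurable_prod_apply h2).aestronglyMeasurable
      (Filter.Eventually.of_forall fun y => ?_)
    rw [Real.norm_eq_abs, Finset.abs_prod]
    exact Finset.prod_le_prod (fun j _ => abs_nonneg _) fun j _ => hC j _
  refine (integrableOn_iff_integrable_of_support_subset fun x hx => ?_).1 h1
  by_contra hn
  exact hx (by simp only [prod_eq_zero_of_notMem he hn, zero_mul])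

/-- Fubini with the `j`-th variable innermost. The other factors are then constants, and the
univariate integration by parts applies. -/
lemma integral_prod_mul_partialDeriv {R : ℝ} {e : Fin d → ℝ → ℝ} (he : ∀ i, BddSupp R (e i))
    (j : Fin d) {e' : ℝ → ℝ} (he' : BddSupp R e') (hd : HasDerivOff (e j) e')
    {φ : (Fin d → ℝ) → ℝ} (hφ : ContDiff ℝ 1 φ) :
    ∫ x, (∏ i, e i (x i)) * partialDeriv j φ x =
      -∫ x, (∏ i, Function.update e j e' i (x i)) * φ x := by
  cases d with
  | zero => exact j.elim0
  | succ n =>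
    have hdc : Continuous (partialDeriv j φ) :=
      (hφ.continuous_fderiv one_ne_zero).clm_apply continuous_const
    have hup : ∀ i, BddSupp R (Function.update e j e' i) := fun i => by
      by_cases h : i = j
      · subst h; rwa [Function.update_self]
      · rw [Function.update_of_ne h]; exact he i
    have mp := (volume_preserving_piFinSuccAbove (fun _ : Fin (n + 1) => ℝ) j).symm
    have hsplit : ∀ g : (Fin (n + 1) → ℝ) → ℝ, Integrable g →
        ∫ x, g x = ∫ x' : Fin n → ℝ, ∫ t : ℝ, g (j.insertNth t x') := fun g hg => by
      rw [← mp.integral_comp']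
      exact integral_prod_symm _ (mp.integrable_comp_of_integrable hg)
    rw [hsplit _ (integrable_prod_mul he hdc), hsplit _ (integrable_prod_mul hup hφ.continuous),
      ← integral_neg]
    congr 1; funext x'
    simp only [Fin.prod_univ_succAbove _ j, Fin.insertNth_apply_same, Fin.insertNth_apply_succAbove,
      Function.update_self, Function.update_of_ne (Fin.succAbove_ne j _)]
    have hder : ∀ t : ℝ, HasDerivAt (fun t => φ (j.insertNth t x'))
        (partialDeriv j φ (j.insertNth t x')) t := fun t => by
      have h1 := hasDerivAt_update (j.insertNth (α := fun _ => ℝ) 0 x') j t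
      have h2 : ∀ s : ℝ, Function.update (j.insertNth (α := fun _ => ℝ) 0 x') j s =
          j.insertNth (α := fun _ => ℝ) s x' := fun s => Fin.update_insertNth _ _ _ _
      have h3 := ((hφ.differentiable one_ne_zero) (j.insertNth (α := fun _ => ℝ) t x')).hasFDerivAt
      rw [← h2] at h3
      have h4 := h3.comp_hasDerivAt t h1
      simp only [Function.comp_def, h2] at h4
      exact h4
    have hcont : Continuous fun t : ℝ => partialDeriv j φ (j.insertNth t x') := by
      refine hdc.comp ?_
      have h2 : (fun s : ℝ => j.insertNth (α := fun _ => ℝ) s x') = fun s =>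
          Function.update (j.insertNth (α := fun _ => ℝ) 0 x') j s := by
        funext s; exact (Fin.update_insertNth _ _ _ _).symm
      rw [h2]
      exact continuous_const.update j continuous_id
    have h5 := hd.integral_mul_deriv he'.bddMeas (he j).eq_zero he'.eq_zero hder hcont
    set c := ∏ i, e (j.succAbove i) (x' i) with hc
    have e1 : ∀ t, e j t * c * partialDeriv j φ (j.insertNth t x') =
        c * (e j t * partialDeriv j φ (j.insertNth t x')) := fun t => by ring
    have e2 : ∀ t, e' t * c * φ (j.insertNth t x') = c * (e' t * φ (j.insertNth t x')) :=
      fun t => by ring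
    simp_rw [e1, e2]
    rw [integral_const_mul, integral_const_mul, h5]
    ring

lemma contDiff_partialDeriv {φ : (Fin d → ℝ) → ℝ} (hφ : ContDiff ℝ ∞ φ) (j : Fin d) :
    ContDiff ℝ ∞ (partialDeriv j φ) :=
  (hφ.fderiv_right (m := ∞) (by simp)).clm_apply contDiff_const

lemma contDiff_partialDeriv_iterate {φ : (Fin d → ℝ) → ℝ} (hφ : ContDiff ℝ ∞ φ) (j : Fin d)
    (n : ℕ) : ContDiff ℝ ∞ ((partialDeriv j)^[n] φ) := by
  induction n with
  | zero => exact hφ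
  | succ n ih => rw [Function.iterate_succ_apply']; exact contDiff_partialDeriv ih j

lemma contDiff_foldr {φ : (Fin d → ℝ) → ℝ} (hφ : ContDiff ℝ ∞ φ) (α : Fin d → ℕ)
    (s : List (Fin d)) :
    ContDiff ℝ ∞ (s.foldr (fun j ψ => (partialDeriv j)^[α j] ψ) φ) := by
  induction s with
  | nil => exact hφ
  | cons j s ih => exact contDiff_partialDeriv_iterate ih j _

/-- The outermost derivative is moved first, raising the order at `j` by one. Only orders strictly
below `m j` are differentiated, so the order `m j` itself may be reached. -/
lemma integral_prod_mul_iterate {R : ℝ} {m : Fin d → ℕ} {e : Fin d → ℕ → ℝ → ℝ}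
    (he : ∀ i a, BddSupp R (e i a)) (hd : ∀ i a, a < m i → HasDerivOff (e i a) (e i (a + 1)))
    (j : Fin d) {φ : (Fin d → ℝ) → ℝ} (hφ : ContDiff ℝ ∞ φ) (n : ℕ) (β : Fin d → ℕ)
    (hn : β j + n ≤ m j) :
    ∫ x, (∏ i, e i (β i) (x i)) * (partialDeriv j)^[n] φ x =
      (-1) ^ n * ∫ x, (∏ i, e i (Function.update β j (β j + n) i) (x i)) * φ x := by
  induction n generalizing β with
  | zero => simp
  | succ n ih =>
    rw [Function.iterate_succ_apply']
    have h1 := integral_prod_mul_partialDeriv (e := fun i => e i (β i)) (fun i => he i _) j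
      (he j (β j + 1)) (hd j (β j) (by omega))
      ((contDiff_partialDeriv_iterate hφ j n).of_le (by simp))
    have h2 : ∀ i, Function.update (fun i => e i (β i)) j (e j (β j + 1)) i =
        e i (Function.update β j (β j + 1) i) := fun i => by
      by_cases h : i = j
      · subst h; simp
      · simp [h]
    simp_rw [h2] at h1
    rw [h1, ih (Function.update β j (β j + 1)) (by rw [Function.update_self]; omega)]
    simp only [Function.update_self, Function.update_idem]
    rw [show β j + 1 + n = β j + (n + 1) by ring, pow_succ]
    ring

/-- Here `β` records the orders reached so far. Coordinates still in the list have order zero, and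
distinctness of the list keeps it so. -/
lemma integral_prod_mul_foldr {R : ℝ} {m : Fin d → ℕ} {e : Fin d → ℕ → ℝ → ℝ}
    (he : ∀ i a, BddSupp R (e i a)) (hd : ∀ i a, a < m i → HasDerivOff (e i a) (e i (a + 1)))
    {φ : (Fin d → ℝ) → ℝ} (hφ : ContDiff ℝ ∞ φ) {α : Fin d → ℕ} (hα : ∀ j, α j ≤ m j)
    (s : List (Fin d)) (hs : s.Nodup) (β : Fin d → ℕ) (hβ : ∀ j ∈ s, β j = 0) :
    ∫ x, (∏ i, e i (β i) (x i)) * s.foldr (fun j ψ => (partialDeriv j)^[α j] ψ) φ x =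
      (-1) ^ (s.map α).sum * ∫ x, (∏ i, e i (if i ∈ s then α i else β i) (x i)) * φ x := by
  induction s generalizing β with
  | nil => simp
  | cons j s ih =>
    rw [List.nodup_cons] at hs
    have hβj : β j = 0 := hβ j List.mem_cons_self
    rw [List.foldr_cons, integral_prod_mul_iterate he hd j (contDiff_foldr hφ α s) (α j) β
      (by rw [hβj, zero_add]; exact hα j), hβj, zero_add,
      ih hs.2 (Function.update β j (α j)) fun i hi => by
        have hij : i ≠ j := fun h => hs.1 (h ▸ hi)
        rw [Function.update_of_ne hij]
        exact hβ i (List.mem_cons_of_mem j hi), List.map_cons, List.sum_cons, pow_add, mul_assoc]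
    congr 3; funext x
    congr 1
    refine Finset.prod_congr rfl fun i _ => ?_
    by_cases h : i = j
    · subst h; simp [hs.1]
    · simp [h]

lemma integral_prod_mul_multiDeriv {R : ℝ} {m : Fin d → ℕ} {e : Fin d → ℕ → ℝ → ℝ}
    (he : ∀ i a, BddSupp R (e i a)) (hd : ∀ i a, a < m i → HasDerivOff (e i a) (e i (a + 1)))
    {φ : (Fin d → ℝ) → ℝ} (hφ : ContDiff ℝ ∞ φ) {α : Fin d → ℕ} (hα : ∀ j, α j ≤ m j) :
    ∫ x, (∏ i, e i 0 (x i)) * multiDeriv α φ x =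
      (-1) ^ (∑ j, α j) * ∫ x, (∏ i, e i (α i) (x i)) * φ x := by
  have h := integral_prod_mul_foldr he hd hφ hα (List.finRange d) (List.nodup_finRange d)
    (fun _ => 0) fun _ _ => rfl
  simp only [List.mem_finRange, if_true] at h
  rw [Fin.sum_univ_def]
  exact h

/-! ### The derivative of the operator -/

/-- The derivative of order `α` of the operator with kernel `∏ⱼ opKernel`. -/
def opDeriv (L m κ α : Fin d → ℕ) (F : (Fin d → ℝ) → ℝ) (x : Fin d → ℝ) : ℝ :=
  ∫ y, F y * ∏ j, opKernel (L j) (m j) (κ j) (α j) (x j) (y j)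

lemma exists_bddSupp_opKernel (m : Fin d → ℕ) : ∃ R : ℝ, ∀ (L κ : Fin d → ℕ) i a y,
    BddSupp R fun x => opKernel (L i) (m i) (κ i) a x y := by
  refine ⟨∑ i, (4 * (m i : ℝ) + 4), fun L κ i a y => ⟨⟨?_, ?_⟩, fun x hx => ?_⟩⟩
  · exact (measurable_opKernel _ _ _ _).comp measurable_prodMk_right
  · obtain ⟨C, _, hC⟩ := exists_opKernel_bound (L i) (m i) a
    exact ⟨_, fun x => hC (κ i) x y⟩
  · by_contra hn
    obtain ⟨h1, h2⟩ := opKernel_ne_zero hn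
    have h3 : (4 * (m i : ℝ) + 4) ≤ ∑ i, (4 * (m i : ℝ) + 4) :=
      Finset.single_le_sum (f := fun i => 4 * (m i : ℝ) + 4) (fun i _ => by positivity)
        (Finset.mem_univ i)
    have h4 : ((2 : ℝ) ^ κ i)⁻¹ ≤ 1 := inv_le_one_of_one_le₀ (one_le_pow₀ (by norm_num))
    have h5 : |x - y| ≤ 4 * (m i : ℝ) + 3 :=
      h2.trans (mul_le_of_le_one_right (by positivity) h4)
    have h6 : |x| ≤ |x - y| + |y| := by
      have := abs_add_le (x - y) y; rwa [sub_add_cancel] at this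
    rw [abs_of_pos h1.1] at h6
    linarith [h1.2]

lemma measurable_prod_opKernel (L m κ α : Fin d → ℕ) : Measurable fun q : (Fin d → ℝ) × (Fin d → ℝ) =>
    ∏ j, opKernel (L j) (m j) (κ j) (α j) (q.1 j) (q.2 j) := by
  refine Finset.measurable_fun_prod _ fun j _ => ?_
  have h : Measurable fun q : (Fin d → ℝ) × (Fin d → ℝ) => (q.1 j, q.2 j) := by fun_prop
  exact (measurable_opKernel (L j) (m j) (κ j) (α j)).comp h

lemma exists_prod_opKernel_bound (L m κ α : Fin d → ℕ) : ∃ C : ℝ, 0 ≤ C ∧ ∀ x y : Fin d → ℝ,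
    |∏ j, opKernel (L j) (m j) (κ j) (α j) (x j) (y j)| ≤ C := by
  choose C hC0 hC using fun j => exists_opKernel_bound (L j) (m j) (α j)
  refine ⟨∏ j, C j * (2 ^ κ j) ^ (α j + 1),
    Finset.prod_nonneg fun j _ => by have := hC0 j; positivity, fun x y => ?_⟩
  rw [Finset.abs_prod]
  exact Finset.prod_le_prod (fun j _ => abs_nonneg _) fun j _ => hC j _ _ _

lemma integrable_opDeriv_integrand {F : (Fin d → ℝ) → ℝ} (hF : Integrable F)
    (L m κ α : Fin d → ℕ) {g : (Fin d → ℝ) → ℝ} (hg : Continuous g) :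
    Integrable (fun q : (Fin d → ℝ) × (Fin d → ℝ) =>
      (F q.2 * ∏ j, opKernel (L j) (m j) (κ j) (α j) (q.1 j) (q.2 j)) * g q.1)
      (volume.prod volume) := by
  obtain ⟨R, hR⟩ := exists_bddSupp_opKernel m
  obtain ⟨C, hC0, hC⟩ := exists_prod_opKernel_bound L m κ α
  have hgi : Integrable ((Set.Icc (fun _ : Fin d => -R) (fun _ => R)).indicator g) :=
    (integrable_indicator_iff measurableSet_Icc).2
      (hg.continuousOn.integrableOn_compact isCompact_Icc)
  have h1 := (hgi.mul_prod hF).bdd_mul (c := C)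
    (measurable_prod_opKernel L m κ α).aestronglyMeasurable
    (Filter.Eventually.of_forall fun q => hC q.1 q.2)
  refine h1.congr (Filter.Eventually.of_forall fun q => ?_)
  simp only
  by_cases hq : q.1 ∈ Set.Icc (fun _ : Fin d => -R) (fun _ => R)
  · rw [Set.indicator_of_mem hq]; ring
  · have := prod_eq_zero_of_notMem (fun i => hR L κ i (α i) (q.2 i)) hq
    rw [this]; ring

lemma integrable_opDeriv {F : (Fin d → ℝ) → ℝ} (hF : Integrable F) (L m κ α : Fin d → ℕ) :
    Integrable (opDeriv L m κ α F) := by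
  have := (integrable_opDeriv_integrand hF L m κ α (g := fun _ => 1)
    continuous_const).integral_prod_left
  simp only [mul_one] at this
  exact this

/-- Fubini transfers the test function onto the kernel for fixed `y`, where all derivatives can be
moved to the splines. -/
lemma hasWeakDeriv_opE {F : (Fin d → ℝ) → ℝ} (hF : Integrable F) {L m κ α : Fin d → ℕ}
    (hα : ∀ j, α j ≤ m j) : HasWeakDeriv α (opE L m κ F) (opDeriv L m κ α F) := by
  have h0 : opE L m κ F = opDeriv L m κ 0 F := funext fun x => opE_eq hF L m κ x
  rw [h0]
  refine ⟨(integrable_opDeriv hF L m κ 0).locallyIntegrable,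
    (integrable_opDeriv hF L m κ α).locallyIntegrable, fun φ hφ _ => ?_⟩
  obtain ⟨R, hR⟩ := exists_bddSupp_opKernel m
  have hswap : ∀ (β : Fin d → ℕ) (g : (Fin d → ℝ) → ℝ), Continuous g →
      ∫ x, opDeriv L m κ β F x * g x =
        ∫ y, F y * ∫ x, (∏ j, opKernel (L j) (m j) (κ j) (β j) (x j) (y j)) * g x := by
    intro β g hg
    simp_rw [opDeriv, ← integral_mul_const]
    rw [integral_integral_swap (integrable_opDeriv_integrand hF L m κ β hg)]
    congr 1; funext y
    rw [← integral_const_mul]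
    congr 1; funext x; ring
  rw [hswap 0 (multiDeriv α φ) (contDiff_foldr hφ α _).continuous, hswap α _ hφ.continuous, ← integral_const_mul]
  congr 1; funext y
  have := integral_prod_mul_multiDeriv (e := fun i a x => opKernel (L i) (m i) (κ i) a x (y i))
    (fun i a => hR L κ i a (y i)) (fun i a ha => hasDerivOff_opKernel (L i) (κ i) ha (y i)) hφ hα
  simp only [Pi.zero_apply]
  rw [this]
  ring

/-! ### Tensor products of difference representations -/

lemma measurePreserving_shear (k : Fin d → ℕ) :
    MeasurePreserving (fun q : (Fin d → ℝ) × (Fin d → ℝ) =>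
      (q.1, fun j => q.2 j + (k j : ℝ) * q.1 j)) (volume.prod volume) (volume.prod volume) := by
  refine (MeasurePreserving.id (volume : Measure (Fin d → ℝ))).skew_product
    (g := fun (ξ y : Fin d → ℝ) (j : Fin d) => y j + (k j : ℝ) * ξ j) ?_ ?_
  · exact measurable_pi_lambda _ fun j => by fun_prop
  · refine Filter.Eventually.of_forall fun ξ => ?_
    exact map_add_right_eq_self volume fun j => (k j : ℝ) * ξ j

lemma bddMeas_integral_diagonal {K : ℝ → ℝ → ℝ} (hK : Measurable (Function.uncurry K)) {M T : ℝ}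
    (hT : 0 ≤ T) (hM : ∀ z ξ, |K z ξ| ≤ M) (hs : ∀ z ξ, K z ξ ≠ 0 → |ξ| ≤ T) (k : ℝ) :
    BddMeas fun y => ∫ ξ, K (y - k * ξ) ξ := by
  constructor
  · have h : Measurable (Function.uncurry fun y ξ : ℝ => K (y - k * ξ) ξ) :=
      hK.comp (by fun_prop : Measurable fun q : ℝ × ℝ => (q.1 - k * q.2, q.2))
    exact (h.stronglyMeasurable.integral_prod_right (ν := volume)).measurable
  · refine ⟨M * (2 * T), fun y => ?_⟩
    have e : ∫ ξ, K (y - k * ξ) ξ = ∫ ξ in Set.Icc (-T) T, K (y - k * ξ) ξ :=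
      (setIntegral_eq_integral_of_forall_compl_eq_zero fun ξ hξ => by
        by_contra h; exact hξ (abs_le.1 (hs _ _ h))).symm
    simp only
    rw [e, ← Real.norm_eq_abs]
    refine (norm_setIntegral_le_of_norm_le_const (C := M) measure_Icc_lt_top
      fun ξ _ => hM _ _).trans (le_of_eq ?_)
    rw [measureReal_def, Real.volume_Icc, ENNReal.toReal_ofReal (by linarith)]
    ring

/-- The mixed differences are integrated against the product kernel. -/
lemma integral_mul_prod_diffRep {F : (Fin d → ℝ) → ℝ} (hF : Integrable F)
    {l : Fin d → ℕ} {w : Fin d → ℝ → ℝ} {K : Fin d → ℝ → ℝ → ℝ} {M T : Fin d → ℝ}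
    (hK : ∀ j, Measurable (Function.uncurry (K j))) (hT : ∀ j, 0 ≤ T j)
    (hM : ∀ j z ξ, |K j z ξ| ≤ M j) (hs : ∀ j z ξ, K j z ξ ≠ 0 → |ξ| ≤ T j)
    (hw : ∀ j, IsDiffRep (l j) (w j) (K j)) :
    ∫ y, F y * ∏ j, w j (y j) = ∫ q : (Fin d → ℝ) × (Fin d → ℝ),
      (∏ j, K j (q.2 j) (q.1 j)) * mixedDiff l q.1 F q.2 := by
  have hI : ∀ j (k : ℕ), BddMeas fun y => ∫ ξ, K j (y - k * ξ) ξ := fun j k =>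
    bddMeas_integral_diagonal (hK j) (hT j) (hM j) (hs j) k
  have hset : Fintype.piFinset (fun j => Finset.range (l j + 1)) = Finset.Iic l := by
    ext μ
    simp only [Fintype.mem_piFinset, Finset.mem_range, Finset.mem_Iic, Nat.lt_succ_iff, Pi.le_def]
  have hint : ∀ k : Fin d → ℕ, Integrable (fun q : (Fin d → ℝ) × (Fin d → ℝ) =>
      F q.2 * ∏ j, K j (q.2 j - k j * q.1 j) (q.1 j)) (volume.prod volume) := by
    intro k
    -- `F` carries no decay in `ξ`. Integrability on the product comes from the bounded range of
    -- steps of `K`.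
    have hb : Integrable ((Set.Icc (fun j => -T j) T).indicator fun _ => (1 : ℝ)) := by
      refine (integrable_indicator_iff measurableSet_Icc).2 ?_
      exact integrableOn_const (isCompact_Icc.measure_lt_top.ne)
    have hm : Measurable fun q : (Fin d → ℝ) × (Fin d → ℝ) =>
        ∏ j, K j (q.2 j - k j * q.1 j) (q.1 j) := by
      refine Finset.measurable_fun_prod _ fun j _ => ?_
      have h : Measurable fun q : (Fin d → ℝ) × (Fin d → ℝ) =>
        (q.2 j - k j * q.1 j, q.1 j) := by fun_prop
      exact (hK j).comp h
    have h1 := (hb.mul_prod hF).bdd_mul (c := ∏ j, M j) hm.aestronglyMeasurable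
      (Filter.Eventually.of_forall fun q => by
        rw [Real.norm_eq_abs, Finset.abs_prod]
        exact Finset.prod_le_prod (fun j _ => abs_nonneg _) fun j _ => hM j _ _)
    refine h1.congr (Filter.Eventually.of_forall fun q => ?_)
    simp only
    by_cases hq : q.1 ∈ Set.Icc (fun j => -T j) T
    · rw [Set.indicator_of_mem hq]; ring
    · have : ∃ j, ¬ |q.1 j| ≤ T j := by
        by_contra hn
        push Not at hn
        exact hq ⟨fun j => (abs_le.1 (hn j)).1, fun j => (abs_le.1 (hn j)).2⟩
      obtain ⟨j, hj⟩ := this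
      have h0 : K j (q.2 j - k j * q.1 j) (q.1 j) = 0 := by
        by_contra hne; exact hj (hs j _ _ hne)
      rw [Finset.prod_eq_zero (Finset.mem_univ j) h0]; ring
  have hterm : ∀ k : Fin d → ℕ, Integrable (fun q : (Fin d → ℝ) × (Fin d → ℝ) =>
      F (fun j => q.2 j + k j * q.1 j) * ∏ j, K j (q.2 j) (q.1 j)) (volume.prod volume) ∧
      ∫ y, F y * ∏ j, ∫ ξ, K j (y j - k j * ξ) ξ = ∫ q : (Fin d → ℝ) × (Fin d → ℝ),
        F (fun j => q.2 j + k j * q.1 j) * ∏ j, K j (q.2 j) (q.1 j) := by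
    intro k
    -- The shear `(ξ, y) ↦ (ξ, y + kξ)` moves the translation from `K` to `F`.
    have h1 := (measurePreserving_shear k).integrable_comp_of_integrable (hint k)
    have h2 : (fun q : (Fin d → ℝ) × (Fin d → ℝ) =>
        F (fun j => q.2 j + k j * q.1 j) * ∏ j, K j (q.2 j) (q.1 j)) =
        (fun q : (Fin d → ℝ) × (Fin d → ℝ) => F q.2 * ∏ j, K j (q.2 j - k j * q.1 j) (q.1 j)) ∘
        (fun q : (Fin d → ℝ) × (Fin d → ℝ) => (q.1, fun j => q.2 j + (k j : ℝ) * q.1 j)) := by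
      funext q
      simp only [Function.comp_apply, add_sub_cancel_right]
    refine ⟨h2 ▸ h1, ?_⟩
    rw [Measure.volume_eq_prod, integral_prod _ (h2 ▸ h1)]
    have h3 : ∀ y : Fin d → ℝ, F y * ∏ j, ∫ ξ, K j (y j - k j * ξ) ξ =
        ∫ ξ : Fin d → ℝ, F y * ∏ j, K j (y j - k j * ξ j) (ξ j) := fun y => by
      rw [integral_const_mul, ← integral_fintype_prod_volume_eq_prod]
    simp_rw [h3]
    have hsw : Integrable (Function.uncurry fun (y ξ : Fin d → ℝ) =>
        F y * ∏ j, K j (y j - k j * ξ j) (ξ j)) (volume.prod volume) := (hint k).swap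
    rw [integral_integral_swap hsw]
    congr 1; funext ξ
    have h4 := integral_add_right_eq_self (μ := (volume : Measure (Fin d → ℝ)))
      (fun y => F y * ∏ j, K j (y j - k j * ξ j) (ξ j)) (fun j => (k j : ℝ) * ξ j)
    rw [← h4]
    congr 1; funext y
    simp only [Pi.add_apply, add_sub_cancel_right]
    rfl
  have hwe : ∀ y : Fin d → ℝ, ∏ j, w j (y j) = ∏ j, ∑ k ∈ Finset.range (l j + 1),
      (-1) ^ (l j - k) * ((l j).choose k : ℝ) * ∫ ξ, K j (y j - k * ξ) ξ := fun y =>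
    Finset.prod_congr rfl fun j _ => hw j (y j)
  simp_rw [hwe]
  rw [integral_mul_prod_sum hF _ fun j k _ => (hI j k).const_mul _, hset]
  have h5 : ∀ k ∈ Finset.Iic l, ∫ y, F y * ∏ j, ((-1) ^ (l j - k j) * ((l j).choose (k j) : ℝ) *
      ∫ ξ, K j (y j - k j * ξ) ξ) = ∫ q : (Fin d → ℝ) × (Fin d → ℝ),
      (∏ j, (-1 : ℝ) ^ (l j - k j) * ((l j).choose (k j) : ℝ)) *
        (F (fun j => q.2 j + k j * q.1 j) * ∏ j, K j (q.2 j) (q.1 j)) := fun k _ => by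
    rw [integral_mul_prod_const_mul F (fun j => (-1) ^ (l j - k j) * ((l j).choose (k j) : ℝ))
      (fun j y => ∫ ξ, K j (y - k j * ξ) ξ), (hterm k).2, integral_const_mul]
  rw [Finset.sum_congr rfl h5, Measure.volume_eq_prod,
    ← integral_finsetSum _ fun k _ => (hterm k).1.const_mul _]
  congr 1; funext q
  rw [mixedDiff, Finset.mul_sum]
  exact Finset.sum_congr rfl fun k _ => by ring

/-! ### Pointwise estimate by mixed differences -/

/-- The pairs `(ξ, y)` such that `y` belongs to the domain of the mixed difference with step `ξ` on
the unit cube. -/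
def diffSet (l : Fin d → ℕ) : Set ((Fin d → ℝ) × (Fin d → ℝ)) :=
  {q | ∀ j, q.2 j ∈ Set.Ioo (0 : ℝ) 1 ∧ q.2 j + l j * q.1 j ∈ Set.Ioo (0 : ℝ) 1}

lemma measurableSet_diffSet (l : Fin d → ℕ) : MeasurableSet (diffSet l) := by
  have h : diffSet l = ⋂ j, ({q : (Fin d → ℝ) × (Fin d → ℝ) | q.2 j ∈ Set.Ioo (0 : ℝ) 1} ∩
      {q | q.2 j + l j * q.1 j ∈ Set.Ioo (0 : ℝ) 1}) := by
    ext q; simp only [diffSet, Set.mem_ofPred_eq, Set.mem_iInter, Set.mem_inter_iff]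
  rw [h]
  refine MeasurableSet.iInter fun j => ?_
  have h1 : Measurable fun q : (Fin d → ℝ) × (Fin d → ℝ) => q.2 j := by fun_prop
  have h2 : Measurable fun q : (Fin d → ℝ) × (Fin d → ℝ) => q.2 j + l j * q.1 j := by fun_prop
  exact (h1 measurableSet_Ioo).inter (h2 measurableSet_Ioo)

lemma add_mul_mem_Ioo {a b s u : ℝ} (hs0 : 0 ≤ s) (hsu : s ≤ u) (ha : a ∈ Set.Ioo (0 : ℝ) 1)
    (hb : a + u * b ∈ Set.Ioo (0 : ℝ) 1) : a + s * b ∈ Set.Ioo (0 : ℝ) 1 := by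
  rcases le_total 0 b with h | h
  · have h1 := mul_le_mul_of_nonneg_right hsu h
    have h2 := mul_nonneg hs0 h
    exact ⟨by linarith [ha.1], by linarith [hb.2]⟩
  · have h1 := mul_le_mul_of_nonpos_right hsu h
    have h2 := mul_nonpos_of_nonneg_of_nonpos hs0 h
    exact ⟨by linarith [hb.1], by linarith [ha.2]⟩

/-- By convexity of the interval, only the base point and the full displacement in each coordinate
need to be tested. -/
lemma mem_diffDomain_iff {l : Fin d → ℕ} {ξ y : Fin d → ℝ} :
    y ∈ diffDomain (unitCube d) l ξ ↔ (ξ, y) ∈ diffSet l := by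
  constructor
  · rintro ⟨h1, h2⟩ j
    refine ⟨h1 j (Set.mem_univ j), ?_⟩
    have := h2 (fun _ => 1) (fun _ => ⟨zero_le_one, le_rfl⟩) j (Set.mem_univ j)
    simpa using this
  · intro h
    refine ⟨fun j _ => (h j).1, fun t ht j _ => ?_⟩
    have hl : (0 : ℝ) ≤ l j := (l j).cast_nonneg
    exact add_mul_mem_Ioo (mul_nonneg (ht j).1 hl) (mul_le_of_le_one_left hl (ht j).2)
      (h j).1 (h j).2

lemma mem_unitCube_of_mem_diffDomain {l k : Fin d → ℕ} (hk : k ≤ l) {ξ y : Fin d → ℝ}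
    (hy : y ∈ diffDomain (unitCube d) l ξ) : (fun j => y j + (k j : ℝ) * ξ j) ∈ unitCube d := by
  intro j _
  have h := mem_diffDomain_iff.1 hy j
  exact add_mul_mem_Ioo (Nat.cast_nonneg _) (Nat.cast_le.2 (hk j)) h.1 h.2

lemma mixedDiff_zeroExt {l : Fin d → ℕ} {ξ y : Fin d → ℝ} (f : (Fin d → ℝ) → ℝ)
    (hy : y ∈ diffDomain (unitCube d) l ξ) :
    mixedDiff l ξ (zeroExt f) y = mixedDiff l ξ f y := by
  refine Finset.sum_congr rfl fun k hk => ?_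
  rw [zeroExt, Set.indicator_of_mem (mem_unitCube_of_mem_diffDomain (Finset.mem_Iic.1 hk) hy)]

lemma measurable_mixedDiff {F : (Fin d → ℝ) → ℝ} (hF : Measurable F) (l : Fin d → ℕ) :
    Measurable fun q : (Fin d → ℝ) × (Fin d → ℝ) => mixedDiff l q.1 F q.2 := by
  refine Finset.measurable_fun_sum _ fun k _ => ?_
  have h : Measurable fun q : (Fin d → ℝ) × (Fin d → ℝ) => fun j => q.2 j + (k j : ℝ) * q.1 j :=
    measurable_pi_lambda _ fun j => by fun_prop
  exact (hF.comp h).const_mul _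

/-- The pairs `(ξ, y)` in `diffSet l` with `ξ` in the box of size `t` and `y` close to `x`. -/
def localSet (l : Fin d → ℕ) (t x : Fin d → ℝ) : Set ((Fin d → ℝ) × (Fin d → ℝ)) :=
  diffSet l ∩ {q | ∀ j, |q.1 j| ≤ t j ∧ |q.2 j - x j| ≤ t j}

/-- The order of the mixed difference belonging to the level `κ`. -/
def levelOrder (L κ : Fin d → ℕ) : Fin d → ℕ := fun j => if κ j ≠ 0 then L j + 1 else 0

/-- The product kernel is bounded and nonzero only on `localSet`. The bound keeps `y` near `x`, and
this localisation is what makes the integration over `x` in the `L_p` estimate efficient. -/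
lemma exists_enorm_opDeriv_le (L m α : Fin d → ℕ) {T : ℝ} (hT : ∀ j, 8 * (m j : ℝ) + 8 ≤ T) :
    ∃ B : ℝ, 0 < B ∧ ∀ (κ : Fin d → ℕ) (F : (Fin d → ℝ) → ℝ), Integrable F → ∀ x,
      ‖opDeriv L m κ α F x‖ₑ ≤ ENNReal.ofReal (B * ∏ j, (2 ^ κ j) ^ (α j + 2)) *
        ∫⁻ q in localSet (levelOrder L κ) (fun j => T * ((2 : ℝ) ^ κ j)⁻¹) x,
          ‖mixedDiff (levelOrder L κ) q.1 F q.2‖ₑ := by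
  choose C hC0 hC using fun j => exists_opKernel_rep (L j) (m j) (α j) (hT j)
  refine ⟨∏ j, C j, Finset.prod_pos fun j _ => hC0 j, fun κ F hF x => ?_⟩
  choose K hKm hKb hKs hK using fun j => hC j (κ j) (x j)
  have hrep := integral_mul_prod_diffRep hF (l := levelOrder L κ)
    (w := fun j => opKernel (L j) (m j) (κ j) (α j) (x j)) (T := fun j => T * ((2 : ℝ) ^ κ j)⁻¹) hKm
    (fun j => by
      have h1 := hT j
      have h2 : (0 : ℝ) ≤ m j := (m j).cast_nonneg
      have : 0 ≤ T := by linarith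
      positivity) hKb (fun j z ξ h => (hKs j z ξ h).2.2.1) hK
  rw [opDeriv, hrep]
  refine (enorm_integral_le_lintegral_enorm _).trans ?_
  have hmeas : MeasurableSet (localSet (levelOrder L κ) (fun j => T * ((2 : ℝ) ^ κ j)⁻¹) x) := by
    refine (measurableSet_diffSet _).inter ?_
    rw [Set.ofPred_forall]
    refine MeasurableSet.iInter fun j => ?_
    have h1 : Measurable fun q : (Fin d → ℝ) × (Fin d → ℝ) => |q.1 j| := by fun_prop
    have h2 : Measurable fun q : (Fin d → ℝ) × (Fin d → ℝ) => |q.2 j - x j| := by fun_prop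
    exact (h1 measurableSet_Iic).inter (h2 measurableSet_Iic)
  rw [← lintegral_const_mul' _ _ ENNReal.ofReal_ne_top, ← lintegral_indicator hmeas]
  refine lintegral_mono fun q => ?_
  by_cases hq : ∏ j, K j (q.2 j) (q.1 j) = 0
  · simp only [hq, zero_mul, enorm_zero]; exact zero_le
  · have hq' : ∀ j, K j (q.2 j) (q.1 j) ≠ 0 := fun j =>
      Finset.prod_ne_zero_iff.1 hq j (Finset.mem_univ j)
    have hmem : q ∈ localSet (levelOrder L κ) (fun j => T * ((2 : ℝ) ^ κ j)⁻¹) x :=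
      ⟨fun j => ⟨(hKs j _ _ (hq' j)).1, (hKs j _ _ (hq' j)).2.1⟩,
        fun j => ⟨(hKs j _ _ (hq' j)).2.2.1, (hKs j _ _ (hq' j)).2.2.2⟩⟩
    rw [Set.indicator_of_mem hmem, enorm_mul]
    gcongr
    rw [Real.enorm_eq_ofReal_abs, Finset.abs_prod, ← Finset.prod_mul_distrib]
    exact ENNReal.ofReal_le_ofReal
      (Finset.prod_le_prod (fun j _ => abs_nonneg _) fun j _ => hKb j _ _)

/-! ### Norm estimates -/

/-- Hölder's inequality on a set of measure at most `V`. -/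
lemma lintegral_enorm_restrict_le {X : Type*} [MeasurableSpace X] {μ : Measure X} {g : X → ℝ}
    (hg : Measurable g) {p : ℝ} (hp : 1 ≤ p) (s : Set X) {V : ℝ≥0∞} (hV : μ s ≤ V) :
    ∫⁻ q in s, ‖g q‖ₑ ∂μ ≤ (∫⁻ q in s, ‖g q‖ₑ ^ p ∂μ) ^ (1 / p) * V ^ (1 - 1 / p) := by
  have hp0 : 0 < p := by linarith
  have h := eLpNorm_le_eLpNorm_mul_rpow_measure_univ (μ := μ.restrict s) (p := 1)
    (q := ENNReal.ofReal p) (by rw [← ENNReal.ofReal_one]; exact ENNReal.ofReal_le_ofReal hp)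
    hg.aestronglyMeasurable
  rw [eLpNorm_one_eq_lintegral_enorm, eLpNorm_eq_lintegral_rpow_enorm_toReal
    (by simpa using hp0) ENNReal.ofReal_ne_top, ENNReal.toReal_ofReal hp0.le,
    Measure.restrict_apply_univ, ENNReal.toReal_one, div_one] at h
  refine h.trans ?_
  gcongr
  rw [sub_nonneg, div_le_one hp0]
  exact hp

lemma volume_localSet_le (l : Fin d → ℕ) {t : Fin d → ℝ} (x : Fin d → ℝ) :
    volume (localSet l t x) ≤ (∏ j, ENNReal.ofReal (2 * t j)) * ∏ j, ENNReal.ofReal (2 * t j) := by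
  have h : localSet l t x ⊆ Set.Icc (fun j => -t j) t ×ˢ Set.Icc (x - t) (x + t) := by
    rintro q ⟨_, h⟩
    refine ⟨⟨fun j => (abs_le.1 (h j).1).1, fun j => (abs_le.1 (h j).1).2⟩,
      fun j => ?_, fun j => ?_⟩
    · have := (abs_le.1 (h j).2).1
      simp only [Pi.sub_apply]; linarith
    · have := (abs_le.1 (h j).2).2
      simp only [Pi.add_apply]; linarith
  refine (measure_mono h).trans ?_
  rw [Measure.volume_eq_prod, Measure.prod_prod, Real.volume_Icc_pi, Real.volume_Icc_pi]
  refine le_of_eq ?_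
  congr 1
  · exact Finset.prod_congr rfl fun j _ => by rw [sub_neg_eq_add, two_mul]
  · refine Finset.prod_congr rfl fun j _ => ?_
    congr 1
    simp only [Pi.add_apply, Pi.sub_apply]
    ring

/-- The pairs `(ξ, y)` in `diffSet l` with `ξ` in the box of size `t`. -/
def stepSet (l : Fin d → ℕ) (t : Fin d → ℝ) : Set ((Fin d → ℝ) × (Fin d → ℝ)) :=
  diffSet l ∩ {q | ∀ j, |q.1 j| ≤ t j}

lemma measurableSet_stepSet (l : Fin d → ℕ) (t : Fin d → ℝ) : MeasurableSet (stepSet l t) := by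
  refine (measurableSet_diffSet _).inter ?_
  rw [Set.ofPred_forall]
  refine MeasurableSet.iInter fun j => ?_
  have h1 : Measurable fun q : (Fin d → ℝ) × (Fin d → ℝ) => |q.1 j| := by fun_prop
  exact h1 measurableSet_Iic

lemma localSet_subset_stepSet (l : Fin d → ℕ) (t x : Fin d → ℝ) :
    localSet l t x ⊆ stepSet l t := fun _ h => ⟨h.1, fun j => (h.2 j).1⟩

/-- Tonelli: a pair `(ξ, y)` is counted only for `x` in the box of half-widths `t` about `y`, whose
volume is the factor in front. -/
lemma lintegral_lintegral_localSet_le (l : Fin d → ℕ) (t : Fin d → ℝ)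
    {g : (Fin d → ℝ) × (Fin d → ℝ) → ℝ≥0∞} (hg : Measurable g) :
    ∫⁻ x, ∫⁻ q in localSet l t x, g q ≤
      (∏ j, ENNReal.ofReal (2 * t j)) * ∫⁻ q in stepSet l t, g q := by
  have hS : MeasurableSet {r : (Fin d → ℝ) × ((Fin d → ℝ) × (Fin d → ℝ)) | r.2 ∈ localSet l t r.1} := by
    have h0 : MeasurableSet {r : (Fin d → ℝ) × ((Fin d → ℝ) × (Fin d → ℝ)) | r.2 ∈ stepSet l t} :=
      measurable_snd (measurableSet_stepSet l t)
    have h1 : MeasurableSet {r : (Fin d → ℝ) × ((Fin d → ℝ) × (Fin d → ℝ)) |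
        ∀ j, |r.2.2 j - r.1 j| ≤ t j} := by
      rw [Set.ofPred_forall]
      refine MeasurableSet.iInter fun j => ?_
      have h2 : Measurable fun r : (Fin d → ℝ) × ((Fin d → ℝ) × (Fin d → ℝ)) =>
        |r.2.2 j - r.1 j| := by fun_prop
      exact h2 measurableSet_Iic
    convert h0.inter h1 using 1
    ext r
    simp only [localSet, stepSet, Set.mem_ofPred_eq, Set.mem_inter_iff, forall_and, and_assoc]
  have h1 : ∀ x, MeasurableSet (localSet l t x) := fun x => measurable_prodMk_left hS
  have h2 : Measurable (Function.uncurry fun (x : Fin d → ℝ) q => (localSet l t x).indicator g q) := by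
    have : (Function.uncurry fun (x : Fin d → ℝ) q => (localSet l t x).indicator g q) =
        {r : (Fin d → ℝ) × ((Fin d → ℝ) × (Fin d → ℝ)) | r.2 ∈ localSet l t r.1}.indicator
          fun r => g r.2 := by
      funext r; rfl
    rw [this]
    exact (hg.comp measurable_snd).indicator hS
  simp_rw [← lintegral_indicator (h1 _)]
  rw [lintegral_lintegral_swap h2.aemeasurable, ← lintegral_indicator (measurableSet_stepSet l t),
    ← lintegral_const_mul _ (hg.indicator (measurableSet_stepSet l t))]
  refine lintegral_mono fun q => ?_
  by_cases hq : q ∈ stepSet l t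
  · have h3 : ∀ x, (localSet l t x).indicator g q ≤
        (Set.Icc (q.2 - t) (q.2 + t)).indicator (fun _ => g q) x := fun x => by
      by_cases hx : q ∈ localSet l t x
      · have hm : x ∈ Set.Icc (q.2 - t) (q.2 + t) := by
          refine ⟨fun j => ?_, fun j => ?_⟩
          · have := (abs_le.1 (hx.2 j).2).2
            simp only [Pi.sub_apply]; linarith
          · have := (abs_le.1 (hx.2 j).2).1
            simp only [Pi.add_apply]; linarith
        rw [Set.indicator_of_mem hx, Set.indicator_of_mem hm]
      · rw [Set.indicator_of_notMem hx]; exact zero_le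
    rw [Set.indicator_of_mem hq]
    refine (lintegral_mono h3).trans ?_
    rw [lintegral_indicator measurableSet_Icc, setLIntegral_const, Real.volume_Icc_pi, mul_comm]
    refine le_of_eq ?_
    congr 1
    refine Finset.prod_congr rfl fun j _ => ?_
    congr 1
    simp only [Pi.add_apply, Pi.sub_apply]
    ring
  · rw [Set.indicator_of_notMem hq, mul_zero]
    refine le_of_eq ?_
    rw [lintegral_eq_zero_iff']
    · refine Filter.Eventually.of_forall fun x => ?_
      exact Set.indicator_of_notMem (fun h => hq (localSet_subset_stepSet l t x h)) _
    · exact (h2.comp measurable_prodMk_right).aemeasurable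

lemma mixedDiff_congr_step {l : Fin d → ℕ} {ξ ξ' : Fin d → ℝ} (h : ∀ j, l j ≠ 0 → ξ j = ξ' j)
    (f : (Fin d → ℝ) → ℝ) (x : Fin d → ℝ) : mixedDiff l ξ f x = mixedDiff l ξ' f x := by
  refine Finset.sum_congr rfl fun k hk => ?_
  congr 2
  funext j
  by_cases hj : l j = 0
  · have : k j = 0 := Nat.le_zero.1 ((Finset.mem_Iic.1 hk j).trans hj.le)
    simp [this]
  · rw [h j hj]

lemma diffSet_congr_step {l : Fin d → ℕ} {ξ ξ' : Fin d → ℝ} (h : ∀ j, l j ≠ 0 → ξ j = ξ' j)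
    (y : Fin d → ℝ) : (ξ, y) ∈ diffSet l ↔ (ξ', y) ∈ diffSet l := by
  refine forall_congr' fun j => ?_
  by_cases hj : l j = 0
  · simp [hj]
  · simp only [h j hj]

lemma avgModulus_rpow {p : ℝ≥0∞} (hp : p ≠ 0) (hp' : p ≠ ⊤) (D : Set (Fin d → ℝ)) (l : Fin d → ℕ)
    (f : (Fin d → ℝ) → ℝ) (t : Fin d → ℝ) :
    avgModulus p D l f t ^ p.toReal = ENNReal.ofReal (∏ j ∈ supp l, (2 * t j)⁻¹) *
      ∫⁻ ξ in {ξ : supp l → ℝ | ∀ j, |ξ j| ≤ t j},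
        ∫⁻ y in diffDomain D l (extendVec (supp l) ξ),
          ‖mixedDiff l (extendVec (supp l) ξ) f y‖ₑ ^ p.toReal := by
  have h0 : p.toReal ≠ 0 := (ENNReal.toReal_pos hp hp').ne'
  rw [avgModulus, ← ENNReal.rpow_mul, one_div, inv_mul_cancel₀ h0, ENNReal.rpow_one]
  congr 1
  refine lintegral_congr fun ξ => ?_
  rw [eLpNorm_eq_lintegral_rpow_enorm_toReal hp hp', ← ENNReal.rpow_mul, one_div,
    inv_mul_cancel₀ h0, ENNReal.rpow_one]

/-- The steps outside `supp l` do not affect the difference and integrate to the side lengths `2 t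
j`. On `supp l` the same factors undo the normalisation of the averaged modulus, so the product over
all coordinates appears. -/
lemma lintegral_stepSet_le {f : (Fin d → ℝ) → ℝ} (hf : Measurable f) {p : ℝ≥0∞} (hp : p ≠ 0)
    (hp' : p ≠ ⊤) (l : Fin d → ℕ) {t : Fin d → ℝ} (ht : ∀ j, 0 < t j) :
    ∫⁻ q in stepSet l t, ‖mixedDiff l q.1 (zeroExt f) q.2‖ₑ ^ p.toReal ≤
      (∏ j, ENNReal.ofReal (2 * t j)) * avgModulus p (unitCube d) l f t ^ p.toReal := by
  have hF : Measurable (zeroExt f) :=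
    hf.indicator (MeasurableSet.univ_pi fun _ => measurableSet_Ioo)
  set g : (Fin d → ℝ) × (Fin d → ℝ) → ℝ≥0∞ := (diffSet l).indicator
    fun q => ‖mixedDiff l q.1 (zeroExt f) q.2‖ₑ ^ p.toReal with hg
  have hgm : Measurable g :=
    ((measurable_mixedDiff hF l).enorm.pow_const _).indicator (measurableSet_diffSet l)
  set H : (Fin d → ℝ) → ℝ≥0∞ := fun ξ => ∫⁻ y, g (ξ, y) with hH
  have hHm : Measurable H := hgm.lintegral_prod_right'
  have hHc : ∀ ξ ξ' : Fin d → ℝ, (∀ j, l j ≠ 0 → ξ j = ξ' j) → H ξ = H ξ' := by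
    intro ξ ξ' h
    refine lintegral_congr fun y => ?_
    by_cases hy : (ξ, y) ∈ diffSet l
    · rw [hg, Set.indicator_of_mem hy, Set.indicator_of_mem ((diffSet_congr_step h y).1 hy)]
      simp only [mixedDiff_congr_step h]
    · rw [hg, Set.indicator_of_notMem hy,
        Set.indicator_of_notMem fun h' => hy ((diffSet_congr_step h y).2 h')]
  have hHe : ∀ ξ, H ξ = ∫⁻ y in diffDomain (unitCube d) l ξ, ‖mixedDiff l ξ f y‖ₑ ^ p.toReal := by
    intro ξ
    have hm : MeasurableSet (diffDomain (unitCube d) l ξ) := by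
      have : diffDomain (unitCube d) l ξ = Prod.mk ξ ⁻¹' diffSet l := by
        ext y; exact mem_diffDomain_iff
      rw [this]; exact measurable_prodMk_left (measurableSet_diffSet l)
    rw [← lintegral_indicator hm]
    refine lintegral_congr fun y => ?_
    by_cases hy : y ∈ diffDomain (unitCube d) l ξ
    · rw [Set.indicator_of_mem hy, hg, Set.indicator_of_mem (mem_diffDomain_iff.1 hy)]
      simp only [mixedDiff_zeroExt f hy]
    · rw [Set.indicator_of_notMem hy, hg,
        Set.indicator_of_notMem (fun h => hy (mem_diffDomain_iff.2 h))]
  set J : Fin d → Prop := fun j => j ∈ supp l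
  set e := MeasurableEquiv.piEquivPiSubtypeProd (fun _ : Fin d => ℝ) J
  set u : (supp l → ℝ) → ℝ≥0∞ :=
    (Set.Icc (fun j : supp l => -t j) (fun j : supp l => t j)).indicator fun a => H (extendVec (supp l) a) with hu
  set v : ({j // ¬ J j} → ℝ) → ℝ≥0∞ :=
    (Set.Icc (fun j : {j // ¬ J j} => -t j) (fun j : {j // ¬ J j} => t j)).indicator fun _ => 1 with hv
  have hextm : Measurable (extendVec (supp l)) := by
    refine measurable_pi_lambda _ fun j => ?_
    by_cases hj : j ∈ supp l
    · simp only [extendVec, hj, dif_pos]; fun_prop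
    · simp only [extendVec, hj, dif_neg, not_false_eq_true]; fun_prop
  have hum : Measurable u := (hHm.comp hextm).indicator measurableSet_Icc
  have hvm : Measurable v := measurable_const.indicator measurableSet_Icc
  have hleft : ∫⁻ q in stepSet l t, ‖mixedDiff l q.1 (zeroExt f) q.2‖ₑ ^ p.toReal ≤
      ∫⁻ ξ, u (e ξ).1 * v (e ξ).2 := by
    rw [← lintegral_indicator (measurableSet_stepSet l t), Measure.volume_eq_prod,
      lintegral_prod _ (((measurable_mixedDiff hF l).enorm.pow_const _).indicator
        (measurableSet_stepSet l t)).aemeasurable]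
    refine lintegral_mono fun ξ => ?_
    by_cases hξ : ∀ j, |ξ j| ≤ t j
    · have h1 : (e ξ).1 ∈ Set.Icc (fun j : {j // J j} => -t j) (fun j => t j) :=
        ⟨fun j => (abs_le.1 (hξ j)).1, fun j => (abs_le.1 (hξ j)).2⟩
      have h2 : (e ξ).2 ∈ Set.Icc (fun j : {j // ¬ J j} => -t j) (fun j => t j) :=
        ⟨fun j => (abs_le.1 (hξ j)).1, fun j => (abs_le.1 (hξ j)).2⟩
      have h3 : u (e ξ).1 = H (extendVec (supp l) (e ξ).1) := Set.indicator_of_mem h1 _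
      have h4 : v (e ξ).2 = 1 := Set.indicator_of_mem h2 _
      rw [h3, h4, mul_one, hHc (extendVec (supp l) (e ξ).1) ξ]
      · refine lintegral_mono fun y => ?_
        refine Set.indicator_le_indicator_of_subset (fun q hq => hq.1) (fun _ => zero_le) _
      · intro j hj
        have hj' : j ∈ supp l := by simp [supp, hj]
        simp only [extendVec, hj', dif_pos]; rfl
    · refine le_of_eq_of_le ?_ zero_le
      rw [lintegral_eq_zero_iff' (by
        exact ((((measurable_mixedDiff hF l).enorm.pow_const _).indicator
          (measurableSet_stepSet l t)).comp measurable_prodMk_left).aemeasurable)]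
      exact Filter.Eventually.of_forall fun y => Set.indicator_of_notMem (fun h => hξ h.2) _
  refine hleft.trans (le_of_eq ?_)
  have hpres := volume_preserving_piEquivPiSubtypeProd (fun _ : Fin d => ℝ) J
  rw [hpres.lintegral_comp (f := fun z => u z.1 * v z.2)
    ((hum.comp measurable_fst).mul (hvm.comp measurable_snd)), Measure.volume_eq_prod]
  rw [lintegral_prod_mul hum.aemeasurable hvm.aemeasurable, avgModulus_rpow hp hp']
  have hbox : {ξ : supp l → ℝ | ∀ j, |ξ j| ≤ t j} =
      Set.Icc (fun j : supp l => -t j) (fun j : supp l => t j) := by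
    ext ξ
    simp only [Set.mem_ofPred_eq, abs_le, Set.mem_Icc, Pi.le_def, forall_and]
  have hv1 : ∫⁻ b, v b = ∏ j : {j // ¬ J j}, ENNReal.ofReal (2 * t j) := by
    rw [hv, lintegral_indicator measurableSet_Icc, setLIntegral_const, one_mul, Real.volume_Icc_pi]
    exact Finset.prod_congr rfl fun j _ => by rw [sub_neg_eq_add, two_mul]
  have hu1 : ∫⁻ a, u a = ∫⁻ ξ in {ξ : supp l → ℝ | ∀ j, |ξ j| ≤ t j},
        ∫⁻ y in diffDomain (unitCube d) l (extendVec (supp l) ξ),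
          ‖mixedDiff l (extendVec (supp l) ξ) f y‖ₑ ^ p.toReal := by
    rw [hu, lintegral_indicator measurableSet_Icc, hbox]
    exact lintegral_congr fun ξ => hHe _
  have hτ : (∏ j, ENNReal.ofReal (2 * t j)) * ENNReal.ofReal (∏ j ∈ supp l, (2 * t j)⁻¹) =
      ∏ j : {j // ¬ J j}, ENNReal.ofReal (2 * t j) := by
    have hp2 : ∀ j, 0 < 2 * t j := fun j => by linarith [ht j]
    rw [← Fintype.prod_subtype_mul_prod_subtype J, ENNReal.ofReal_prod_of_nonneg
      (fun j _ => (inv_pos.2 (hp2 j)).le), ← Finset.prod_coe_sort (supp l),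
      mul_right_comm]
    have h1 : (∏ j : supp l, ENNReal.ofReal (2 * t j)) *
        ∏ j : supp l, ENNReal.ofReal (2 * t j)⁻¹ = 1 := by
      rw [← Finset.prod_mul_distrib]
      refine Finset.prod_eq_one fun j _ => ?_
      rw [← ENNReal.ofReal_mul (hp2 _).le, mul_inv_cancel₀ (hp2 _).ne', ENNReal.ofReal_one]
    refine Eq.trans ?_ (one_mul _)
    rw [← h1]
    congr!
  rw [← hu1, hv1, ← mul_assoc, hτ, mul_comm]
  congr!

/-! ### Interpolation -/

/-- From `‖G‖_q^q ≤ (sup |G|)^(q-p) ‖G‖_p^p`. The exponent follows from `(q - p)/p = q(1/p - 1/q)`.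
-/
lemma eLpNorm_le_of_sup {X : Type*} [MeasurableSpace X] {μ : Measure X} {G : X → ℝ}
    (hG : AEStronglyMeasurable G μ) {p q : ℝ≥0∞} (hp : p ≠ 0) (hp' : p ≠ ⊤) (hpq : p ≤ q) {P τ : ℝ≥0∞}
    (hS : ∀ x, ‖G x‖ₑ ≤ P * τ ^ (-p⁻¹.toReal)) (hP : eLpNorm G p μ ≤ P) :
    eLpNorm G q μ ≤ P * τ ^ (-(p⁻¹.toReal - q⁻¹.toReal)) := by
  rcases eq_or_ne q ⊤ with rfl | hq'
  · rw [ENNReal.inv_top, ENNReal.toReal_zero, sub_zero]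
    exact eLpNormEssSup_le_of_ae_enorm_bound (Filter.Eventually.of_forall hS)
  have hq : q ≠ 0 := fun h => hp (le_zero_iff.1 (h ▸ hpq))
  have hp0 := ENNReal.toReal_pos hp hp'
  have hq0 := ENNReal.toReal_pos hq hq'
  have hle : p.toReal ≤ q.toReal := ENNReal.toReal_mono hq' hpq
  rw [eLpNorm_eq_lintegral_rpow_enorm_toReal hp hp', one_div,
    ENNReal.rpow_inv_le_iff hp0] at hP
  rw [eLpNorm_eq_lintegral_rpow_enorm_toReal hq hq', one_div, ENNReal.rpow_inv_le_iff hq0,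
    ENNReal.toReal_inv, ENNReal.toReal_inv]
  rw [ENNReal.toReal_inv] at hS
  calc ∫⁻ x, ‖G x‖ₑ ^ q.toReal ∂μ
      ≤ ∫⁻ x, (P * τ ^ (-p.toReal⁻¹)) ^ (q.toReal - p.toReal) * ‖G x‖ₑ ^ p.toReal ∂μ := by
        refine lintegral_mono fun x => ?_
        have : ‖G x‖ₑ ^ q.toReal = ‖G x‖ₑ ^ (q.toReal - p.toReal) * ‖G x‖ₑ ^ p.toReal := by
          rw [← ENNReal.rpow_add_of_nonneg _ _ (sub_nonneg.2 hle) hp0.le, sub_add_cancel]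
        rw [this]
        gcongr
        exact hS x
    _ ≤ (P * τ ^ (-p.toReal⁻¹)) ^ (q.toReal - p.toReal) * ∫⁻ x, ‖G x‖ₑ ^ p.toReal ∂μ :=
        (lintegral_const_mul'' _ (hG.enorm.pow_const _)).le
    _ ≤ (P * τ ^ (-p.toReal⁻¹)) ^ (q.toReal - p.toReal) * P ^ p.toReal := by gcongr
    _ = (P * τ ^ (-(p.toReal⁻¹ - q.toReal⁻¹))) ^ q.toReal := by
        rw [ENNReal.mul_rpow_of_nonneg _ _ (sub_nonneg.2 hle),
          ENNReal.mul_rpow_of_nonneg _ _ hq0.le, mul_right_comm,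
          ← ENNReal.rpow_add_of_nonneg _ _ (sub_nonneg.2 hle) hp0.le, sub_add_cancel,
          ← ENNReal.rpow_mul, ← ENNReal.rpow_mul]
        congr 2
        field_simp

/-! ### The estimate of the derivatives -/

/-- Interpolation with `P = β τ² Ω`, where `β` is the size of the kernel and `Ω` the modulus. Hölder
on a set of measure at most `τ²` contributes `τ^(2 - 2/p)`. Integrating the local sets over `x`
supplies the missing `τ^(2/p)`, whereas enlarging them to `stepSet` supplies only `τ^(1/p)`, hence
the loss `τ^(-1/p)` in the sup bound. -/
lemma eLpNorm_opDeriv_le_of_le (L m α : Fin d → ℕ) {T : ℝ} (hT : ∀ j, 8 * (m j : ℝ) + 8 ≤ T)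
    (hT0 : 0 < T) {p : ℝ≥0∞} (hp1 : 1 ≤ p) (hp' : p ≠ ⊤) :
    ∃ B : ℝ, 0 < B ∧ ∀ (q : ℝ≥0∞), p ≤ q → ∀ (κ : Fin d → ℕ) (f : (Fin d → ℝ) → ℝ), Measurable f →
      Integrable (zeroExt f) →
      eLpNorm (opDeriv L m κ α (zeroExt f)) q volume ≤
        ENNReal.ofReal (B * ∏ j, (2 ^ κ j) ^ (α j + 2)) *
          (∏ j, ENNReal.ofReal (2 * (T * ((2 : ℝ) ^ κ j)⁻¹))) ^ (2 : ℝ) *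
          avgModulus p (unitCube d) (levelOrder L κ) f (fun j => T * ((2 : ℝ) ^ κ j)⁻¹) *
          (∏ j, ENNReal.ofReal (2 * (T * ((2 : ℝ) ^ κ j)⁻¹))) ^ (-(p⁻¹.toReal - q⁻¹.toReal)) := by
  obtain ⟨B, hB0, hB⟩ := exists_enorm_opDeriv_le L m α hT
  refine ⟨B, hB0, fun q hpq κ f hfm hF => ?_⟩
  have hp : p ≠ 0 := (zero_lt_one.trans_le hp1).ne'
  have hp0 := ENNReal.toReal_pos hp hp'
  have hp1' : 1 ≤ p.toReal := by
    rw [← ENNReal.toReal_one]; exact ENNReal.toReal_mono hp' hp1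
  have hFm : Measurable (zeroExt f) :=
    hfm.indicator (MeasurableSet.univ_pi fun _ => measurableSet_Ioo)
  set l := levelOrder L κ
  set t : Fin d → ℝ := fun j => T * ((2 : ℝ) ^ κ j)⁻¹ with ht
  have ht0 : ∀ j, 0 < t j := fun j => by positivity
  set τ := ∏ j, ENNReal.ofReal (2 * t j) with hτ
  have hτ0 : τ ≠ 0 := Finset.prod_ne_zero_iff.2 fun j _ =>
    (ENNReal.ofReal_pos.2 (by linarith [ht0 j])).ne'
  have hτ' : τ ≠ ⊤ := ENNReal.prod_ne_top fun j _ => ENNReal.ofReal_ne_top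
  set β := ENNReal.ofReal (B * ∏ j, (2 ^ κ j) ^ (α j + 2))
  set Ω := avgModulus p (unitCube d) l f t
  set g : (Fin d → ℝ) × (Fin d → ℝ) → ℝ := fun q => mixedDiff l q.1 (zeroExt f) q.2
  have hg : Measurable g := measurable_mixedDiff hFm l
  have hA : ∫⁻ q in stepSet l t, ‖g q‖ₑ ^ p.toReal ≤ τ * Ω ^ p.toReal :=
    lintegral_stepSet_le hfm hp hp' l ht0
  have hpt : ∀ x, ‖opDeriv L m κ α (zeroExt f) x‖ₑ ≤
      β * ((∫⁻ q in localSet l t x, ‖g q‖ₑ ^ p.toReal) ^ (1 / p.toReal) *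
        (τ * τ) ^ (1 - 1 / p.toReal)) := fun x =>
    (hB κ _ hF x).trans (mul_le_mul_right
      (lintegral_enorm_restrict_le hg hp1' _ (volume_localSet_le l x)) _)
  have hG := (integrable_opDeriv hF L m κ α).aestronglyMeasurable
  have h1p : 0 ≤ 1 - 1 / p.toReal := by
    rw [sub_nonneg, div_le_one hp0]; exact hp1'
  have hττ : (τ * τ) ^ (1 - 1 / p.toReal) = τ ^ (2 - 2 / p.toReal) := by
    rw [ENNReal.mul_rpow_of_nonneg _ _ h1p, ← ENNReal.rpow_add _ _ hτ0 hτ']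
    congr 1; ring
  rw [hττ] at hpt
  refine eLpNorm_le_of_sup hG hp hp' hpq (fun x => (hpt x).trans ?_) ?_
  · calc _ ≤ β * ((τ * Ω ^ p.toReal) ^ (1 / p.toReal) * τ ^ (2 - 2 / p.toReal)) := by
          gcongr
          exact (lintegral_mono_set (localSet_subset_stepSet l t x)).trans hA
      _ = β * τ ^ (2 : ℝ) * Ω * τ ^ (-p⁻¹.toReal) := by
          rw [ENNReal.mul_rpow_of_nonneg _ _ (by positivity), ← ENNReal.rpow_mul,
            mul_one_div_cancel hp0.ne', ENNReal.rpow_one, ENNReal.toReal_inv]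
          have h2 : τ ^ (2 : ℝ) * τ ^ (-p.toReal⁻¹) =
              τ ^ (1 / p.toReal) * τ ^ (2 - 2 / p.toReal) := by
            rw [← ENNReal.rpow_add _ _ hτ0 hτ', ← ENNReal.rpow_add _ _ hτ0 hτ']
            congr 1; field_simp; ring
          calc _ = β * Ω * (τ ^ (1 / p.toReal) * τ ^ (2 - 2 / p.toReal)) := by ring
            _ = _ := by rw [← h2]; ring
  · rw [eLpNorm_eq_lintegral_rpow_enorm_toReal hp hp', one_div, ENNReal.rpow_inv_le_iff hp0]
    set c := (β * τ ^ (2 - 2 / p.toReal)) ^ p.toReal with hc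
    have hc' : c ≠ ⊤ := ENNReal.rpow_ne_top_of_nonneg hp0.le
      (ENNReal.mul_ne_top ENNReal.ofReal_ne_top (ENNReal.rpow_ne_top_of_ne_zero hτ0 hτ'))
    calc ∫⁻ x, ‖opDeriv L m κ α (zeroExt f) x‖ₑ ^ p.toReal
        ≤ ∫⁻ x, c * ∫⁻ q in localSet l t x, ‖g q‖ₑ ^ p.toReal := by
          refine lintegral_mono fun x => ?_
          refine (ENNReal.rpow_le_rpow (hpt x) hp0.le).trans (le_of_eq ?_)
          rw [hc, mul_left_comm, mul_comm, ENNReal.mul_rpow_of_nonneg _ _ hp0.le,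
            ← ENNReal.rpow_mul, one_div_mul_cancel hp0.ne', ENNReal.rpow_one]
      _ = c * ∫⁻ x, ∫⁻ q in localSet l t x, ‖g q‖ₑ ^ p.toReal := lintegral_const_mul' _ _ hc'
      _ ≤ c * (τ * (τ * Ω ^ p.toReal)) := by
          gcongr
          exact (lintegral_lintegral_localSet_le l t (hg.enorm.pow_const _)).trans
            (mul_le_mul_right hA _)
      _ = (β * τ ^ (2 : ℝ) * Ω) ^ p.toReal := by
          rw [ENNReal.mul_rpow_of_nonneg _ _ hp0.le, ENNReal.mul_rpow_of_nonneg _ _ hp0.le, hc,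
            ENNReal.mul_rpow_of_nonneg _ _ hp0.le, ← ENNReal.rpow_mul, ← ENNReal.rpow_mul]
          have h2 : τ ^ (2 * p.toReal) = τ ^ ((2 - 2 / p.toReal) * p.toReal) * (τ * τ) := by
            rw [← sq, ← ENNReal.rpow_natCast τ 2, ← ENNReal.rpow_add _ _ hτ0 hτ']
            congr 1; push_cast; field_simp; ring
          rw [h2]; ring

lemma exists_opDeriv_eq_zero (m : Fin d → ℕ) : ∃ R : ℝ, ∀ (L κ α : Fin d → ℕ)
    (F : (Fin d → ℝ) → ℝ) (x : Fin d → ℝ), x ∉ Set.Icc (fun _ => -R) (fun _ => R) →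
      opDeriv L m κ α F x = 0 := by
  obtain ⟨R, hR⟩ := exists_bddSupp_opKernel m
  refine ⟨R, fun L κ α F x hx => ?_⟩
  rw [opDeriv]
  refine integral_eq_zero_of_ae (Filter.Eventually.of_forall fun y => ?_)
  have := prod_eq_zero_of_notMem (fun i => hR L κ i (α i) (y i)) hx
  simp only [this, mul_zero, Pi.zero_apply]

lemma memLp_opDeriv {F : (Fin d → ℝ) → ℝ} (hF : Integrable F) (L m κ α : Fin d → ℕ) (q : ℝ≥0∞) :
    MemLp (opDeriv L m κ α F) q volume := by
  obtain ⟨R, hR⟩ := exists_opDeriv_eq_zero m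
  obtain ⟨C, hC0, hC⟩ := exists_prod_opKernel_bound L m κ α
  have htop : MemLp (opDeriv L m κ α F) ⊤ volume := by
    refine memLp_top_of_bound (integrable_opDeriv hF L m κ α).aestronglyMeasurable
      (∫ y, ‖F y‖ * C) (Filter.Eventually.of_forall fun x => ?_)
    rw [opDeriv]
    refine (norm_integral_le_integral_norm _).trans
      (integral_mono_of_nonneg (Filter.Eventually.of_forall fun y => norm_nonneg _)
        (hF.norm.mul_const C) (Filter.Eventually.of_forall fun y => ?_))
    simp only [norm_mul]
    exact mul_le_mul_of_nonneg_left (hC x y) (norm_nonneg _)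
  exact htop.mono_exponent_of_measure_support_ne_top (fun x hx => hR L κ α F x hx)
    isCompact_Icc.measure_lt_top.ne le_top

/-- For `q < p` the function lives in a box independent of `κ`, so Hölder reduces the bound to `q =
p` at the price of a constant. -/
lemma exists_eLpNorm_opDeriv_le (L m α : Fin d → ℕ) {T : ℝ} (hT : ∀ j, 8 * (m j : ℝ) + 8 ≤ T)
    (hT0 : 0 < T) {p q : ℝ≥0∞} (hp1 : 1 ≤ p) (hp' : p ≠ ⊤) (hq1 : 1 ≤ q) :
    ∃ B : ℝ, 0 < B ∧ ∀ (κ : Fin d → ℕ) (f : (Fin d → ℝ) → ℝ), Measurable f →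
      Integrable (zeroExt f) →
      eLpNorm (opDeriv L m κ α (zeroExt f)) q volume ≤
        ENNReal.ofReal (B * ∏ j, (2 ^ κ j) ^ (α j + 2)) *
          (∏ j, ENNReal.ofReal (2 * (T * ((2 : ℝ) ^ κ j)⁻¹))) ^ (2 : ℝ) *
          avgModulus p (unitCube d) (levelOrder L κ) f (fun j => T * ((2 : ℝ) ^ κ j)⁻¹) *
          (∏ j, ENNReal.ofReal (2 * (T * ((2 : ℝ) ^ κ j)⁻¹))) ^
            (-max (p⁻¹.toReal - q⁻¹.toReal) 0) := by
  obtain ⟨B, hB0, hB⟩ := eLpNorm_opDeriv_le_of_le L m α hT hT0 hp1 hp'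
  have hpi : p⁻¹ ≠ ⊤ := ENNReal.inv_ne_top.2 (zero_lt_one.trans_le hp1).ne'
  have hqi : q⁻¹ ≠ ⊤ := ENNReal.inv_ne_top.2 (zero_lt_one.trans_le hq1).ne'
  rcases le_or_gt p q with hpq | hpq
  · refine ⟨B, hB0, fun κ f hfm hF => ?_⟩
    have hle : 0 ≤ p⁻¹.toReal - q⁻¹.toReal :=
      sub_nonneg.2 (ENNReal.toReal_mono hpi (ENNReal.inv_le_inv.2 hpq))
    rw [max_eq_left hle]
    exact hB q hpq κ f hfm hF
  · have hle : p⁻¹.toReal - q⁻¹.toReal ≤ 0 :=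
      sub_nonpos.2 (ENNReal.toReal_mono hqi (ENNReal.inv_le_inv.2 hpq.le))
    obtain ⟨R, hR⟩ := exists_opDeriv_eq_zero m
    set K : Set (Fin d → ℝ) := Set.Icc (fun _ => -R) (fun _ => R)
    set W : ℝ≥0∞ := volume K ^ (1 / q.toReal - 1 / p.toReal)
    have hW : W ≠ ⊤ := by
      refine ENNReal.rpow_ne_top_of_nonneg ?_ isCompact_Icc.measure_lt_top.ne
      rw [ENNReal.toReal_inv, ENNReal.toReal_inv] at hle
      rw [one_div, one_div]; linarith
    -- The added `1` only keeps the constant positive.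
    refine ⟨(W.toReal + 1) * B, by positivity, fun κ f hfm hF => ?_⟩
    rw [max_eq_right hle]
    have h1 := hB p le_rfl κ f hfm hF
    rw [sub_self] at h1
    have hG := (integrable_opDeriv hF L m κ α).aestronglyMeasurable
    have hsupp : ∀ r : ℝ≥0∞, eLpNorm (opDeriv L m κ α (zeroExt f)) r (volume.restrict K) =
        eLpNorm (opDeriv L m κ α (zeroExt f)) r volume := fun r =>
      eLpNorm_restrict_eq_of_support_subset fun x hx => by
        by_contra h
        exact hx (hR L κ α _ x h)
    have h2 := eLpNorm_le_eLpNorm_mul_rpow_measure_univ hpq.le (hG.restrict (s := K))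
    rw [hsupp, hsupp, Measure.restrict_apply_univ] at h2
    refine h2.trans ?_
    rw [mul_assoc (W.toReal + 1), ENNReal.ofReal_mul (by positivity)]
    have hW1 : W ≤ ENNReal.ofReal (W.toReal + 1) :=
      (ENNReal.ofReal_toReal hW).symm.le.trans (ENNReal.ofReal_le_ofReal (by linarith))
    calc _ ≤ _ := mul_le_mul' h1 hW1
      _ = _ := by ring

/-- Here the powers balance: `τ²` cancels the two surplus factors `2^{κ_j}` per coordinate, and
`τ^{-θ}` yields `2^{(κ, θ𝔢)}`. -/
lemma ofReal_level_factor {B T θ : ℝ} (hB : 0 < B) (hT : 0 < T) (κ α : Fin d → ℕ) :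
    ENNReal.ofReal (B * ∏ j, (2 ^ κ j) ^ (α j + 2)) *
      (∏ j, ENNReal.ofReal (2 * (T * ((2 : ℝ) ^ κ j)⁻¹))) ^ (2 : ℝ) *
      (∏ j, ENNReal.ofReal (2 * (T * ((2 : ℝ) ^ κ j)⁻¹))) ^ (-θ) =
    ENNReal.ofReal (B * (∏ _j : Fin d, (2 * T) ^ 2 * (2 * T) ^ (-θ)) *
      (2 : ℝ) ^ (∑ j, (κ j : ℝ) * ((α j : ℝ) + θ))) := by
  have h0 : ∀ j, 0 < 2 * (T * ((2 : ℝ) ^ κ j)⁻¹) := fun j => by positivity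
  rw [← ENNReal.ofReal_prod_of_nonneg fun j _ => (h0 j).le,
    ENNReal.ofReal_rpow_of_pos (Finset.prod_pos fun j _ => h0 j),
    ENNReal.ofReal_rpow_of_pos (Finset.prod_pos fun j _ => h0 j),
    ← ENNReal.ofReal_mul (by positivity), ← ENNReal.ofReal_mul (by positivity),
    Real.rpow_sum_of_pos two_pos, ← Real.finsetProd_rpow _ _ fun j _ => (h0 j).le,
    ← Real.finsetProd_rpow _ _ fun j _ => (h0 j).le, mul_assoc, mul_assoc, mul_assoc,
    ← Finset.prod_mul_distrib, ← Finset.prod_mul_distrib, ← Finset.prod_mul_distrib]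
  congr 2
  refine Finset.prod_congr rfl fun j _ => ?_
  have hk : (0 : ℝ) < 2 ^ κ j := by positivity
  have hk2 : (2 : ℝ) ^ ((κ j : ℝ) * ((α j : ℝ) + θ)) = (2 ^ κ j) ^ α j * (2 ^ κ j) ^ θ := by
    rw [Real.rpow_mul two_pos.le, Real.rpow_natCast, Real.rpow_add hk, Real.rpow_natCast]
  rw [hk2, ← mul_assoc 2 T, Real.mul_rpow (by positivity) (by positivity),
    Real.mul_rpow (z := -θ) (by positivity) (by positivity), Real.inv_rpow hk.le,
    Real.inv_rpow hk.le, Real.rpow_neg hk.le, inv_inv, Real.rpow_two, Real.rpow_two]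
  field_simp
  rw [pow_add, mul_comm]

/-! ### Independence of the representative -/

lemma zeroExt_ae_eq {f f₀ : (Fin d → ℝ) → ℝ} (h : f =ᵐ[volume.restrict (unitCube d)] f₀) :
    zeroExt f =ᵐ[volume] zeroExt f₀ :=
  (ae_eq_restrict_iff_indicator_ae_eq
    (MeasurableSet.univ_pi fun _ => measurableSet_Ioo)).1 h

lemma opDeriv_congr {F F₀ : (Fin d → ℝ) → ℝ} (h : F =ᵐ[volume] F₀) (L m κ α : Fin d → ℕ) :
    opDeriv L m κ α F = opDeriv L m κ α F₀ := by
  funext x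
  exact integral_congr_ae (h.mono fun y hy => by simp only [hy])

lemma avgModulus_congr {f f₀ : (Fin d → ℝ) → ℝ} (h : f =ᵐ[volume.restrict (unitCube d)] f₀)
    (p : ℝ≥0∞) (l : Fin d → ℕ) (t : Fin d → ℝ) :
    avgModulus p (unitCube d) l f t = avgModulus p (unitCube d) l f₀ t := by
  have key : ∀ ξ, eLpNorm (mixedDiff l ξ f) p (volume.restrict (diffDomain (unitCube d) l ξ)) =
      eLpNorm (mixedDiff l ξ f₀) p (volume.restrict (diffDomain (unitCube d) l ξ)) := by
    intro ξ
    have hm : MeasurableSet (diffDomain (unitCube d) l ξ) := by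
      have : diffDomain (unitCube d) l ξ = Prod.mk ξ ⁻¹' diffSet l := by
        ext y; exact mem_diffDomain_iff
      rw [this]; exact measurable_prodMk_left (measurableSet_diffSet l)
    refine eLpNorm_congr_ae ((ae_restrict_iff' hm).2 ?_)
    -- The two functions agree almost everywhere only on the cube, so the zero extensions are used.
    -- These agree almost everywhere on the whole space, and finitely many translates preserve this.
    have h1 : ∀ᵐ y, ∀ k ∈ Finset.Iic l, zeroExt f (y + fun j => (k j : ℝ) * ξ j) =
        zeroExt f₀ (y + fun j => (k j : ℝ) * ξ j) := by
      refine (Finset.eventually_all _).2 fun k _ => ?_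
      exact (measurePreserving_add_right volume _).quasiMeasurePreserving.ae (zeroExt_ae_eq h)
    filter_upwards [h1] with y hy hyD
    rw [← mixedDiff_zeroExt f hyD, ← mixedDiff_zeroExt f₀ hyD]
    exact Finset.sum_congr rfl fun k hk => congrArg _ (hy k hk)
  simp only [avgModulus, key]

lemma integrable_zeroExt {f : (Fin d → ℝ) → ℝ} {p : ℝ≥0∞} (hp : 1 ≤ p)
    (hf : MemLp f p (volume.restrict (unitCube d))) : Integrable (zeroExt f) := by
  have hfin : IsFiniteMeasure (volume.restrict (unitCube d)) := by
    refine ⟨?_⟩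
    rw [Measure.restrict_apply_univ, unitCube, Real.volume_pi_Ioo]
    exact ENNReal.prod_lt_top fun _ _ => ENNReal.ofReal_lt_top
  exact (integrable_indicator_iff (MeasurableSet.univ_pi fun _ => measurableSet_Ioo)).2
    (hf.integrable hp)

end MixedModulus

end

/-! ### The main estimate -/

theorem mainTheorem5 (d : ℕ) (hd : 1 ≤ d) (m : Fin d → ℕ) (hm : ∀ j, 1 ≤ m j) :
    ∃ c₂ : ℝ, 0 < c₂ ∧
      ∀ (l : Fin d → ℕ) (_ : ∀ j, 1 ≤ l j) (α : Fin d → ℕ) (_ : ∀ j, α j ≤ m j)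
        (p q : ℝ≥0∞) (_ : 1 ≤ p) (_ : p ≠ ⊤) (_ : 1 ≤ q),
        ∃ c₁ : ℝ, 0 < c₁ ∧
          ∀ (κ : Fin d → ℕ) (f : (Fin d → ℝ) → ℝ),
            MemLp f p (volume.restrict (unitCube d)) →
            ∃ G : (Fin d → ℝ) → ℝ,
              HasWeakDeriv α (opE (fun j => l j - 1) m κ (zeroExt f)) G ∧
              MemLp G q volume ∧
              eLpNorm G q volume ≤
                ENNReal.ofReal (c₁ * (2 : ℝ) ^
                  (∑ j, (κ j : ℝ) * ((α j : ℝ) + max (p⁻¹.toReal - q⁻¹.toReal) 0))) *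
                avgModulus p (unitCube d) (restrictTo l (supp κ)) f
                  (fun j => c₂ * ((2 : ℝ) ^ κ j)⁻¹) := by
  obtain ⟨T, hT0, hT⟩ : ∃ T : ℝ, 0 < T ∧ ∀ j, 8 * (m j : ℝ) + 8 ≤ T := by
    refine ⟨∑ i, 8 * (m i : ℝ) + 8, by positivity, fun j => ?_⟩
    have := Finset.single_le_sum (f := fun i => 8 * (m i : ℝ))
      (fun i _ => by positivity) (Finset.mem_univ j)
    linarith
  -- The threshold for `T` involves `m` alone, so `c₂ = T` is fixed before `l`, `α`, `p` and `q`.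
  refine ⟨T, hT0, fun l hl α hα p q hp hp' hq => ?_⟩
  obtain ⟨B, hB0, hB⟩ := exists_eLpNorm_opDeriv_le (fun j => l j - 1) m α hT hT0 hp hp' hq
  refine ⟨B * ∏ _j : Fin d, (2 * T) ^ 2 * (2 * T) ^ (-max (p⁻¹.toReal - q⁻¹.toReal) 0),
    by positivity, fun κ f hf => ?_⟩
  have hF := integrable_zeroExt hp hf
  refine ⟨opDeriv (fun j => l j - 1) m κ α (zeroExt f), hasWeakDeriv_opE hF hα,
    memLp_opDeriv hF _ m κ α q, ?_⟩
  -- Joint measurability of the mixed difference in `(ξ, y)` needs a measurable representative. Both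
  -- sides of the estimate are unchanged by passing to it.
  have hae := hf.1.ae_eq_mk
  have hae' := zeroExt_ae_eq hae
  have hlevel : levelOrder (fun j => l j - 1) κ = restrictTo l (supp κ) := by
    funext j
    simp only [levelOrder, restrictTo, supp, Finset.mem_filter, Finset.mem_univ, true_and,
      Nat.sub_add_cancel (hl j)]
  rw [opDeriv_congr hae', avgModulus_congr hae, ← hlevel, ← ofReal_level_factor hB0 hT0 κ α,
    mul_right_comm _ _ (avgModulus _ _ _ _ _)]
  exact hB κ _ hf.1.stronglyMeasurable_mk.measurable (hF.congr hae')
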